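/- Let $\widehat{\mathcal S}\subset\{-1,0,1\}^2\setminus\{(0,0)\}$ be a step set that is symmetric ($(i,j)\in\widehat{\mathcal S}\Rightarrow(j,i)\in\widehat{\mathcal S}$), contains neither $(-1,1)$ nor $(1,-1)$, and is not contained in a closed half-plane (there are eight such sets). Put $\mathcal S=\{(i-j,i):(i,j)\in\widehat{\mathcal S}\}$, let $0<t<1/|\mathcal S|$, and let $$K(x,y)=xy\Big(t\sum_{(i,j)\in\mathcal S}x^iy^j-1\Big)=a(x)y^2+b(x)y+c(x)=\widetilde a(y)x^2+\widetilde b(y)x+\widetilde c(y),$$ $d=b^2-4ac$ and $\widetilde d=\widetilde b^2-4\widetilde a\widetilde c$. Let $x_1<x_2$ (resp. $y_1<y_2$) be the zeros of $d$ (resp. $\widetilde d$) in the open unit disc; they are real. Let $y_3>1$ be the smallest zero of $\widetilde d$ in $(1,\infty)$ and $y_4\in(y_3,\infty]$ the last one ($y_4=\infty$ if $\deg\widetilde d=3$). Let $\sqrt{\widetilde d}$ be the branch that is analytic off $[y_1,y_2]\cup[y_3,y_4]$ and positive on $(y_2,y_3)$. Let $$\mathcal L=\{y\in\mathbb C: K(x,y)=0\text{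 for some }x\in[x_1,x_2]\},$$ and let $\mathcal G_{\mathcal L}$ be the open domain delimited by $\mathcal L$ and avoiding the real point at $+\infty$. Assume that $\mathcal L$ is bounded, i.e. that it is a closed curve with interior $\mathcal G_{\mathcal L}$. Write $Y(x_i)=-b(x_i)/(2a(x_i))$. Let $w$ be a conformal gluing function for $\mathcal G_{\mathcal L}$: $w$ is meromorphic and one-to-one (as a map to the Riemann sphere) on $\mathcal G_{\mathcal L}$, has finite limits on $\mathcal L$, also denoted $w$, and $w(y)=w(\overline y)$ for $y\in\mathcal L$. Assume that $\mathcal U=w(\mathcal L)\subset\mathbb R$. Let $v$ be the inverse function of $w$. Then $\mathcal U$ is the nondegenerate segment with ends $w(Y(x_2))$ and $w(Y(x_1))$. Orient it from $w(Y(x_2))$ to $w(Y(x_1))$. The left and right limits $v^+$ and $v^-$ of $v$ exist at every point of $\mathcal U$, and the index of $$u\longmapsto \frac{\sqrt{\widetilde d(v^-(u))}}{\sqrt{\widetilde d(v^+(u))}}$$ along $\mathcal U$, that is, $\frac1{2i\pi}$ times the variation along $\mathcal U$ of a continuous determination of its logarithm, equals $-1$. Moreover $\widetilde d$, which is a polynomial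 and so has no poles in $\mathcal G_{\mathcal L}$, has exactly two zeros in $\mathcal G_{\mathcal L}$, namely $y_1$ and $y_2$. -/

import Mathlib

open Filter Topology

noncomputable section

namespace ThreeQuadrant

/-! ### Step sets -/

/-- The symmetric small-step models without anti-diagonal jumps. The field `nondeg` (the steps do
not all lie in a closed half-plane) leaves exactly the eight genuinely two-dimensional models. -/
structure IsSymmetricModel (Shat : Finset (ℤ × ℤ)) : Prop where
  small : ∀ p ∈ Shat, |p.1| ≤ 1 ∧ |p.2| ≤ 1
  zero_notMem : ((0, 0) : ℤ × ℤ) ∉ Shat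
  symm : ∀ i j : ℤ, (i, j) ∈ Shat → (j, i) ∈ Shat
  no_nw : ((-1, 1) : ℤ × ℤ) ∉ Shat
  no_se : ((1, -1) : ℤ × ℤ) ∉ Shat
  nondeg : ∀ u v : ℤ, (u, v) ≠ (0, 0) → ∃ p ∈ Shat, 0 < u * p.1 + v * p.2

/-- The step set `{(i - j, i) : (i, j) ∈ Shat}` obtained by the change of variables
`(x, y) ↦ (x y, x⁻¹)`. -/
def changeSteps (Shat : Finset (ℤ × ℤ)) : Finset (ℤ × ℤ) :=
  Shat.image fun p => (p.1 - p.2, p.1)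

/-! ### The kernel and its discriminants

All exponents `i + 1` below are nonnegative on small steps. -/

variable (S : Finset (ℤ × ℤ)) (t : ℝ)

/-- The kernel `K(x, y) = x y (t ∑_{(i,j) ∈ S} x^i y^j - 1)`, written as a polynomial. -/
def kernel (x y : ℂ) : ℂ :=
  (t : ℂ) * ∑ p ∈ S, x ^ (p.1 + 1).toNat * y ^ (p.2 + 1).toNat - x * y

/-- `t x ∑_{(i, j) ∈ S} x^i` for a fixed second coordinate `j`. -/
def rowSum (j : ℤ) (x : ℂ) : ℂ :=
  (t : ℂ) * ∑ p ∈ S with p.2 = j, x ^ (p.1 + 1).toNat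

/-- `t y ∑_{(i, j) ∈ S} y^j` for a fixed first coordinate `i`. -/
def colSum (i : ℤ) (y : ℂ) : ℂ :=
  (t : ℂ) * ∑ p ∈ S with p.1 = i, y ^ (p.2 + 1).toNat

def coeffA (x : ℂ) : ℂ := rowSum S t 1 x
def coeffB (x : ℂ) : ℂ := rowSum S t 0 x - x
def coeffC (x : ℂ) : ℂ := rowSum S t (-1) x

def coeffATilde (y : ℂ) : ℂ := colSum S t 1 y
def coeffBTilde (y : ℂ) : ℂ := colSum S t 0 y - y
def coeffCTilde (y : ℂ) : ℂ := colSum S t (-1) y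

/-- `d(x)`, the discriminant of `K(x, y) = a(x) y² + b(x) y + c(x)`. -/
def disc (x : ℂ) : ℂ := coeffB S t x ^ 2 - 4 * coeffA S t x * coeffC S t x

/-- `d̃(y)`, the discriminant of `K(x, y) = ã(y) x² + b̃(y) x + c̃(y)`. -/
def discTilde (y : ℂ) : ℂ :=
  coeffBTilde S t y ^ 2 - 4 * coeffATilde S t y * coeffCTilde S t y

/-- `p < q` are the two zeros of the discriminant `f` in the open unit disc (they are real). -/
structure IsInnerBranchPair (f : ℂ → ℂ) (p q : ℝ) : Prop where
  lt : p < q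
  left_mem : p ∈ Set.Ioo (-1 : ℝ) 1
  right_mem : q ∈ Set.Ioo (-1 : ℝ) 1
  left_zero : f p = 0
  right_zero : f q = 0

/-- `q` is the third branch point: the smallest real zero of `f` beyond the unit disc on the
positive half-line. -/
def IsThirdBranchPoint (f : ℂ → ℂ) (q : ℝ) : Prop :=
  IsLeast {y : ℝ | 1 < y ∧ f y = 0} q

/-- The common value `Y(x) = -b(x) / (2 a(x))` of the two branches at a branch point `x`. -/
def branchValue (x : ℂ) : ℂ := -coeffB S t x / (2 * coeffA S t x)

/-- The function `√d̃`, with branch points `y₁ < y₂ < y₃` and `y₄` (possibly infinite): the branch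
that is analytic off the cuts `[y₁, y₂]` and `[y₃, y₄]` and positive on `(y₂, y₃)`. Here
`Complex.cpow` with exponent `1/2` is the principal root; the quotient under the last root is the
remaining factor of `d̃`, a real polynomial of degree at most one, positive on `(y₂, y₃)`. -/
def sqrtDiscTilde (y₁ y₂ y₃ : ℝ) (y : ℂ) : ℂ :=
  (y - y₂) * ((y - y₁) / (y - y₂)) ^ (1 / 2 : ℂ) * (y₃ - y) ^ (1 / 2 : ℂ) *
    (discTilde S t y / ((y - y₁) * (y - y₂) * (y₃ - y))) ^ (1 / 2 : ℂ)

/-- `sqrtDiscTilde` is a square root of `d̃`. -/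
theorem sqrtDiscTilde_sq {y₁ y₂ y₃ : ℝ} (h₁ : discTilde S t y₁ = 0) (h₂ : discTilde S t y₂ = 0)
    (h₃ : discTilde S t y₃ = 0) (y : ℂ) :
    sqrtDiscTilde S t y₁ y₂ y₃ y ^ 2 = discTilde S t y := by
  have hs : ∀ z : ℂ, (z ^ (1 / 2 : ℂ)) ^ 2 = z := fun z => by
    rw [one_div]; exact_mod_cast Complex.cpow_nat_inv_pow z (two_ne_zero)
  unfold sqrtDiscTilde
  rw [mul_pow, mul_pow, mul_pow, hs, hs, hs]
  by_cases e₁ : y = y₁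
  · subst e₁; simp [h₁]
  by_cases e₂ : y = y₂
  · subst e₂; simp [h₂]
  by_cases e₃ : y = y₃
  · subst e₃; simp [h₃]
  have n₁ := sub_ne_zero.2 e₁
  have n₂ := sub_ne_zero.2 e₂
  have n₃ := sub_ne_zero.2 (Ne.symm e₃)
  field_simp

/-! ### The curve and its domain -/

/-- The curve `𝓛 = {y : K(x, y) = 0 for some x ∈ [x₁, x₂]}`. -/
def curveL (x₁ x₂ : ℝ) : Set ℂ := {y | ∃ x ∈ Set.Icc x₁ x₂, kernel S t x y = 0}

end ThreeQuadrant

namespace ThreeQuadrant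

/-- The open domain delimited by a curve `L` and avoiding the real point at `+∞`: the points off
`L` whose connected component in the complement of `L` does not contain a real half-line
`[R, +∞)`. -/
def domainOf (L : Set ℂ) : Set ℂ :=
  {y | y ∈ Lᶜ ∧ ¬ ∃ R : ℝ, ∀ s : ℝ, R ≤ s → (s : ℂ) ∈ connectedComponentIn Lᶜ y}

/-! ### Conformal gluing functions -/

/-- The value of a meromorphic function in the Riemann sphere: `∞` at a pole. -/
def sphereValue (w : ℂ → ℂ) (y : ℂ) : OnePoint ℂ :=
  open Classical in if meromorphicOrderAt w y < 0 then OnePoint.infty else (w y : OnePoint ℂ)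

/-- `w` is a conformal gluing function for the domain `G` bounded by `L`. The values of `w` on `L`
are its limits from inside `G`. -/
structure IsConformalGluing (L G : Set ℂ) (w : ℂ → ℂ) : Prop where
  meromorphic : MeromorphicNFOn w G
  boundary_limit : ∀ y ∈ L, Tendsto w (𝓝[G] y) (𝓝 (w y))
  injOn : Set.InjOn (sphereValue w) G
  glue : ∀ y ∈ L, w y = w (starRingEnd ℂ y)

/-- The inverse function `v` of `w`, from the image of `G` back to `G`. -/
def inverseOn (G : Set ℂ) (w : ℂ → ℂ) (z : ℂ) : ℂ :=
  Function.invFunOn (sphereValue w) G (z : OnePoint ℂ)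

/-! ### Oriented segments, one-sided limits and the index -/

/-- The points strictly to the left of the line through `A` and `B`, oriented from `A` to `B`. -/
def leftSide (A B : ℂ) : Set ℂ := {z | 0 < ((z - A) / (B - A)).im}

/-- The points strictly to the right of the line through `A` and `B`, oriented from `A` to `B`. -/
def rightSide (A B : ℂ) : Set ℂ := {z | ((z - A) / (B - A)).im < 0}

/-- The index of `G` along the segment from `A` to `B` is `χ`: some continuous determination of
`log G` along the segment varies by `2 π i χ` from `A` to `B`. (In particular `G` is continuous and
nonvanishing on the segment.) -/
def HasIndex (G : ℂ → ℂ) (A B : ℂ) (χ : ℤ) : Prop :=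
  ∃ ℓ : ℝ → ℂ, ContinuousOn ℓ (Set.Icc 0 1) ∧
    (∀ s ∈ Set.Icc (0 : ℝ) 1, Complex.exp (ℓ s) = G (A + s * (B - A))) ∧
    ℓ 1 - ℓ 0 = 2 * Real.pi * Complex.I * χ

end ThreeQuadrant

end

noncomputable section

namespace ThreeQuadrant

/-! Boundedness of the curve forces `e = 1` (`e_eq_one`): otherwise x₁ = 0, and the two values of
Y(x) have product c/a, which blows up as x → 0. When e = 1, 0 < x₁, and for x in [x₁, x₂] the roots
of K(x, ·) are conjugate, with |y|² = c/a strictly decreasing in x and Re y = -b/(2a). The curve is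
therefore an upper arc from Y(x₁) = -R < 0 to Y(x₂) = r, where 0 < r < R, together with its mirror
image. Since |y| determines x, inside and outside can be separated by hand, without Jordan's
theorem; in particular the disc |y| < r is inside (`ball_subset_domainOf`).

The position of the branch points rests on convexity. Write Σ(x, y) for the sum of x^i y^j over the
steps. The function s ↦ Σ(x^s, y^s) is convex, and its value at s = 0 is the number of steps, which
is below 1/t. At (x, y) = (x₂, r) one has Σ = 1/t and ∂Σ/∂y = 0. The derivative at s = 1 is then
positive, which gives x₂² r < 1 (`sq_mul_lt_one`). For 0 ≤ s < 1 the sum is below 1/t, so K is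
negative at (x₂^s, r^s) and d̃(r^s) > 0 (`discTildePoly_pos`). Hence y₂ < r < y₃. The zeros y₁, y₂
are nonnegative and so lie in the disc; every other zero lies on [y₃, ∞), which the curve does not
meet.

To control the inverse v, follow the branch Y of smaller modulus, analytic off the cut [x₁, x₂]. Two
distinct roots of K(·, y) satisfy x x' y = 1, and x₂² r < 1 excludes this near the cut. So Y is
injective off the cut and maps into the domain. Its one-sided limits at a point of the cut are
conjugate points of the curve, where w takes the same value. Thus w ∘ Y is continuous across the
cut, hence holomorphic there by Painlevé's theorem, and it is injective (`exists_uniformization`).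
It is real on the cut, so it maps the cut onto the segment, and by Schwarz reflection it exchanges
the two sides. Near the segment and off it, v is Y composed with the inverse of w ∘ Y; its left
limit runs along the upper arc from r to -R and its right limit along the conjugate arc
(`exists_inverse_limits`).

Finally √d̃ commutes with conjugation off its cuts, so the quotient is exp(-2i arg √d̃(v⁺)). Along
an arc of the upper half-plane from (y₂, y₃) to (-∞, y₁) twice this argument goes from 0 to 2π,
which gives the index -1 (`hasIndex_of_arc`). -/

/-- The kernel and its coefficients, with the multiplicities `e, f, g, h` of the four symmetric
orbits of steps. -/
structure IsKernelModel (S : Finset (ℤ × ℤ)) (t e f g h : ℝ) : Prop where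
  e_mem : e = 0 ∨ e = 1
  f_mem : f = 0 ∨ f = 1
  g_mem : g = 0 ∨ g = 1
  h_mem : h = 0 ∨ h = 1
  ef : 1 ≤ e + f
  eg : 1 ≤ e + g
  fh : 1 ≤ f + h
  t_pos : 0 < t
  t_lt : t * (2 * e + 2 * f + g + h) < 1
  kernel_eq : ∀ x y : ℂ, kernel S t x y =
    t * (e * (x ^ 2 * y ^ 2 + y) + f * (1 + x ^ 2 * y) + g * (x * y ^ 2) + h * x) - x * y
  coeffA_eq : ∀ x : ℂ, coeffA S t x = t * (e * x ^ 2 + g * x)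
  coeffB_eq : ∀ x : ℂ, coeffB S t x = t * (e + f * x ^ 2) - x
  coeffC_eq : ∀ x : ℂ, coeffC S t x = t * (f + h * x)
  coeffATilde_eq : ∀ y : ℂ, coeffATilde S t y = t * (e * y ^ 2 + f * y)
  coeffBTilde_eq : ∀ y : ℂ, coeffBTilde S t y = t * (g * y ^ 2 + h) - y
  coeffCTilde_eq : ∀ y : ℂ, coeffCTilde S t y = t * (e * y + f)

/-! ### Step sets, the explicit kernel, and boundedness of the curve. -/

theorem IsSymmetricModel.subset {Shat : Finset (ℤ × ℤ)} (hShat : IsSymmetricModel Shat) :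
    Shat ⊆ {(1, 0), (0, 1), (-1, 0), (0, -1), (1, 1), (-1, -1)} := by
  rintro ⟨i, j⟩ hp
  obtain ⟨hi, hj⟩ := hShat.small _ hp
  have h0 := hShat.zero_notMem
  have h1 := hShat.no_nw
  have h2 := hShat.no_se
  simp only [abs_le] at hi hj
  obtain ⟨hi1, hi2⟩ := hi
  obtain ⟨hj1, hj2⟩ := hj
  interval_cases i <;> interval_cases j <;> simp_all

/-- Symmetry pairs the off-diagonal steps, so a model is given by four indicators: `e` and `f` for
the pairs of (1, 0) and (-1, 0), `g` and `h` for the diagonal steps (1, 1) and (-1, -1). -/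
theorem exists_sum_changeSteps {Shat : Finset (ℤ × ℤ)} (hShat : IsSymmetricModel Shat) :
    ∃ e f g h : ℝ, (e = 0 ∨ e = 1) ∧ (f = 0 ∨ f = 1) ∧ (g = 0 ∨ g = 1) ∧ (h = 0 ∨ h = 1) ∧
      1 ≤ e + f ∧ 1 ≤ e + g ∧ 1 ≤ f + h ∧
      ∀ F : ℤ × ℤ → ℂ, ∑ p ∈ changeSteps Shat, F p =
        e * (F (1, 1) + F (-1, 0)) + f * (F (-1, -1) + F (1, 0)) + g * F (0, 1) +
          h * F (0, -1) := by
  have m01 : ∀ p : Prop, ∀ _ : Decidable p, (if p then (1 : ℝ) else 0) = 0 ∨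
      (if p then (1 : ℝ) else 0) = 1 := fun p _ => by split_ifs <;> simp
  have h1 : ((0, 1) : ℤ × ℤ) ∈ Shat ↔ (1, 0) ∈ Shat :=
    ⟨hShat.symm _ _, hShat.symm _ _⟩
  have h2 : ((0, -1) : ℤ × ℤ) ∈ Shat ↔ (-1, 0) ∈ Shat :=
    ⟨hShat.symm _ _, hShat.symm _ _⟩
  have key : ∀ u v : ℤ, (u, v) ≠ (0, 0) →
      ((1, 0) ∈ Shat ∧ (0 < u ∨ 0 < v)) ∨ ((-1, 0) ∈ Shat ∧ (u < 0 ∨ v < 0)) ∨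
      ((1, 1) ∈ Shat ∧ 0 < u + v) ∨ ((-1, -1) ∈ Shat ∧ u + v < 0) := by
    intro u v huv
    obtain ⟨p, hp, hpos⟩ := hShat.nondeg u v huv
    have := hShat.subset hp
    simp only [Finset.mem_insert, Finset.mem_singleton] at this
    rcases this with rfl | rfl | rfl | rfl | rfl | rfl
    · exact Or.inl ⟨hp, Or.inl (by simpa using hpos)⟩
    · exact Or.inl ⟨h1.1 hp, Or.inr (by simpa using hpos)⟩
    · exact Or.inr (Or.inl ⟨hp, Or.inl (by simpa using hpos)⟩)
    · exact Or.inr (Or.inl ⟨h2.1 hp, Or.inr (by simpa using hpos)⟩)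
    · exact Or.inr (Or.inr (Or.inl ⟨hp, by simpa using hpos⟩))
    · exact Or.inr (Or.inr (Or.inr ⟨hp, by simp at hpos; omega⟩))
  -- These three half-planes are all that is needed of nondegeneracy: they give `e + f`, `e + g` and
  -- `f + h` at least one, in this order.
  have k1 := key 1 (-1) (by decide)
  have k2 := key 1 1 (by decide)
  have k3 := key (-1) (-1) (by decide)
  norm_num at k1 k2 k3
  refine ⟨if (1, 0) ∈ Shat then 1 else 0, if (-1, 0) ∈ Shat then 1 else 0,
    if (1, 1) ∈ Shat then 1 else 0, if (-1, -1) ∈ Shat then 1 else 0,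
    m01 _ _, m01 _ _, m01 _ _, m01 _ _, ?_, ?_, ?_, fun F => ?_⟩
  · rcases k1 with h | h <;> simp only [h, if_true] <;> split_ifs <;> norm_num
  · rcases k2 with h | h <;> simp only [h, if_true] <;> split_ifs <;> norm_num
  · rcases k3 with h | h <;> simp only [h, if_true] <;> split_ifs <;> norm_num
  unfold changeSteps
  rw [Finset.sum_image (by
    rintro ⟨i, j⟩ - ⟨k, l⟩ - hp
    simp only [Prod.mk.injEq] at hp ⊢
    omega)]
  rw [← Finset.inter_eq_right.2 hShat.subset, ← Finset.sum_ite_mem]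
  rw [Finset.sum_insert (by decide), Finset.sum_insert (by decide), Finset.sum_insert (by decide),
    Finset.sum_insert (by decide), Finset.sum_insert (by decide), Finset.sum_singleton]
  simp only [Finset.inter_eq_right.2 hShat.subset, h1, h2]
  split_ifs <;> norm_num <;> ring

theorem exists_isKernelModel {Shat S : Finset (ℤ × ℤ)} (hShat : IsSymmetricModel Shat)
    (hS : S = changeSteps Shat) {t : ℝ} (ht0 : 0 < t) (ht1 : t < 1 / (S.card : ℝ)) :
    ∃ e f g h : ℝ, IsKernelModel S t e f g h := by
  obtain ⟨e, f, g, h, he, hf, hg, hh, hef, heg, hfh, hsum⟩ := exists_sum_changeSteps hShat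
  rw [← hS] at hsum
  refine ⟨e, f, g, h, he, hf, hg, hh, hef, heg, hfh, ht0, ?_, ?_, ?_, ?_, ?_, ?_, ?_, ?_⟩
  · have hcard := hsum (fun _ => 1)
    have hc : (S.card : ℝ) = 2 * e + 2 * f + g + h := by
      simp only [Finset.sum_const, nsmul_eq_mul, mul_one] at hcard
      have : ((S.card : ℝ) : ℂ) = ((2 * e + 2 * f + g + h : ℝ) : ℂ) := by
        push_cast
        rw [hcard]
        ring
      exact_mod_cast this
    rw [← hc]
    -- An empty step set is excluded because `1 / 0 = 0` would contradict `0 < t < 1 / S.card`.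
    have hpos : 0 < (S.card : ℝ) := by
      by_contra hn
      have : (S.card : ℝ) = 0 := le_antisymm (not_lt.1 hn) (by positivity)
      rw [this] at ht1
      norm_num at ht1
      linarith
    exact (lt_div_iff₀ hpos).1 ht1
  · intro x y
    unfold kernel
    rw [hsum]
    norm_num
    left
    simp only [show Int.toNat 2 = 2 from rfl]
  all_goals
    intro x
    first
    | unfold coeffA | unfold coeffB | unfold coeffC
    | unfold coeffATilde | unfold coeffBTilde | unfold coeffCTilde
    simp only [rowSum, colSum]
    rw [Finset.sum_filter, hsum]
    norm_num
    try ring_nf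
    try tauto

namespace IsKernelModel

variable {S : Finset (ℤ × ℤ)} {t e f g h : ℝ}

theorem kernel_eq_quadratic (hm : IsKernelModel S t e f g h) (x y : ℂ) :
    kernel S t x y = coeffA S t x * y ^ 2 + coeffB S t x * y + coeffC S t x := by
  rw [hm.kernel_eq, hm.coeffA_eq, hm.coeffB_eq, hm.coeffC_eq]
  ring

/-- When `e = 0`, the point `x = 0` is a branch point at which both branches of `Y` blow up, so
that the curve is unbounded. -/
theorem e_eq_one (hm : IsKernelModel S t e f g h) {x₁ x₂ : ℝ}
    (hx : IsInnerBranchPair (disc S t) x₁ x₂) (hb : Bornology.IsBounded (curveL S t x₁ x₂)) :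
    e = 1 := by
  refine hm.e_mem.resolve_left fun he => ?_
  have ht := hm.t_pos
  have hf : f = 1 := hm.f_mem.resolve_left fun hf => by have := hm.ef; linarith
  have hg : g = 1 := hm.g_mem.resolve_left fun hg => by have := hm.eg; linarith
  have hh0 : 0 ≤ h := by rcases hm.h_mem with h | h <;> linarith
  have hh1 : h ≤ 1 := by rcases hm.h_mem with h | h <;> linarith
  subst he hf hg
  have htt := hm.t_lt
  have hd : ∀ x : ℝ, disc S t x = 0 →
      x * (t ^ 2 * x ^ 3 - 2 * t * x ^ 2 + (1 - 4 * t ^ 2 * h) * x - 4 * t ^ 2) = 0 := by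
    intro x h0
    rw [disc, hm.coeffA_eq, hm.coeffB_eq, hm.coeffC_eq] at h0
    have : ((x * (t ^ 2 * x ^ 3 - 2 * t * x ^ 2 + (1 - 4 * t ^ 2 * h) * x - 4 * t ^ 2) : ℝ) : ℂ)
        = 0 := by
      rw [← h0]; push_cast; ring
    exact_mod_cast this
  -- For x < 0 the cubic factor amounts to x (t x - 1)² = 4 t² (1 + h x), with sides of opposite
  -- signs.
  have hneg : ∀ x : ℝ, -1 < x → disc S t x = 0 → 0 ≤ x := by
    intro x hx1 h0
    by_contra! hx0
    rcases mul_eq_zero.1 (hd x h0) with h1 | h1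
    · exact hx0.ne h1
    · have : x * (t * x - 1) ^ 2 - 4 * t ^ 2 * (1 + h * x) = 0 := by linarith
      have h2 : x * (t * x - 1) ^ 2 ≤ 0 := mul_nonpos_of_nonpos_of_nonneg hx0.le (sq_nonneg _)
      have h3 : 0 < 1 + h * x := by nlinarith
      have h4 : 0 < 4 * t ^ 2 * (1 + h * x) := by positivity
      linarith
  have hx10 := hneg x₁ hx.left_mem.1 hx.left_zero
  have hx2 : 0 < x₂ := lt_of_le_of_lt hx10 hx.lt
  have hx1 : x₁ = 0 := by
    by_contra hne
    have hx1 : 0 < x₁ := lt_of_le_of_ne hx10 (Ne.symm hne)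
    have e1 := (mul_eq_zero.1 (hd x₁ hx.left_zero)).resolve_left hne
    have e2 := (mul_eq_zero.1 (hd x₂ hx.right_zero)).resolve_left hx2.ne'
    -- `m` is t² times the third root of the cubic. Positivity of the cubic at 1 makes that root
    -- less than 1, whereas the product of the three roots is 4.
    obtain ⟨m, hm'⟩ : ∃ m, m = 2 * t - t ^ 2 * (x₁ + x₂) := ⟨_, rfl⟩
    have hne : x₂ - x₁ ≠ 0 := (sub_pos.2 hx.lt).ne'
    have e3 : 1 - 4 * t ^ 2 * h = t ^ 2 * (x₁ * x₂) + m * (x₁ + x₂) := by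
      apply mul_left_cancel₀ hne
      rw [hm']
      linear_combination e2 - e1
    have e4 : m * (x₁ * x₂) = 4 * t ^ 2 := by
      rw [e3] at e1
      rw [hm'] at e1 ⊢
      linear_combination e1
    have hx1' := hx.left_mem.2
    have hx2' := hx.right_mem.2
    have hm1 : m < t ^ 2 := by
      have h1 : 0 < (1 - x₁) * (1 - x₂) * (t ^ 2 - m) := by
        have : (1 - x₁) * (1 - x₂) * (t ^ 2 - m) = (1 - t) ^ 2 - 4 * t ^ 2 - 4 * t ^ 2 * h := by
          linear_combination -e3 - e4 - hm'
        rw [this]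
        rcases hm.h_mem with h | h <;> subst h <;> nlinarith
      have h2 : 0 < (1 - x₁) * (1 - x₂) := mul_pos (by linarith) (by linarith)
      nlinarith [(pos_iff_pos_of_mul_pos h1).1 h2]
    have hp : x₁ * x₂ < 1 := by nlinarith
    have hp0 : 0 < x₁ * x₂ := mul_pos hx1 hx2
    nlinarith [sq_nonneg t, mul_lt_mul_of_pos_right hm1 hp0, pow_pos ht 2]
  -- As x₁ = 0, arbitrarily small x > 0 are allowed. The two values of Y(x) have product (1 + h x)/x
  -- ≥ 1/x, which exceeds R² once x ≤ 1/(R² + 1).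
  obtain ⟨R, hR⟩ := hb.exists_norm_le
  have hR0 : 0 < R ^ 2 + 1 := by positivity
  obtain ⟨x, hx0, hxx, hxR⟩ : ∃ x : ℝ, 0 < x ∧ x ≤ x₂ ∧ x ≤ 1 / (R ^ 2 + 1) :=
    ⟨min x₂ (1 / (R ^ 2 + 1)), lt_min hx2 (by positivity), min_le_left _ _, min_le_right _ _⟩
  obtain ⟨s, hs⟩ := IsAlgClosed.exists_pow_nat_eq (disc S t x) (n := 2) (by norm_num)
  have ha : coeffA S t x ≠ 0 := by
    rw [hm.coeffA_eq]
    simp only [Complex.ofReal_zero, zero_mul, Complex.ofReal_one, one_mul, zero_add]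
    exact_mod_cast (mul_pos ht hx0).ne'
  have hroot : ∀ r : ℂ, r ^ 2 = disc S t x →
      ‖(-coeffB S t x + r) / (2 * coeffA S t x)‖ ≤ R := by
    intro r hr
    refine hR _ ⟨x, ⟨by rw [hx1]; exact hx0.le, hxx⟩, ?_⟩
    rw [hm.kernel_eq_quadratic]
    rw [disc] at hr
    field_simp
    linear_combination hr
  have h1 := hroot s hs
  have h2 := hroot (-s) (by rw [neg_sq, hs])
  have h3 : (-coeffB S t x + s) / (2 * coeffA S t x) * ((-coeffB S t x + -s) / (2 * coeffA S t x)) =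
      (((1 + h * x) / x : ℝ) : ℂ) := by
    have : coeffC S t x / coeffA S t x = (((1 + h * x) / x : ℝ) : ℂ) := by
      have h1 : (x : ℂ) ≠ 0 := by exact_mod_cast hx0.ne'
      have h2 : (t : ℂ) ≠ 0 := by exact_mod_cast ht.ne'
      rw [hm.coeffA_eq, hm.coeffC_eq]
      push_cast
      field_simp
      ring
    rw [← this]
    rw [disc] at hs
    field_simp
    linear_combination -hs
  have h4 := mul_le_mul h1 h2 (norm_nonneg _) ((norm_nonneg _).trans h1)
  rw [← norm_mul, h3, Complex.norm_real, Real.norm_eq_abs] at h4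
  have h5 := (le_abs_self _).trans h4
  rw [div_le_iff₀ hx0] at h5
  rw [le_div_iff₀ hR0] at hxR
  nlinarith [mul_nonneg hh0 hx0.le]

end IsKernelModel

/-! ### The discriminant d and the inner branch points x₁, x₂. -/

/-- A polynomial of degree at most four with two distinct roots splits off two linear factors. -/
theorem quartic_factor_two {k : Type*} [Field k] {c₀ c₁ c₂ c₃ c₄ p q : k} (hpq : p ≠ q)
    (hp : c₄ * p ^ 4 + c₃ * p ^ 3 + c₂ * p ^ 2 + c₁ * p + c₀ = 0)
    (hq : c₄ * q ^ 4 + c₃ * q ^ 3 + c₂ * q ^ 2 + c₁ * q + c₀ = 0) (x : k) :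
    c₄ * x ^ 4 + c₃ * x ^ 3 + c₂ * x ^ 2 + c₁ * x + c₀ =
      (x - p) * (x - q) * (c₄ * x ^ 2 + (c₃ + c₄ * (p + q)) * x +
        (c₂ + c₃ * (p + q) + c₄ * (p ^ 2 + p * q + q ^ 2))) := by
  apply mul_left_cancel₀ (sub_ne_zero.2 hpq)
  linear_combination (x - q) * hp - (x - p) * hq

/-- A real quadratic polynomial, positive at `1` and at `-1`, whose roots have a product at least
one, is positive on `[-1, 1]`. -/
theorem quadratic_pos_of_product {a b c x : ℝ} (ha : 0 ≤ a) (hac : a ≤ c) (h1 : 0 < a + b + c)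
    (h2 : 0 < a - b + c) (hx1 : -1 ≤ x) (hx2 : x ≤ 1) : 0 < a * x ^ 2 + b * x + c := by
  -- With p the polynomial, p(x) = x p(1) + (1 - x)(c - a x) handles x > 0, and p(x) = -x p(-1) + (1
  -- + x)(c + a x) handles x < 0.
  rcases lt_trichotomy x 0 with hx | hx | hx
  · nlinarith [mul_pos h2 (neg_pos.2 hx), mul_nonneg (by linarith : 0 ≤ 1 + x)
      (by nlinarith : 0 ≤ c + a * x)]
  · subst hx
    nlinarith
  · nlinarith [mul_pos h1 hx, mul_nonneg (by linarith : 0 ≤ 1 - x)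
      (by nlinarith : 0 ≤ c - a * x)]

/-- The weights of a symmetric model whose curve is bounded. -/
structure IsWeights (t f g h : ℝ) : Prop where
  f_mem : f = 0 ∨ f = 1
  g_mem : g = 0 ∨ g = 1
  h_mem : h = 0 ∨ h = 1
  fh : 1 ≤ f + h
  t_pos : 0 < t
  t_lt : t * (2 + 2 * f + g + h) < 1

namespace IsWeights

variable {t f g h : ℝ}

theorem f_nonneg (hw : IsWeights t f g h) : 0 ≤ f := by rcases hw.f_mem with h | h <;> linarith
theorem f_le (hw : IsWeights t f g h) : f ≤ 1 := by rcases hw.f_mem with h | h <;> linarith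
theorem g_nonneg (hw : IsWeights t f g h) : 0 ≤ g := by rcases hw.g_mem with h | h <;> linarith
theorem h_nonneg (hw : IsWeights t f g h) : 0 ≤ h := by rcases hw.h_mem with h | h <;> linarith
theorem f_sq (hw : IsWeights t f g h) : f ^ 2 = f := by
  rcases hw.f_mem with h | h <;> rw [h] <;> norm_num
theorem g_sq (hw : IsWeights t f g h) : g ^ 2 = g := by
  rcases hw.g_mem with h | h <;> rw [h] <;> norm_num
theorem h_sq (hw : IsWeights t f g h) : h ^ 2 = h := by
  rcases hw.h_mem with h | h <;> rw [h] <;> norm_num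

theorem t_lt_third (hw : IsWeights t f g h) : t < 1 / 3 := by
  have := hw.t_lt
  have := hw.fh
  have := hw.f_nonneg
  have := hw.g_nonneg
  have := hw.t_pos
  nlinarith

end IsWeights

/-- The discriminant in `x`, over any commutative ring. -/
def discPoly {k : Type*} [CommRing k] (t f g h x : k) : k :=
  (t * (1 + f * x ^ 2) - x) ^ 2 - 4 * (t * (x ^ 2 + g * x)) * (t * (f + h * x))

/-- The discriminant in `y`, over any commutative ring. -/
def discTildePoly {k : Type*} [CommRing k] (t f g h y : k) : k :=
  (t * (g * y ^ 2 + h) - y) ^ 2 - 4 * (t * (y ^ 2 + f * y)) * (t * (y + f))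

theorem ofReal_discPoly (t f g h x : ℝ) :
    ((discPoly t f g h x : ℝ) : ℂ) = discPoly (t : ℂ) f g h x := by
  simp [discPoly]

theorem ofReal_discTildePoly (t f g h x : ℝ) :
    ((discTildePoly t f g h x : ℝ) : ℂ) = discTildePoly (t : ℂ) f g h x := by
  simp [discTildePoly]

namespace IsWeights

variable {t f g h : ℝ}

/-- On [-1, 0] one has b ≥ t - x, so b² ≥ t² + x², whereas 4ac ≤ 4t²x² and 4t² < 1. Hence no branch
point of the unit disc lies in (-1, 0]. -/
theorem discPoly_pos_of_nonpos (hw : IsWeights t f g h) {x : ℝ} (hx : -1 ≤ x) (hx0 : x ≤ 0) :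
    0 < discPoly t f g h x := by
  have h1 : (x ^ 2 + g * x) * (f + h * x) ≤ x ^ 2 := by
    have e : (x ^ 2 + g * x) * (f + h * x) = f * x ^ 2 + g * f * x + h * x * x ^ 2
      + g * h * x ^ 2 := by ring
    have := hw.fh
    have a1 : 0 ≤ x ^ 2 * (1 + x) := mul_nonneg (sq_nonneg _) (by linarith)
    have a2 : 0 ≤ x ^ 2 := sq_nonneg _
    have a3 : 0 ≤ x ^ 2 * (-x) := mul_nonneg a2 (by linarith)
    have a4 : 0 ≤ (-x) * (1 + x) := mul_nonneg (by linarith) (by linarith)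
    rcases hw.f_mem with rfl | rfl <;> rcases hw.g_mem with rfl | rfl <;>
      rcases hw.h_mem with rfl | rfl <;> nlinarith
  have h2 : t ^ 2 < 1 / 9 := by nlinarith [hw.t_pos, hw.t_lt_third]
  have h3 : t ^ 2 + x ^ 2 ≤ (t * (1 + f * x ^ 2) - x) ^ 2 := by
    have := hw.t_pos
    have h4 : t ≤ t * (1 + f * x ^ 2) := by
      have := mul_nonneg hw.f_nonneg (sq_nonneg x)
      nlinarith
    nlinarith [mul_nonneg this.le (neg_nonneg.2 hx0)]
  unfold discPoly
  nlinarith [sq_nonneg x, pow_pos hw.t_pos 2, mul_le_mul_of_nonneg_left h1 (sq_nonneg t)]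

/-- At 1 the bound on t says that -b > a + c, and (a + c)² ≥ 4ac. -/
theorem discPoly_one_pos (hw : IsWeights t f g h) : 0 < discPoly t f g h 1 := by
  have ht := hw.t_pos
  have h1 := hw.t_lt
  have := hw.f_nonneg
  have := hw.g_nonneg
  have := hw.h_nonneg
  unfold discPoly
  have h2 : 0 < t * (1 + g + f + h) := by positivity
  have h3 : (t * (1 + g + f + h)) ^ 2 < (1 - t * (1 + f)) ^ 2 := by
    apply pow_lt_pow_left₀ _ h2.le (by norm_num)
    linarith
  nlinarith [sq_nonneg (t * (1 + g - (f + h)))]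

theorem discPoly_eq {k : Type*} [CommRing k] {t f g h : k} (hf : f ^ 2 = f) (x : k) :
    discPoly t f g h x = t ^ 2 * f * x ^ 4 + -(2 * t * f + 4 * t ^ 2 * h) * x ^ 3 +
      (1 - 2 * t ^ 2 * f - 4 * t ^ 2 * g * h) * x ^ 2 + -(2 * t + 4 * t ^ 2 * g * f) * x +
      t ^ 2 := by
  unfold discPoly
  linear_combination (t ^ 2 * x ^ 4) * hf

/-- The two zeros of `d` in the unit disc are positive, and the cofactor is positive on
`[-1, 1]`. -/
theorem exists_disc_factor (hw : IsWeights t f g h) {x₁ x₂ : ℝ} (hlt : x₁ < x₂)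
    (h1 : x₁ ∈ Set.Ioo (-1 : ℝ) 1) (h2 : x₂ ∈ Set.Ioo (-1 : ℝ) 1)
    (e1 : discPoly t f g h x₁ = 0) (e2 : discPoly t f g h x₂ = 0) :
    0 < x₁ ∧ ∃ q₂ q₁ q₀ : ℝ,
      (∀ x : ℝ, discPoly t f g h x = (x - x₁) * (x - x₂) * (q₂ * x ^ 2 + q₁ * x + q₀)) ∧
      (∀ z : ℂ, discPoly (t : ℂ) f g h z =
        (z - x₁) * (z - x₂) * (q₂ * z ^ 2 + q₁ * z + q₀)) ∧
      (∀ x : ℝ, -1 ≤ x → x ≤ 1 → 0 < q₂ * x ^ 2 + q₁ * x + q₀) := by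
  have hx1 : 0 < x₁ := by
    by_contra! hn
    exact (hw.discPoly_pos_of_nonpos h1.1.le hn).ne' e1
  refine ⟨hx1, ?_⟩
  have hfac := quartic_factor_two hlt.ne ((discPoly_eq hw.f_sq x₁).symm.trans e1)
    ((discPoly_eq hw.f_sq x₂).symm.trans e2)
  have hfsq : (f : ℂ) ^ 2 = f := by exact_mod_cast hw.f_sq
  have hfacC := quartic_factor_two (k := ℂ) (p := x₁) (q := x₂) (by exact_mod_cast hlt.ne)
    ((discPoly_eq hfsq (x₁ : ℂ)).symm.trans (by rw [← ofReal_discPoly, e1, Complex.ofReal_zero]))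
    ((discPoly_eq hfsq (x₂ : ℂ)).symm.trans (by rw [← ofReal_discPoly, e2, Complex.ofReal_zero]))
  simp only [← discPoly_eq hw.f_sq] at hfac
  simp only [← discPoly_eq hfsq] at hfacC
  obtain ⟨q₁, hq₁⟩ : ∃ q₁, q₁ = -(2 * t * f + 4 * t ^ 2 * h) + t ^ 2 * f * (x₁ + x₂) := ⟨_, rfl⟩
  obtain ⟨q₀, hq₀⟩ : ∃ q₀, q₀ = 1 - 2 * t ^ 2 * f - 4 * t ^ 2 * g * h +
    -(2 * t * f + 4 * t ^ 2 * h) * (x₁ + x₂) + t ^ 2 * f * (x₁ ^ 2 + x₁ * x₂ + x₂ ^ 2) := ⟨_, rfl⟩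
  rw [← hq₁, ← hq₀] at hfac
  refine ⟨t ^ 2 * f, q₁, q₀, hfac, fun z => by rw [hfacC, hq₁, hq₀]; push_cast; rfl, fun x hx hx' => ?_⟩
  have p1 := hw.discPoly_one_pos
  have p2 := hw.discPoly_pos_of_nonpos le_rfl (by norm_num)
  have p0 : discPoly t f g h 0 = t ^ 2 := by rw [discPoly_eq hw.f_sq]; ring
  rw [hfac] at p0 p1 p2
  have hx2 := hx1.trans hlt
  have s1 : 0 < (1 - x₁) * (1 - x₂) := mul_pos (by linarith [h1.2]) (by linarith [h2.2])
  have s2 : 0 < (-1 - x₁) * (-1 - x₂) := mul_pos_of_neg_of_neg (by linarith) (by linarith)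
  have s0 : 0 < x₁ * x₂ := mul_pos hx1 hx2
  have s0' : x₁ * x₂ < 1 := by nlinarith [h1.2, h2.2]
  have ht := pow_pos hw.t_pos 2
  refine quadratic_pos_of_product (mul_nonneg (sq_nonneg t) hw.f_nonneg) ?_ ?_ ?_ hx hx'
  -- Evaluating at 0 gives x₁ x₂ q₀ = t² with 0 < x₁ x₂ < 1. So q₀ ≥ t² f, the condition on the
  -- product of the outer roots.
  · have : 0 < q₀ := by
      have : 0 < x₁ * x₂ * q₀ := by nlinarith
      exact (pos_iff_pos_of_mul_pos this).1 s0
    nlinarith [hw.f_le]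
  · have := (pos_iff_pos_of_mul_pos p1).1 s1
    linarith
  · have := (pos_iff_pos_of_mul_pos p2).1 s2
    linarith

/-- `b` changes sign between the two inner branch points. -/
theorem coeffB_sign (hw : IsWeights t f g h) {x₁ x₂ : ℝ} (hlt : x₁ < x₂)
    (h1 : x₁ ∈ Set.Ioo (-1 : ℝ) 1) (h2 : x₂ ∈ Set.Ioo (-1 : ℝ) 1)
    (e1 : discPoly t f g h x₁ = 0) (e2 : discPoly t f g h x₂ = 0) :
    0 < t * (1 + f * x₁ ^ 2) - x₁ ∧ t * (1 + f * x₂ ^ 2) - x₂ < 0 := by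
  obtain ⟨hx1, q₂, q₁, q₀, hfac, -, hq⟩ := hw.exists_disc_factor hlt h1 h2 e1 e2
  have ht := hw.t_pos
  have hac : ∀ x : ℝ, 0 < x → 0 < 4 * (t * (x ^ 2 + g * x)) * (t * (f + h * x)) := by
    intro x hx
    have a1 : 0 < f + h * x := by
      have := hw.fh
      rcases hw.f_mem with rfl | rfl <;> rcases hw.h_mem with rfl | rfl <;> linarith
    have a2 : 0 ≤ g * x := mul_nonneg hw.g_nonneg hx.le
    positivity
  have hcont : ∀ s : Set ℝ, ContinuousOn (fun x : ℝ => t * (1 + f * x ^ 2) - x) s := by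
    intro s; fun_prop
  -- Where d ≥ 0 and x > 0, b cannot vanish, since then d = -4ac < 0. So b keeps its sign from b(0)
  -- = t up to x₁, and from x₂ up to b(1) ≤ 0.
  have hzero : ∀ x : ℝ, 0 < x → discPoly t f g h x ≥ 0 → t * (1 + f * x ^ 2) - x ≠ 0 := by
    intro x hx hd h0
    have := hac x hx
    rw [discPoly, h0] at hd
    linarith
  constructor
  · by_contra! hn
    obtain ⟨x, hx, h0⟩ := intermediate_value_Icc' hx1.le (hcont _)
      (show (0 : ℝ) ∈ Set.Icc _ _ from ⟨hn, by norm_num; exact ht.le⟩)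
    have hx0 : 0 < x := by
      rcases hx.1.lt_or_eq with h | h
      · exact h
      · subst h; norm_num at h0; exact absurd h0 ht.ne'
    refine hzero x hx0 ?_ h0
    rw [hfac]
    have := hq x (by linarith) (by linarith [hx.2, h1.2])
    exact mul_nonneg (mul_nonneg_of_nonpos_of_nonpos (by linarith [hx.2])
      (by linarith [hx.2])) this.le
  · by_contra! hn
    have hb1 : t * (1 + f * 1 ^ 2) - 1 ≤ 0 := by
      have := hw.t_lt
      have := mul_nonneg ht.le hw.f_nonneg
      have := mul_nonneg ht.le hw.g_nonneg
      have := mul_nonneg ht.le hw.h_nonneg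
      linarith
    obtain ⟨x, hx, h0⟩ := intermediate_value_Icc' h2.2.le (hcont _)
      (show (0 : ℝ) ∈ Set.Icc _ _ from ⟨hb1, hn⟩)
    refine hzero x (by linarith [hx.1]) ?_ h0
    rw [hfac]
    have := hq x (by linarith [hx.1]) hx.2
    exact mul_nonneg (mul_nonneg (by linarith [hx.1]) (by linarith [hx.1])) this.le

end IsWeights

/-! ### Convexity of the step polynomial and the zeros of d̃. -/

namespace IsWeights

variable {t f g h : ℝ}

/-- At a point of the positive quadrant where `K` and its `y`-derivative vanish, and whose first
coordinate is less than one, the other root in `x` is larger. -/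
theorem sq_mul_lt_one (hw : IsWeights t f g h) {x y : ℝ} (hx : 0 < x) (hx1 : x < 1) (hy : 0 < y)
    (hK : t * (x ^ 2 + g * x) * y ^ 2 + (t * (1 + f * x ^ 2) - x) * y + t * (f + h * x) = 0)
    (hKy : 2 * (t * (x ^ 2 + g * x)) * y + (t * (1 + f * x ^ 2) - x) = 0) :
    x ^ 2 * y < 1 := by
  have ht := hw.t_pos
  have hxy := mul_pos hx hy
  obtain ⟨u, hu⟩ : ∃ u, u = 1 / x := ⟨_, rfl⟩
  obtain ⟨v, hv⟩ : ∃ v, v = 1 / y := ⟨_, rfl⟩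
  have hux : u * x = 1 := by rw [hu]; field_simp
  have hvy : v * y = 1 := by rw [hv]; field_simp
  have hu0 : 0 < u := by rw [hu]; positivity
  have hv0 : 0 < v := by rw [hv]; positivity
  -- Summed over the monomials m of the step polynomial Σ, this is convexity of s ↦ Σ(x^s, y^s):
  -- Σ(1, 1) ≥ Σ - ∑ m log m. The sum ∑ m log m equals log x · x∂Σ/∂x + log y · y∂Σ/∂y, and its
  -- second term vanishes by `hKy`.
  have key : ∀ m : ℝ, 0 < m → m - 1 ≤ m * Real.log m := by
    intro m hm
    have h1 := Real.one_sub_inv_le_log_of_pos hm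
    have h2 := mul_le_mul_of_nonneg_left h1 hm.le
    rwa [mul_sub, mul_one, mul_inv_cancel₀ hm.ne'] at h2
  have k1 := key (x * y) hxy
  have k2 := key u hu0
  have k3 := key (u * v) (mul_pos hu0 hv0)
  have k4 := key x hx
  have k5 := key y hy
  have k6 := key v hv0
  have lu : Real.log u = -Real.log x := by rw [hu, one_div, Real.log_inv]
  have lv : Real.log v = -Real.log y := by rw [hv, one_div, Real.log_inv]
  rw [Real.log_mul hx.ne' hy.ne'] at k1
  rw [Real.log_mul hu0.ne' hv0.ne', lu, lv] at k3
  rw [lu] at k2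
  rw [lv] at k6
  have lx := Real.log_neg hx hx1
  set a := Real.log x
  set b := Real.log y
  have hS : t * (x * y + u + f * (u * v + x) + g * y + h * v) = 1 := by
    apply mul_right_cancel₀ hxy.ne'
    linear_combination hK + (t * y) * hux + t * f * (u * x * hvy + hux) + h * t * x * hvy
  have hSy : x * y - f * (u * v) + g * y - h * v = 0 := by
    apply mul_left_cancel₀ (mul_pos ht hxy).ne'
    have e1 : t * (x ^ 2 + g * x) * y ^ 2 - t * (f + h * x) = 0 := by
      linear_combination y * hKy - hK
    linear_combination e1 - t * f * (u * x * hvy + hux) - h * t * x * hvy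
  have hsum : 2 + 2 * f + g + h < x * y + u + f * (u * v + x) + g * y + h * v := by
    have := hw.t_lt
    rw [← hS] at this
    exact lt_of_mul_lt_mul_left this ht.le
  have hE : 0 < a * (x * y - u - f * (u * v) + f * x) := by
    have hf := hw.f_nonneg
    have hg := hw.g_nonneg
    have hh := hw.h_nonneg
    have m3 := mul_le_mul_of_nonneg_left k3 hf
    have m4 := mul_le_mul_of_nonneg_left k4 hf
    have m5 := mul_le_mul_of_nonneg_left k5 hg
    have m6 := mul_le_mul_of_nonneg_left k6 hh
    have e : b * (x * y - f * (u * v) + g * y - h * v) = 0 := by rw [hSy, mul_zero]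
    linarith
  have hE' : x * y - u - f * (u * v) + f * x < 0 := by
    by_contra! hn
    nlinarith
  -- The left side is x∂Σ/∂x, which has just been shown negative; its sign is that of x²y - 1.
  have e2 : x * y - u - f * (u * v) + f * x = (x ^ 2 * y - 1) * (u + f * (u * v)) := by
    linear_combination (-x * y) * hux - f * x * (u * x * hvy + hux)
  rw [e2] at hE'
  have : 0 < u + f * (u * v) := by
    have := mul_nonneg hw.f_nonneg (mul_pos hu0 hv0).le
    linarith
  nlinarith

theorem rpow_le_affine {m s : ℝ} (hm : 0 < m) (hs0 : 0 ≤ s) (hs1 : s ≤ 1) :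
    m ^ s ≤ 1 + s * (m - 1) := by
  have := rpow_one_add_le_one_add_mul_self (s := m - 1) (by linarith) hs0 hs1
  simpa using this

/-- `d̃` is positive between `1` and the extreme point of the oval `K = 0`. -/
theorem discTildePoly_pos (hw : IsWeights t f g h) {x r : ℝ} (hx : 0 < x) (hr : 0 < r)
    (hK : t * (x ^ 2 + g * x) * r ^ 2 + (t * (1 + f * x ^ 2) - x) * r + t * (f + h * x) = 0)
    (hne : x ^ 2 * r ≠ 1) {y : ℝ} (hy : y ∈ Set.uIcc r 1) :
    0 < discTildePoly t f g h y := by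
  have ht := hw.t_pos
  have hf := hw.f_nonneg
  have hg := hw.g_nonneg
  have hh := hw.h_nonneg
  -- Completing the square: d̃(Y) = (2ãX + b̃)² - 4ã K(X, Y). When ã > 0, one real X with K(X, Y) <
  -- 0 suffices.
  have hdisc : ∀ X Y : ℝ, discTildePoly t f g h Y =
      (2 * (t * (Y ^ 2 + f * Y)) * X + (t * (g * Y ^ 2 + h) - Y)) ^ 2 - 4 * (t * (Y ^ 2 + f * Y)) *
      (t * (X ^ 2 + g * X) * Y ^ 2 + (t * (1 + f * X ^ 2) - X) * Y + t * (f + h * X)) := by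
    intro X Y; unfold discTildePoly; ring
  obtain ⟨s, hs0, hs1, hs⟩ : ∃ s : ℝ, 0 ≤ s ∧ s ≤ 1 ∧ y = r ^ s := by
    have hc : ContinuousOn (fun s : ℝ => r ^ s) (Set.uIcc 1 0) :=
      (Real.continuous_const_rpow hr.ne').continuousOn
    have := intermediate_value_uIcc hc
    simp only [Real.rpow_one, Real.rpow_zero] at this
    obtain ⟨s, hs, e⟩ := this hy
    rw [Set.uIcc_of_ge zero_le_one] at hs
    exact ⟨s, hs.1, hs.2, e.symm⟩
  rcases hs1.lt_or_eq with hs1' | rfl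
  -- The witness lies on the curve s ↦ (x^s, r^s) joining (1, 1) to (x, r). Each monomial is at most
  -- its affine interpolation there, so the step polynomial stays below 1/t for s < 1.
  · obtain ⟨X, hX⟩ : ∃ X, X = x ^ s := ⟨_, rfl⟩
    have hX0 : 0 < X := by rw [hX]; positivity
    have hy0 : 0 < y := by rw [hs]; positivity
    have hxr := mul_pos hx hr
    have l1 := rpow_le_affine hxr hs0 hs1
    have l2 := rpow_le_affine (inv_pos.2 hx) hs0 hs1
    have l3 := rpow_le_affine (inv_pos.2 hxr) hs0 hs1
    have l4 := rpow_le_affine hx hs0 hs1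
    have l5 := rpow_le_affine hr hs0 hs1
    have l6 := rpow_le_affine (inv_pos.2 hr) hs0 hs1
    rw [Real.mul_rpow hx.le hr.le, ← hX, ← hs] at l1
    rw [Real.inv_rpow hx.le, ← hX] at l2
    rw [Real.inv_rpow hxr.le, Real.mul_rpow hx.le hr.le, ← hX, ← hs] at l3
    rw [← hX] at l4
    rw [← hs] at l5
    rw [Real.inv_rpow hr.le, ← hs] at l6
    have hS : t * (x * r + x⁻¹ + f * ((x * r)⁻¹ + x) + g * r + h * r⁻¹) = 1 := by
      field_simp
      linear_combination hK
    have hS' : t * (X * y + X⁻¹ + f * ((X * y)⁻¹ + X) + g * y + h * y⁻¹) < 1 := by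
      have m3 := mul_le_mul_of_nonneg_left l3 hf
      have m4 := mul_le_mul_of_nonneg_left l4 hf
      have m5 := mul_le_mul_of_nonneg_left l5 hg
      have m6 := mul_le_mul_of_nonneg_left l6 hh
      have hle : X * y + X⁻¹ + f * ((X * y)⁻¹ + X) + g * y + h * y⁻¹ ≤
          (1 - s) * (2 + 2 * f + g + h) +
          s * (x * r + x⁻¹ + f * ((x * r)⁻¹ + x) + g * r + h * r⁻¹) := by linarith
      have h1 := mul_le_mul_of_nonneg_left hle ht.le
      have h2 := mul_lt_mul_of_pos_left hw.t_lt (sub_pos.2 hs1')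
      have h3 : t * ((1 - s) * (2 + 2 * f + g + h) +
          s * (x * r + x⁻¹ + f * ((x * r)⁻¹ + x) + g * r + h * r⁻¹)) =
          (1 - s) * (t * (2 + 2 * f + g + h)) + s := by linear_combination s * hS
      linarith
    have hK' : t * (X ^ 2 + g * X) * y ^ 2 + (t * (1 + f * X ^ 2) - X) * y + t * (f + h * X) < 0 := by
      have h1 := mul_lt_mul_of_pos_left hS' (mul_pos hX0 hy0)
      have h2 : X * y * (t * (X * y + X⁻¹ + f * ((X * y)⁻¹ + X) + g * y + h * y⁻¹)) =
          t * (X ^ 2 * y ^ 2 + y + f * (1 + X ^ 2 * y) + g * (X * y ^ 2) + h * X) := by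
        field_simp
      rw [h2] at h1
      linarith
    rw [hdisc X y]
    have ha : 0 < t * (y ^ 2 + f * y) := by positivity
    nlinarith [sq_nonneg (2 * (t * (y ^ 2 + f * y)) * X + (t * (g * y ^ 2 + h) - y))]
  -- At s = 1 the kernel vanishes, and instead x² d̃ = (t (y + f))² (x² y - 1)², which is positive
  -- because x² r ≠ 1.
  · rw [Real.rpow_one] at hs
    subst hs
    have h1 : (x * discTildePoly t f g h y ) * x =
        (t * (y + f)) ^ 2 * (x ^ 2 * y - 1) ^ 2 := by
      have hb : x * (t * (g * y ^ 2 + h) - y) =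
        -(t * (y ^ 2 + f * y) * x ^ 2 + t * (y + f)) := by linear_combination hK
      unfold discTildePoly
      linear_combination (x * (t * (g * y ^ 2 + h) - y) -
        (t * (y ^ 2 + f * y) * x ^ 2 + t * (y + f))) * hb
    have h2 : 0 < (t * (y + f)) ^ 2 * (x ^ 2 * y - 1) ^ 2 := by
      have : 0 < (x ^ 2 * y - 1) ^ 2 := by
        have := sub_ne_zero.2 hne
        positivity
      positivity
    rw [← h1] at h2
    have h3 := (pos_iff_pos_of_mul_pos h2).2 hx
    exact (pos_iff_pos_of_mul_pos h3).1 hx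

/-- The product ãc̃ = t²(y + f)² y is nonpositive for y < 0, and b̃ > 0 there. -/
theorem discTildePoly_pos_of_neg (hw : IsWeights t f g h) {y : ℝ} (hy : y < 0) :
    0 < discTildePoly t f g h y := by
  have ht := hw.t_pos
  unfold discTildePoly
  have h1 : 0 < t * (g * y ^ 2 + h) - y := by
    have := hw.g_nonneg
    have := hw.h_nonneg
    have : 0 ≤ t * (g * y ^ 2 + h) := by positivity
    linarith
  have h2 : (t * (y ^ 2 + f * y)) * (t * (y + f)) = t ^ 2 * (y + f) ^ 2 * y := by ring
  have h3 : t ^ 2 * (y + f) ^ 2 * y ≤ 0 := mul_nonpos_of_nonneg_of_nonpos (by positivity) hy.le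
  nlinarith [pow_pos h1 2]

theorem discTildePoly_one_pos (hw : IsWeights t f g h) : 0 < discTildePoly t f g h 1 := by
  have ht := hw.t_pos
  have h1 := hw.t_lt
  have := hw.f_nonneg
  have := hw.g_nonneg
  have := hw.h_nonneg
  unfold discTildePoly
  have h2 : (2 * (t * (1 + f))) ^ 2 < (1 - t * (g + h)) ^ 2 := by
    apply pow_lt_pow_left₀ _ (by positivity) (by norm_num)
    linarith
  nlinarith

theorem discTildePoly_eq {k : Type*} [CommRing k] {t f g h : k} (hf : f ^ 2 = f) (hg : g ^ 2 = g)
    (hh : h ^ 2 = h) (y : k) :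
    discTildePoly t f g h y = t ^ 2 * g * y ^ 4 + -(2 * t * g + 4 * t ^ 2) * y ^ 3 +
      (1 + 2 * t ^ 2 * g * h - 8 * t ^ 2 * f) * y ^ 2 + -(2 * t * h + 4 * t ^ 2 * f) * y +
      t ^ 2 * h := by
  unfold discTildePoly
  linear_combination (t ^ 2 * y ^ 4) * hg + t ^ 2 * hh - 4 * t ^ 2 * y * hf

/-- Factorization of `d̃`: all its zeros are real and nonnegative, and all but `y₁` and `y₂` are at
least `y₃`. -/
theorem exists_discTilde_factor (hw : IsWeights t f g h) {y₁ y₂ y₃ : ℝ} (hlt : y₁ < y₂)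
    (h2 : y₂ < 1)
    (e1 : discTildePoly t f g h y₁ = 0) (e2 : discTildePoly t f g h y₂ = 0)
    (h3 : IsLeast {y : ℝ | 1 < y ∧ discTildePoly t f g h y = 0} y₃) :
    0 ≤ y₁ ∧ ∃ p q : ℝ,
      (∀ z : ℂ, discTildePoly (t : ℂ) f g h z = (z - y₁) * (z - y₂) * (y₃ - z) * (p - q * z)) ∧
      (∀ y : ℝ, y < y₃ → 0 < p - q * y) ∧
      (∀ z : ℂ, discTildePoly (t : ℂ) f g h z = 0 →
        z = y₁ ∨ z = y₂ ∨ ∃ s : ℝ, y₃ ≤ s ∧ z = s) := by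
  have ht := hw.t_pos
  have hy1 : 0 ≤ y₁ := by
    by_contra! hn
    exact (hw.discTildePoly_pos_of_neg hn).ne' e1
  refine ⟨hy1, ?_⟩
  obtain ⟨h31, e3⟩ := h3.1
  have hfac : ∀ y : ℝ, discTildePoly t f g h y = _ := fun y =>
    (discTildePoly_eq hw.f_sq hw.g_sq hw.h_sq y).trans
    (quartic_factor_two hlt.ne ((discTildePoly_eq hw.f_sq hw.g_sq hw.h_sq y₁).symm.trans e1)
    ((discTildePoly_eq hw.f_sq hw.g_sq hw.h_sq y₂).symm.trans e2) y)
  have hfsq : (f : ℂ) ^ 2 = f := by exact_mod_cast hw.f_sq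
  have hgsq : (g : ℂ) ^ 2 = g := by exact_mod_cast hw.g_sq
  have hhsq : (h : ℂ) ^ 2 = h := by exact_mod_cast hw.h_sq
  have hfacC : ∀ z : ℂ, discTildePoly (t : ℂ) f g h z = _ := fun z =>
    (discTildePoly_eq hfsq hgsq hhsq z).trans
    (quartic_factor_two (k := ℂ) (p := y₁) (q := y₂) (by exact_mod_cast hlt.ne)
    ((discTildePoly_eq hfsq hgsq hhsq (y₁ : ℂ)).symm.trans
      (by rw [← ofReal_discTildePoly, e1, Complex.ofReal_zero]))
    ((discTildePoly_eq hfsq hgsq hhsq (y₂ : ℂ)).symm.trans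
      (by rw [← ofReal_discTildePoly, e2, Complex.ofReal_zero])) z)
  obtain ⟨q₁, hq₁⟩ : ∃ q₁, q₁ = -(2 * t * g + 4 * t ^ 2) + t ^ 2 * g * (y₁ + y₂) := ⟨_, rfl⟩
  obtain ⟨q₀, hq₀⟩ : ∃ q₀, q₀ = 1 + 2 * t ^ 2 * g * h - 8 * t ^ 2 * f +
    -(2 * t * g + 4 * t ^ 2) * (y₁ + y₂) + t ^ 2 * g * (y₁ ^ 2 + y₁ * y₂ + y₂ ^ 2) := ⟨_, rfl⟩
  simp only [← hq₁, ← hq₀] at hfac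
  -- `q = 0` is the cubic case `g = 0`, in which y₄ is infinite; it has to be allowed throughout.
  obtain ⟨q, hq⟩ : ∃ q, q = t ^ 2 * g := ⟨_, rfl⟩
  have hq0 : 0 ≤ q := by rw [hq]; exact mul_nonneg (sq_nonneg t) hw.g_nonneg
  rw [← hq] at hfac
  have hr3 : q * y₃ ^ 2 + q₁ * y₃ + q₀ = 0 := by
    rw [hfac] at e3
    exact (mul_eq_zero.1 e3).resolve_left
      (mul_ne_zero (by linarith) (by linarith))
  have hfac' : ∀ z : ℂ, discTildePoly (t : ℂ) f g h z =
      (z - y₁) * (z - y₂) * (y₃ - z) * ((-q₁ - q * y₃ : ℝ) - q * z) := by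
    intro z
    have hr3' : (q : ℂ) * y₃ ^ 2 + q₁ * y₃ + q₀ = 0 := by exact_mod_cast hr3
    have e : ((t : ℂ) ^ 2 * g * z ^ 2 + (-(2 * t * g + 4 * t ^ 2) + t ^ 2 * g * (y₁ + y₂)) * z +
      (1 + 2 * t ^ 2 * g * h - 8 * t ^ 2 * f +
      -(2 * t * g + 4 * t ^ 2) * (y₁ + y₂) + t ^ 2 * g * (y₁ ^ 2 + y₁ * y₂ + y₂ ^ 2))) =
      q * z ^ 2 + q₁ * z + q₀ := by
      rw [hq, hq₁, hq₀]; push_cast; rfl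
    rw [hfacC, e]
    push_cast
    linear_combination ((z - y₁) * (z - y₂)) * hr3'
  have hp1 : 0 < (-q₁ - q * y₃) - q := by
    have := hw.discTildePoly_one_pos
    rw [hfac] at this
    have s1 : 0 < (1 - y₁) * (1 - y₂) := mul_pos (by linarith) (by linarith)
    have h4 := (pos_iff_pos_of_mul_pos this).1 s1
    have h5 : 0 < (y₃ - 1) * ((-q₁ - q * y₃) - q) := by linarith
    exact (pos_iff_pos_of_mul_pos h5).1 (by linarith)
  -- Positivity at 1 pushes the root of the affine factor beyond 1, and minimality of y₃ then pushes
  -- it to y₃ or further.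
  have hzero : ∀ s : ℝ, (-q₁ - q * y₃) - q * s = 0 → y₃ ≤ s := by
    intro s hs
    refine h3.2 ⟨?_, ?_⟩
    · by_contra! hn
      nlinarith
    · have := hfac' s
      rw [← ofReal_discTildePoly] at this
      have h6 : ((-q₁ - q * y₃ : ℝ) : ℂ) - q * s = 0 := by exact_mod_cast hs
      rw [h6, mul_zero] at this
      exact_mod_cast this
  refine ⟨-q₁ - q * y₃, q, hfac', fun y hy => ?_, fun z hz => ?_⟩
  · rcases hq0.eq_or_lt with h0 | h0
    · rw [← h0] at hp1 ⊢
      linarith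
    · by_contra! hn
      have := hzero ((-q₁ - q * y₃) / q) (by field_simp; ring)
      rw [le_div_iff₀ h0] at this
      nlinarith
  · rw [hfac'] at hz
    rcases mul_eq_zero.1 hz with hz | hz
    · rcases mul_eq_zero.1 hz with hz | hz
      · rcases mul_eq_zero.1 hz with hz | hz
        · exact Or.inl (sub_eq_zero.1 hz)
        · exact Or.inr (Or.inl (sub_eq_zero.1 hz))
      · exact Or.inr (Or.inr ⟨y₃, le_rfl, (sub_eq_zero.1 hz).symm⟩)
    · right; right
      rcases hq0.eq_or_lt with h0 | h0
      · rw [← h0] at hp1 hz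
        have : (-q₁ - 0 * y₃ : ℝ) = 0 := by
          have : ((-q₁ - 0 * y₃ : ℝ) : ℂ) = 0 := by simpa using hz
          exact_mod_cast this
        linarith
      · have hq' : (q : ℂ) ≠ 0 := by exact_mod_cast h0.ne'
        refine ⟨(-q₁ - q * y₃) / q, hzero _ (by field_simp; ring), ?_⟩
        rw [Complex.ofReal_div, eq_div_iff hq']
        linear_combination -hz

end IsWeights

/-! ### Inside and outside of the curve. -/

theorem isOpen_domainOf {L : Set ℂ} (hL : IsClosed L) : IsOpen (domainOf L) := by
  rw [isOpen_iff_mem_nhds]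
  rintro y ⟨hy, hy'⟩
  filter_upwards [(hL.isOpen_compl.connectedComponentIn (x := y)).mem_nhds
    (mem_connectedComponentIn hy)] with z hz
  refine ⟨connectedComponentIn_subset _ _ hz, ?_⟩
  rwa [← connectedComponentIn_eq hz]

theorem mem_domainOf_of_isPreconnected {L C : Set ℂ} (hC : IsPreconnected C) (hCL : C ⊆ Lᶜ)
    {x y : ℂ} (hx : x ∈ C) (hy : y ∈ C) (hxL : x ∈ domainOf L) : y ∈ domainOf L := by
  refine ⟨hCL hy, ?_⟩
  rw [← connectedComponentIn_eq (hC.subset_connectedComponentIn hx hCL hy)]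
  exact hxL.2

theorem ofReal_notMem_domainOf {L : Set ℂ} {r : ℝ} (h : ∀ s : ℝ, r ≤ s → (s : ℂ) ∉ L) :
    (r : ℂ) ∉ domainOf L := by
  rintro ⟨-, hn⟩
  refine hn ⟨r, fun s hs => ?_⟩
  have hC : IsPreconnected ((fun s : ℝ => (s : ℂ)) '' Set.Ici r) :=
    isPreconnected_Ici.image _ Complex.continuous_ofReal.continuousOn
  refine hC.subset_connectedComponentIn ⟨r, Set.self_mem_Ici, rfl⟩ ?_ ⟨s, hs, rfl⟩
  rintro _ ⟨s, hs, rfl⟩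
  exact h s hs

/-- A substitute for the Jordan curve theorem: a connected set off `L` that starts in `F` cannot
pass to `E`, since it would have to cross F ∩ E. It therefore stays bounded and never contains a
real half-line. -/
theorem mem_domainOf_of_separation {L F E : Set ℂ} (hF : IsClosed F) (hE : IsClosed E)
    (hFE : ∀ y, y ∈ F ∨ y ∈ E) (hL : F ∩ E ⊆ L) (hb : Bornology.IsBounded F) {y : ℂ}
    (hy : y ∈ F) (hyL : y ∉ L) : y ∈ domainOf L := by
  refine ⟨hyL, ?_⟩
  rintro ⟨R, hR⟩
  set C := connectedComponentIn Lᶜ y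
  have hC : IsPreconnected C := isPreconnected_connectedComponentIn
  have hCL : C ⊆ Lᶜ := connectedComponentIn_subset _ _
  obtain ⟨B, hB⟩ := hb.exists_norm_le
  have hs := hR (max R (|B| + 1)) (le_max_left _ _)
  have hsF : ((max R (|B| + 1) : ℝ) : ℂ) ∉ F := by
    intro h
    have h1 := hB _ h
    rw [Complex.norm_real, Real.norm_eq_abs] at h1
    have := le_max_right R (|B| + 1)
    have := le_abs_self (max R (|B| + 1))
    have := le_abs_self B
    linarith
  have hsE := (hFE _).resolve_left hsF
  obtain ⟨z, hzC, hz⟩ := isPreconnected_closed_iff.1 hC F E hF hE (fun z _ => hFE z)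
    ⟨y, mem_connectedComponentIn hyL, hy⟩ ⟨_, hs, hsE⟩
  exact hCL hzC (hL hz)

/-- A curve of points `y` with `a |y|² = c` and `2 a Re y + b = 0` along a parameter interval on
which `c / a` decreases from `R²` to `r²` encloses the disc of radius `r`. -/
theorem ball_subset_domainOf {a b c : ℝ → ℝ} {p q r R : ℝ} {L : Set ℂ} (hpq : p ≤ q)
    (ha : ContinuousOn a (Set.Icc p q)) (hb : ContinuousOn b (Set.Icc p q))
    (hc : ContinuousOn c (Set.Icc p q)) (hpos : ∀ x ∈ Set.Icc p q, 0 < a x)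
    (hanti : StrictAntiOn (fun x => c x / a x) (Set.Icc p q))
    (hr : 0 < r) (hrR : r < R) (hq : c q = a q * r ^ 2) (hp : c p = a p * R ^ 2)
    (hbq : b q = -2 * a q * r) (hbp : b p = 2 * a p * R)
    (hL : ∀ y : ℂ, (∃ x ∈ Set.Icc p q, a x * ‖y‖ ^ 2 = c x ∧ 2 * a x * y.re + b x = 0) ↔ y ∈ L) :
    Metric.ball 0 r ⊆ domainOf L := by
  have hmp : p ∈ Set.Icc p q := ⟨le_rfl, hpq⟩
  have hmq : q ∈ Set.Icc p q := ⟨hpq, le_rfl⟩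
  have hdiv : ∀ x ∈ Set.Icc p q, ∀ y : ℂ, a x * ‖y‖ ^ 2 = c x ↔ c x / a x = ‖y‖ ^ 2 := by
    intro x hx y
    rw [div_eq_iff (hpos x hx).ne', mul_comm, eq_comm]
  have hdq : c q / a q = r ^ 2 := by rw [hq, mul_div_cancel_left₀ _ (hpos q hmq).ne']
  have hdp : c p / a p = R ^ 2 := by rw [hp, mul_div_cancel_left₀ _ (hpos p hmp).ne']
  have hcd : ContinuousOn (fun x => c x / a x) (Set.Icc p q) :=
    hc.div ha fun x hx => (hpos x hx).ne'
  have hrange : ∀ x ∈ Set.Icc p q, ∀ y : ℂ, a x * ‖y‖ ^ 2 = c x → ‖y‖ ≤ R := by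
    intro x hx y h
    rw [hdiv x hx] at h
    have := hanti.antitoneOn hmp hx hx.1
    simp only [hdp, h] at this
    exact abs_le_of_sq_le_sq' this (hr.trans hrR).le |>.2
  have hrange' : ∀ x ∈ Set.Icc p q, ∀ y : ℂ, a x * ‖y‖ ^ 2 = c x → r ≤ ‖y‖ := by
    intro x hx y h
    rw [hdiv x hx] at h
    have := hanti.antitoneOn hx hmq hx.2
    simp only [hdq, h] at this
    exact abs_le_of_sq_le_sq' this (norm_nonneg y) |>.2
  have hclosed : ∀ σ : ℝ, IsClosed {y : ℂ | ∃ x ∈ Set.Icc p q, a x * ‖y‖ ^ 2 = c x ∧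
      0 ≤ σ * (2 * a x * y.re + b x)} := by
    intro σ
    have hK : IsClosed {z : ℝ × ℂ | z ∈ Set.Icc p q ×ˢ Set.univ ∧
        (a z.1 * ‖z.2‖ ^ 2 - c z.1 ∈ ({0} : Set ℝ) ∧
        σ * (2 * a z.1 * z.2.re + b z.1) ∈ Set.Ici (0 : ℝ))} := by
      have hs : IsClosed (Set.Icc p q ×ˢ (Set.univ : Set ℂ)) := isClosed_Icc.prod isClosed_univ
      have hmaps : Set.MapsTo Prod.fst (Set.Icc p q ×ˢ (Set.univ : Set ℂ)) (Set.Icc p q) :=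
        fun z hz => hz.1
      have ha' := ha.comp continuousOn_fst hmaps
      have hb' := hb.comp continuousOn_fst hmaps
      have hc' := hc.comp continuousOn_fst hmaps
      have e1 : ContinuousOn (fun z : ℝ × ℂ => a z.1 * ‖z.2‖ ^ 2 - c z.1)
          (Set.Icc p q ×ˢ (Set.univ : Set ℂ)) :=
        (ha'.mul (continuous_snd.norm.pow 2).continuousOn).sub hc'
      have e2 : ContinuousOn (fun z : ℝ × ℂ => σ * (2 * a z.1 * z.2.re + b z.1))
          (Set.Icc p q ×ˢ (Set.univ : Set ℂ)) :=
        continuousOn_const.mul (((continuousOn_const.mul ha').mul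
          (Complex.continuous_re.comp continuous_snd).continuousOn).add hb')
      have c1 := e1.preimage_isClosed_of_isClosed hs isClosed_singleton (t := ({0} : Set ℝ))
      have c2 := e2.preimage_isClosed_of_isClosed hs isClosed_Ici (t := Set.Ici (0 : ℝ))
      convert c1.inter c2 using 1
      ext z
      simp only [Set.mem_ofPred_eq, Set.mem_inter_iff, Set.mem_preimage]
      tauto
    have hcomp : IsCompact {z : ℝ × ℂ | z ∈ Set.Icc p q ×ˢ Set.univ ∧
        (a z.1 * ‖z.2‖ ^ 2 - c z.1 ∈ ({0} : Set ℝ) ∧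
        σ * (2 * a z.1 * z.2.re + b z.1) ∈ Set.Ici (0 : ℝ))} := by
      refine ((isCompact_Icc (a := p) (b := q)).prod
        (isCompact_closedBall (0 : ℂ) R)).of_isClosed_subset hK ?_
      rintro ⟨x, y⟩ ⟨hx, h1, h2⟩
      refine ⟨hx.1, ?_⟩
      rw [mem_closedBall_zero_iff]
      exact hrange x hx.1 y (sub_eq_zero.1 h1)
    convert (hcomp.image continuous_snd).isClosed using 1
    ext y
    constructor
    · rintro ⟨x, hx, h1, h2⟩
      exact ⟨(x, y), ⟨⟨hx, trivial⟩, sub_eq_zero.2 h1, h2⟩, rfl⟩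
    · rintro ⟨⟨x, y'⟩, ⟨hx, h1, h2⟩, rfl⟩
      exact ⟨x, hx.1, sub_eq_zero.1 h1, h2⟩
  have hmin := hclosed (-1)
  have hmax := hclosed 1
  -- In the annulus r ≤ |y| ≤ R the modulus determines x, and the sign of 2a Re y + b tells on which
  -- side of the curve y lies. `Tm` contains the whole circle |y| = r but only the point -R of |y| =
  -- R; for `Tp` the roles are reversed. This makes the two closed sets meet only on `L`.
  set Tm := {y : ℂ | ∃ x ∈ Set.Icc p q, a x * ‖y‖ ^ 2 = c x ∧ 0 ≤ -1 * (2 * a x * y.re + b x)}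
  set Tp := {y : ℂ | ∃ x ∈ Set.Icc p q, a x * ‖y‖ ^ 2 = c x ∧ 0 ≤ 1 * (2 * a x * y.re + b x)}
  intro y hy
  rw [mem_ball_zero_iff] at hy
  refine mem_domainOf_of_separation (F := Metric.closedBall 0 r ∪ Tm)
    (E := {y : ℂ | R ≤ ‖y‖} ∪ Tp) (Metric.isClosed_closedBall.union hmin)
    ((isClosed_le continuous_const continuous_norm).union hmax) ?_ ?_ ?_
    (Or.inl (by simpa using hy.le)) ?_
  · intro z
    by_cases h1 : ‖z‖ ≤ r
    · exact Or.inl (Or.inl (by simpa using h1))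
    by_cases h2 : R ≤ ‖z‖
    · exact Or.inr (Or.inl h2)
    push Not at h1 h2
    obtain ⟨x, hx, hxz⟩ := intermediate_value_Icc' hpq hcd
      (show ‖z‖ ^ 2 ∈ Set.Icc _ _ from ⟨by simp only [hdq]; gcongr, by simp only [hdp]; gcongr⟩)
    have hxz' := (hdiv x hx z).2 hxz
    rcases le_total 0 (2 * a x * z.re + b x) with h | h
    · exact Or.inr (Or.inr ⟨x, hx, hxz', by linarith⟩)
    · exact Or.inl (Or.inr ⟨x, hx, hxz', by linarith⟩)
  · rintro z ⟨hz1 | ⟨x, hx, hx1, hx2⟩, hz2 | ⟨x', hx', hx1', hx2'⟩⟩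
    · rw [mem_closedBall_zero_iff] at hz1
      simp only [Set.mem_ofPred_eq] at hz2
      linarith
    · rw [mem_closedBall_zero_iff] at hz1
      have hz : ‖z‖ = r := le_antisymm hz1 (hrange' x' hx' z hx1')
      have hxq : x' = q := hanti.injOn hx' hmq (by
        simp only [hdq]; rw [(hdiv x' hx' z).1 hx1', hz])
      subst hxq
      rw [hbq] at hx2'
      have h1 : r ≤ z.re := by
        have := hpos x' hx'
        have h2 : 0 ≤ a x' * (z.re - r) := by linarith
        linarith [nonneg_of_mul_nonneg_right h2 this]
      have h2 := Complex.re_le_norm z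
      refine (hL z).1 ⟨x', hx', hx1', ?_⟩
      rw [hbq, show z.re = r by linarith]
      ring
    · simp only [Set.mem_ofPred_eq] at hz2
      have hz : ‖z‖ = R := le_antisymm (hrange x hx z hx1) hz2
      have hxp : x = p := hanti.injOn hx hmp (by
        simp only [hdp]; rw [(hdiv x hx z).1 hx1, hz])
      subst hxp
      rw [hbp] at hx2
      have h1 : z.re ≤ -R := by
        have := hpos x hx
        have h2 : 0 ≤ a x * (-R - z.re) := by linarith
        linarith [nonneg_of_mul_nonneg_right h2 this]
      have h2 := (abs_le.1 (Complex.abs_re_le_norm z)).1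
      refine (hL z).1 ⟨x, hx, hx1, ?_⟩
      rw [hbp, show z.re = -R by linarith]
      ring
    · have : x = x' := hanti.injOn hx hx' (by
        simp only [(hdiv x hx z).1 hx1, (hdiv x' hx' z).1 hx1'])
      subst this
      exact (hL z).1 ⟨x, hx, hx1, by linarith⟩
  · refine Metric.isBounded_closedBall.union
      ((Metric.isBounded_closedBall (x := (0 : ℂ)) (r := R)).subset ?_)
    rintro z ⟨x, hx, hx1, -⟩
    rw [mem_closedBall_zero_iff]
    exact hrange x hx z hx1
  · intro hyL
    obtain ⟨x, hx, hx1, -⟩ := (hL y).2 hyL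
    linarith [hrange' x hx y hx1]

/-! ### Holomorphic functions across a real segment. -/

open Complex Set Interval in
/-- **Painlevé's theorem** for the real line: a continuous function which is holomorphic off the
real line is holomorphic. -/
theorem differentiableOn_of_differentiableAt_of_im_ne_zero {U : Set ℂ} (hU : IsOpen U) {f : ℂ → ℂ}
    (hc : ContinuousOn f U) (hd : ∀ z ∈ U, z.im ≠ 0 → DifferentiableAt ℂ f z) :
    DifferentiableOn ℂ f U := by
  refine (isConservativeOn_and_continuousOn_iff_isDifferentiableOn hU).1 ⟨fun z w hzw => ?_, hc⟩
  rw [← add_eq_zero_iff_eq_neg, wedgeIntegral_add_wedgeIntegral_eq]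
  -- By Morera's theorem it is enough to integrate over rectangles. A rectangle crossing the real
  -- axis is cut along it, and each half has its interior off the axis.
  have hsub : ∀ a b : ℝ, a ∈ [[z.im, w.im]] → b ∈ [[z.im, w.im]] →
      (0 : ℝ) ∉ Ioo (min a b) (max a b) →
      (∫ x : ℝ in z.re..w.re, f (x + a * I)) - (∫ x : ℝ in z.re..w.re, f (x + b * I)) +
      I • (∫ y : ℝ in a..b, f (w.re + y * I)) - I • (∫ y : ℝ in a..b, f (z.re + y * I)) = 0 := by
    intro a b ha hb h0
    have hR : [[z.re, w.re]] ×ℂ [[a, b]] ⊆ U := by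
      refine Subset.trans (fun x hx => ?_) hzw
      exact ⟨hx.1, uIcc_subset_uIcc ha hb hx.2⟩
    have := integral_boundary_rect_eq_zero_of_continuousOn_of_differentiableOn f
      (z.re + a * I) (w.re + b * I) (by simpa using hc.mono hR) (by
        simp only [add_re, ofReal_re, mul_re, I_re, mul_zero, ofReal_im, I_im, mul_one, sub_self,
          add_zero, add_im, mul_im, zero_add]
        intro x hx
        refine (hd x (hR ⟨Ioo_subset_Icc_self hx.1, Ioo_subset_Icc_self hx.2⟩)
          fun hx0 => h0 ?_).differentiableWithinAt
        rw [← hx0]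
        exact hx.2)
    simpa using this
  by_cases h0 : (0 : ℝ) ∈ [[z.im, w.im]]
  · have h1 := hsub z.im 0 left_mem_uIcc h0 (by
      rcases le_total z.im 0 with h | h <;> simp [h])
    have h2 := hsub 0 w.im h0 right_mem_uIcc (by
      rcases le_total w.im 0 with h | h <;> simp [h])
    have hint : ∀ c : ℝ, c ∈ [[z.re, w.re]] → ∀ a b : ℝ, a ∈ [[z.im, w.im]] → b ∈ [[z.im, w.im]] →
        IntervalIntegrable (fun y : ℝ => f (c + y * I)) MeasureTheory.volume a b := by
      intro c hcm a b ha hb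
      refine ContinuousOn.intervalIntegrable (hc.comp (by fun_prop) fun y hy => hzw ?_)
      exact ⟨by simpa using hcm, by simpa using uIcc_subset_uIcc ha hb hy⟩
    have i1 := intervalIntegral.integral_add_adjacent_intervals
      (hint w.re right_mem_uIcc z.im 0 left_mem_uIcc h0)
      (hint w.re right_mem_uIcc 0 w.im h0 right_mem_uIcc)
    have i2 := intervalIntegral.integral_add_adjacent_intervals
      (hint z.re left_mem_uIcc z.im 0 left_mem_uIcc h0)
      (hint z.re left_mem_uIcc 0 w.im h0 right_mem_uIcc)
    rw [← i1, ← i2]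
    simp only [smul_eq_mul] at h1 h2 ⊢
    linear_combination h1 + h2
  · exact hsub z.im w.im left_mem_uIcc right_mem_uIcc fun h => h0 (Ioo_subset_Icc_self h)

/-- Local openness of a holomorphic function that is injective off the real line. -/
theorem image_mem_nhds_of_injOn {N s : Set ℂ} (hN : IsOpen N) {W : ℂ → ℂ}
    (hd : DifferentiableOn ℂ W N) (hinj : Set.InjOn W (N \ s)) (hs : ∀ z ∈ s, z.im = 0) {x : ℂ}
    (hx : x ∈ N) {O : Set ℂ} (hO : O ∈ 𝓝 x) : W '' O ∈ 𝓝 (W x) := by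
  have han : AnalyticAt ℂ W x := hd.analyticAt (hN.mem_nhds hx)
  rcases han.eventually_constant_or_nhds_le_map_nhds with h | h
  -- A locally constant function would agree at x + ri and x + 2ri, both off the real line for small
  -- r > 0.
  · exfalso
    have hev : ∀ᶠ z in 𝓝 x, W z = W x ∧ z ∈ N := h.and (hN.mem_nhds hx)
    have htend : ∀ c : ℂ, Tendsto (fun r : ℝ => x + (r : ℂ) * c) (𝓝[>] 0) (𝓝 x) := by
      intro c
      refine Tendsto.mono_left ?_ nhdsWithin_le_nhds
      have : Continuous fun r : ℝ => x + (r : ℂ) * c := by fun_prop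
      simpa using this.tendsto 0
    have e1 := (htend Complex.I).eventually hev
    have e2 := (htend (2 * Complex.I)).eventually hev
    have e3 : ∀ᶠ r : ℝ in 𝓝[>] 0, 0 < r := self_mem_nhdsWithin
    have e4 : ∀ᶠ r : ℝ in 𝓝[>] 0, x.im + r ≠ 0 ∧ x.im + 2 * r ≠ 0 := by
      rcases le_or_gt 0 x.im with hxi | hxi
      · filter_upwards [e3] with r hr
        exact ⟨by positivity, by positivity⟩
      · have : ∀ᶠ r : ℝ in 𝓝[>] 0, r < -x.im / 2 :=
          nhdsWithin_le_nhds (Iio_mem_nhds (by linarith))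
        filter_upwards [this, e3] with r hr hr0
        exact ⟨by linarith, by linarith⟩
    obtain ⟨r, ⟨h1, n1⟩, ⟨h2, n2⟩, h3, h4, h5⟩ := (e1.and (e2.and (e3.and e4))).exists
    have hi1 : (x + (r : ℂ) * Complex.I).im = x.im + r := by simp
    have hi2 : (x + (r : ℂ) * (2 * Complex.I)).im = x.im + 2 * r := by simp; ring
    have := hinj ⟨n1, fun h => h4 (hi1 ▸ hs _ h)⟩ ⟨n2, fun h => h5 (hi2 ▸ hs _ h)⟩
      (h1.trans h2.symm)
    have := congrArg Complex.im this
    rw [hi1, hi2] at this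
    linarith
  · exact h (image_mem_map hO)

/-- If moreover the function is real on the exceptional real set, it is injective everywhere. -/
theorem injOn_of_injOn_diff {N s : Set ℂ} (hN : IsOpen N) {W : ℂ → ℂ}
    (hd : DifferentiableOn ℂ W N) (hinj : Set.InjOn W (N \ s)) (hs : ∀ z ∈ s, z.im = 0)
    (hreal : ∀ z ∈ s, (W z).im = 0) : Set.InjOn W N := by
  intro x hx y hy hxy
  by_contra hne
  obtain ⟨u, v, hu, hv, hxu, hyv, huv⟩ := t2_separation hne
  have h1 := image_mem_nhds_of_injOn hN hd hinj hs hx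
    ((hu.inter hN).mem_nhds ⟨hxu, hx⟩)
  have h2 := image_mem_nhds_of_injOn hN hd hinj hs hy
    ((hv.inter hN).mem_nhds ⟨hyv, hy⟩)
  rw [← hxy] at h2
  -- The two open images share the value W x, hence also nearby nonreal values. Preimages of these
  -- are off `s`, where injectivity is known.
  have htend : Tendsto (fun r : ℝ => W x + (r : ℂ) * Complex.I) (𝓝 0) (𝓝 (W x)) := by
    have : Continuous fun r : ℝ => W x + (r : ℂ) * Complex.I := by fun_prop
    simpa using this.tendsto 0
  have h3 : ∀ᶠ r : ℝ in 𝓝[≠] 0, W x + (r : ℂ) * Complex.I ∈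
      W '' (u ∩ N) ∩ W '' (v ∩ N) := nhdsWithin_le_nhds (htend (inter_mem h1 h2))
  have h4 : ∀ᶠ r : ℝ in 𝓝[≠] 0, (W x).im + r ≠ 0 := by
    by_cases h0 : (W x).im = 0
    · filter_upwards [self_mem_nhdsWithin] with r hr
      rw [h0, zero_add]; exact hr
    · refine nhdsWithin_le_nhds ?_
      have : Continuous fun r : ℝ => (W x).im + r := by fun_prop
      exact this.continuousAt.eventually_ne (by simpa using h0)
  obtain ⟨r, ⟨⟨x', hx', e1⟩, ⟨y', hy', e2⟩⟩, hr⟩ := (h3.and h4).exists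
  have him : (W x + (r : ℂ) * Complex.I).im = (W x).im + r := by simp
  have hx's : x' ∉ s := fun h => hr (by rw [← him, ← e1]; exact hreal _ h)
  have hy's : y' ∉ s := fun h => hr (by rw [← him, ← e2]; exact hreal _ h)
  have := hinj ⟨hx'.2, hx's⟩ ⟨hy'.2, hy's⟩ (e1.trans e2.symm)
  subst this
  exact Set.disjoint_left.1 huv hx'.1 hy'.1

theorem tendsto_invFunOn {N s : Set ℂ} (hN : IsOpen N) {W : ℂ → ℂ}
    (hd : DifferentiableOn ℂ W N) (hinj : Set.InjOn W N) (hs : ∀ z ∈ s, z.im = 0) {x : ℂ}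
    (hx : x ∈ N) : Tendsto (Function.invFunOn W N) (𝓝 (W x)) (𝓝 x) := by
  intro O hO
  have := image_mem_nhds_of_injOn hN hd (hinj.mono Set.sdiff_subset) hs hx
    (inter_mem hO (hN.mem_nhds hx))
  rw [mem_map]
  filter_upwards [this]
  rintro _ ⟨z, hz, rfl⟩
  rw [Set.mem_preimage, hinj.leftInvOn_invFunOn hz.2]
  exact hz.1

open scoped ComplexConjugate

/-- Schwarz reflection: z ↦ conj (T (conj z)) is holomorphic and agrees with `T` on the real
segment, so the identity theorem applies. -/
theorem map_conj_eq_conj_map {N : Set ℂ} (hN : IsOpen N) (hNc : IsPreconnected N)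
    (hconj : ∀ z ∈ N, conj z ∈ N) {T : ℂ → ℂ} (hd : DifferentiableOn ℂ T N) {p q : ℝ} (hpq : p < q)
    (hseg : ∀ x ∈ Set.Icc p q, (x : ℂ) ∈ N) (hreal : ∀ x ∈ Set.Icc p q, (T (x : ℂ)).im = 0)
    {z : ℂ} (hz : z ∈ N) : T (conj z) = conj (T z) := by
  have hd' : DifferentiableOn ℂ (fun z => conj (T (conj z))) N := by
    intro z hz
    have := (hd.differentiableAt (hN.mem_nhds (hconj z hz))).conj_conj
    rw [Complex.conj_conj] at this
    exact this.differentiableWithinAt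
  have h := (hd'.analyticOnNhd hN).eqOn_of_preconnected_of_frequently_eq (hd.analyticOnNhd hN) hNc
    (hseg p ⟨le_rfl, hpq.le⟩) (by
      have htend : Tendsto (fun x : ℝ => (x : ℂ)) (𝓝[>] p) (𝓝[≠] (p : ℂ)) := by
        refine tendsto_nhdsWithin_iff.2 ⟨?_, ?_⟩
        · exact (Complex.continuous_ofReal.tendsto p).mono_left nhdsWithin_le_nhds
        · filter_upwards [self_mem_nhdsWithin] with x hx
          exact fun h => (ne_of_gt hx) (Complex.ofReal_injective h)
      refine htend.frequently (Eventually.frequently ?_)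
      filter_upwards [Ioo_mem_nhdsGT hpq] with x hx
      rw [Complex.conj_ofReal, Complex.conj_eq_iff_im]
      exact hreal x (Set.Ioo_subset_Icc_self hx)) hz
  simp only at h
  rw [← h, Complex.conj_conj]

/-- An injective holomorphic function that decreases from `1` to `0` along a real segment exchanges
the two half-planes. -/
theorem im_pos_of_im_neg {N : Set ℂ} (hN : IsOpen N) (hNc : Convex ℝ N)
    (hconj : ∀ z ∈ N, conj z ∈ N) {T : ℂ → ℂ} (hd : DifferentiableOn ℂ T N)
    (hinj : Set.InjOn T N) {p q : ℝ} (hpq : p < q)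
    (hseg : ∀ x ∈ Set.Icc p q, (x : ℂ) ∈ N) (hreal : ∀ x ∈ Set.Icc p q, (T (x : ℂ)).im = 0)
    (hp : T p = 1) (hq : T q = 0) {z : ℂ} (hz : z ∈ N) (hz0 : z.im < 0) : 0 < (T z).im := by
  have hsymm := fun z hz => map_conj_eq_conj_map hN hNc.isPreconnected hconj hd hpq hseg hreal
    (z := z) hz
  -- A real value at a nonreal z would be taken at conj z as well, against injectivity. So Im T has
  -- a constant sign on the lower half of `N`, and one point decides which.
  have hne : ∀ z ∈ N, z.im < 0 → (T z).im ≠ 0 := by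
    intro z hz hz0 h
    have h1 := hsymm z hz
    rw [Complex.conj_eq_iff_im.2 h] at h1
    have := Complex.conj_eq_iff_im.1 (hinj (hconj z hz) hz h1)
    exact hz0.ne this
  -- The mean value theorem gives a point of negative derivative; just below it the imaginary part
  -- of `T` is positive.
  obtain ⟨c, hc, hc'⟩ : ∃ c ∈ Set.Ioo p q, (deriv T (c : ℂ)).re < 0 := by
    have hder : ∀ x ∈ Set.Icc p q, HasDerivAt (fun x : ℝ => (T x).re) (deriv T (x : ℂ)).re x :=
      fun x hx => (hd.differentiableAt (hN.mem_nhds (hseg x hx))).hasDerivAt.real_of_complex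
    obtain ⟨c, hc, e⟩ := exists_hasDerivAt_eq_slope (fun x : ℝ => (T x).re)
      (fun x : ℝ => (deriv T (x : ℂ)).re) hpq
      (fun x hx => (hder x hx).continuousAt.continuousWithinAt)
      (fun x hx => hder x (Set.Ioo_subset_Icc_self hx))
    refine ⟨c, hc, ?_⟩
    rw [e, hp, hq]
    have : 0 < q - p := sub_pos.2 hpq
    simp only [Complex.zero_re, Complex.one_re, zero_sub]
    exact div_neg_of_neg_of_pos (by norm_num) this
  have hcN := hseg c (Set.Ioo_subset_Icc_self hc)
  obtain ⟨r, hr0, hrN, hrT⟩ : ∃ r : ℝ, 0 < r ∧ (c : ℂ) - r * Complex.I ∈ N ∧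
      0 < (T ((c : ℂ) - r * Complex.I)).im := by
    have h1 : HasDerivAt (fun z : ℂ => (c : ℂ) - z * Complex.I) (-Complex.I) ((0 : ℝ) : ℂ) := by
      simpa using ((hasDerivAt_id ((0 : ℝ) : ℂ)).mul_const Complex.I).const_sub (c : ℂ)
    have h2 : HasDerivAt T (deriv T (c : ℂ)) ((c : ℂ) - ((0 : ℝ) : ℂ) * Complex.I) := by
      simpa using (hd.differentiableAt (hN.mem_nhds hcN)).hasDerivAt
    have h3 := ((HasDerivAt.comp ((0 : ℝ) : ℂ) h2 h1).const_mul (-Complex.I)).real_of_complex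
    have h4 : HasDerivAt (fun r : ℝ => (T ((c : ℂ) - r * Complex.I)).im)
        (-(deriv T (c : ℂ)).re) 0 := by
      convert h3 using 1
      · ext r; simp
      · simp
    have h5 := h4.tendsto_slope_zero_right
    have h6 : ∀ᶠ r : ℝ in 𝓝[>] 0, (c : ℂ) - r * Complex.I ∈ N := by
      have : Tendsto (fun r : ℝ => (c : ℂ) - r * Complex.I) (𝓝[>] 0) (𝓝 (c : ℂ)) := by
        have h : Continuous fun r : ℝ => (c : ℂ) - r * Complex.I := by fun_prop
        have h0 := h.tendsto 0
        simp only [Complex.ofReal_zero, zero_mul, sub_zero] at h0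
        exact h0.mono_left nhdsWithin_le_nhds
      exact this (hN.mem_nhds hcN)
    have h7 := h5.eventually (lt_mem_nhds (neg_pos.2 hc'))
    have h8 : ∀ᶠ r : ℝ in 𝓝[>] 0, 0 < r := self_mem_nhdsWithin
    obtain ⟨r, hr, hrN, hr0⟩ := (h7.and (h6.and h8)).exists
    refine ⟨r, hr0, hrN, ?_⟩
    simp only [zero_add, Complex.ofReal_zero, zero_mul, sub_zero,
      hreal c (Set.Ioo_subset_Icc_self hc), smul_eq_mul] at hr
    exact (pos_iff_pos_of_mul_pos hr).1 (inv_pos.2 hr0)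
  by_contra! hn
  have hpre : IsPreconnected (N ∩ {z : ℂ | z.im < 0}) :=
    (hNc.inter (convex_halfSpace_im_lt 0)).isPreconnected
  have hcont : ContinuousOn (fun z => (T z).im) (N ∩ {z : ℂ | z.im < 0}) :=
    Complex.continuous_im.comp_continuousOn (hd.continuousOn.mono Set.inter_subset_left)
  obtain ⟨y, hy, hy'⟩ := hpre.intermediate_value ⟨hz, hz0⟩
    (show (c : ℂ) - r * Complex.I ∈ N ∩ {z : ℂ | z.im < 0} from ⟨hrN, by simpa using hr0⟩) hcont
    (show (0 : ℝ) ∈ Set.Icc _ _ from ⟨hn, hrT.le⟩)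
  exact hne y hy.1 hy.2 hy'

/-! ### Square roots along a cut. -/

/-- A branch of the square root of `(z - p) (z - q) Q(z)`, analytic off the segment `[p, q]` where
`Q` avoids the negative real axis. -/
def cutSqrt (p q : ℝ) (Q : ℂ → ℂ) (z : ℂ) : ℂ :=
  (z - q) * ((z - p) / (z - q)) ^ (1 / 2 : ℂ) * Q z ^ (1 / 2 : ℂ)

theorem cpow_half_sq (z : ℂ) : (z ^ (1 / 2 : ℂ)) ^ 2 = z := by
  rw [one_div]
  exact_mod_cast Complex.cpow_nat_inv_pow z two_ne_zero

theorem ofReal_cpow_half {x : ℝ} (hx : 0 ≤ x) : (x : ℂ) ^ (1 / 2 : ℂ) = (Real.sqrt x : ℝ) := by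
  rw [Real.sqrt_eq_rpow, Complex.ofReal_cpow hx]
  norm_num

theorem cutSqrt_sq (p q : ℝ) (Q : ℂ → ℂ) (z : ℂ) :
    cutSqrt p q Q z ^ 2 = (z - p) * (z - q) * Q z := by
  unfold cutSqrt
  rw [mul_pow, mul_pow, cpow_half_sq, cpow_half_sq]
  by_cases h : z = q
  · simp [h]
  · have := sub_ne_zero.2 h
    field_simp

/-- A ratio equal to r ≤ 0 would give z = (p - r q)/(1 - r), a point of the segment [p, q]. -/
theorem div_mem_slitPlane {p q : ℝ} (hpq : p ≤ q) {z : ℂ}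
    (hz : ∀ x ∈ Set.Icc p q, z ≠ (x : ℂ)) : (z - p) / (z - q) ∈ Complex.slitPlane := by
  have hzq : z - q ≠ 0 := sub_ne_zero.2 (hz q ⟨hpq, le_rfl⟩)
  by_contra hn
  rw [Complex.mem_slitPlane_iff, not_or, not_lt, not_not] at hn
  obtain ⟨r, hr⟩ : ∃ r : ℝ, r = ((z - p) / (z - q)).re := ⟨_, rfl⟩
  have h1 : (z - p) / (z - q) = (r : ℂ) := Complex.ext (by simp [hr]) (by simp [hn.2])
  rw [div_eq_iff hzq] at h1
  rw [← hr] at hn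
  have hr1 : 0 < 1 - r := by linarith [hn.1]
  have h2 : z * ((1 - r : ℝ) : ℂ) = ((p - r * q : ℝ) : ℂ) := by push_cast; linear_combination h1
  refine hz ((p - r * q) / (1 - r)) ⟨?_, ?_⟩ ?_
  · rw [le_div_iff₀ hr1]; nlinarith [hn.1]
  · rw [div_le_iff₀ hr1]; nlinarith [hn.1]
  · rw [Complex.ofReal_div, ← h2, mul_div_cancel_right₀]
    exact_mod_cast hr1.ne'

theorem differentiableAt_cutSqrt {p q : ℝ} (hpq : p ≤ q) {Q : ℂ → ℂ} {z : ℂ}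
    (hz : ∀ x ∈ Set.Icc p q, z ≠ (x : ℂ)) (hQ : DifferentiableAt ℂ Q z)
    (hQz : Q z ∈ Complex.slitPlane) : DifferentiableAt ℂ (cutSqrt p q Q) z := by
  have hzq : z - q ≠ 0 := sub_ne_zero.2 (hz q ⟨hpq, le_rfl⟩)
  unfold cutSqrt
  have h1 : DifferentiableAt ℂ (fun z : ℂ => z - q) z := by fun_prop
  have h2 : DifferentiableAt ℂ (fun z : ℂ => (z - p) / (z - q)) z :=
    DifferentiableAt.div (by fun_prop) h1 hzq
  exact (h1.mul (h2.cpow_const (div_mem_slitPlane hpq hz))).mul (hQ.cpow_const hQz)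

/-- On the cut the ratio is negative and the principal power uses the argument π, giving a factor i;
the factor x - q is negative. By `tendsto_cutSqrt` this is the boundary value from the lower
half-plane. -/
theorem cutSqrt_ofReal {p q x Qx : ℝ} {Q : ℂ → ℂ} (hx : x ∈ Set.Icc p q) (hQx : 0 ≤ Qx)
    (hQ : Q x = Qx) : cutSqrt p q Q x = -Complex.I * Real.sqrt ((x - p) * (q - x) * Qx) := by
  rcases hx.2.eq_or_lt with rfl | hxq
  · simp [cutSqrt]
  unfold cutSqrt
  have hqx : 0 < q - x := sub_pos.2 hxq
  have hr : 0 ≤ (x - p) / (q - x) := div_nonneg (sub_nonneg.2 hx.1) hqx.le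
  have e1 : ((x : ℂ) - p) / (x - q) = ((-((x - p) / (q - x)) : ℝ) : ℂ) := by
    push_cast
    rw [← neg_sub (q : ℂ) x, div_neg]
  rw [e1, Complex.ofReal_cpow_of_nonpos (by linarith), hQ, ofReal_cpow_half hQx, ← Complex.ofReal_neg,
    neg_neg, ofReal_cpow_half hr]
  have e2 : Complex.exp (Real.pi * Complex.I * (1 / 2)) = Complex.I := by
    rw [show (Real.pi * Complex.I * (1 / 2) : ℂ) = Real.pi / 2 * Complex.I by ring,
      Complex.exp_pi_div_two_mul_I]
  rw [e2]
  have e3 : Real.sqrt ((x - p) * (q - x) * Qx) =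
      (q - x) * Real.sqrt ((x - p) / (q - x)) * Real.sqrt Qx := by
    rw [Real.sqrt_mul (mul_nonneg (sub_nonneg.2 hx.1) hqx.le)]
    congr 1
    rw [show (x - p) * (q - x) = (q - x) ^ 2 * ((x - p) / (q - x)) by field_simp,
      Real.sqrt_mul (sq_nonneg _), Real.sqrt_sq hqx.le]
  rw [e3]
  push_cast
  ring

theorem cutSqrt_ofReal_of_lt {p q x Qx : ℝ} {Q : ℂ → ℂ} (hpq : p ≤ q) (hx : q < x) (hQx : 0 ≤ Qx)
    (hQ : Q x = Qx) : ∃ s : ℝ, 0 ≤ s ∧ cutSqrt p q Q x = s := by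
  have hqx : 0 < x - q := sub_pos.2 hx
  refine ⟨(x - q) * Real.sqrt ((x - p) / (x - q)) * Real.sqrt Qx, by positivity, ?_⟩
  unfold cutSqrt
  rw [hQ, ofReal_cpow_half hQx]
  have e1 : ((x : ℂ) - p) / (x - q) = (((x - p) / (x - q) : ℝ) : ℂ) := by push_cast; rfl
  rw [e1, ofReal_cpow_half (div_nonneg (by linarith) hqx.le)]
  push_cast
  rfl

/-- The imaginary part of (z - p)/(z - q) has the sign opposite to Im z. From below the cut the
logarithm of the ratio tends to its value on the negative axis; from above it differs by 2πi, and
halving the exponent turns this into a change of sign. At the ends both limits are 0. -/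
theorem tendsto_cutSqrt {p q x Qx : ℝ} {Q : ℂ → ℂ} (hpq : p < q) (hx : x ∈ Set.Icc p q)
    (hQx : 0 < Qx) (hQ : Q x = Qx) (hQc : ContinuousAt Q x) :
    Tendsto (cutSqrt p q Q) (𝓝[{z | z.im < 0}] x) (𝓝 (cutSqrt p q Q x)) ∧
    Tendsto (cutSqrt p q Q) (𝓝[{z | 0 < z.im}] x) (𝓝 (-cutSqrt p q Q x)) := by
  by_cases hend : x = p ∨ x = q
  · have h0 : cutSqrt p q Q x = 0 := by
      rw [cutSqrt_ofReal hx hQx.le hQ]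
      rcases hend with rfl | rfl <;> simp
    have h1 : Tendsto (fun z => cutSqrt p q Q z ^ 2) (𝓝 (x : ℂ)) (𝓝 0) := by
      have : ContinuousAt (fun z : ℂ => (z - p) * (z - q) * Q z) x :=
        ContinuousAt.mul (by fun_prop) hQc
      have h2 := this.tendsto
      rw [← cutSqrt_sq, h0, zero_pow two_ne_zero] at h2
      simpa only [cutSqrt_sq] using h2
    have h2 : Tendsto (cutSqrt p q Q) (𝓝 (x : ℂ)) (𝓝 0) := by
      rw [tendsto_zero_iff_norm_tendsto_zero] at h1 ⊢
      simp only [norm_pow] at h1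
      have := (Real.continuous_sqrt.tendsto 0).comp h1
      simpa [Function.comp_def, Real.sqrt_sq] using this
    rw [h0, neg_zero]
    exact ⟨h2.mono_left nhdsWithin_le_nhds, h2.mono_left nhdsWithin_le_nhds⟩
  push Not at hend
  have hp : 0 < x - p := sub_pos.2 (lt_of_le_of_ne hx.1 (Ne.symm hend.1))
  have hq : 0 < q - x := sub_pos.2 (lt_of_le_of_ne hx.2 hend.2)
  have hxq : (x : ℂ) - q ≠ 0 := by exact_mod_cast (by linarith : x - q ≠ 0)
  have hratio : ContinuousAt (fun z : ℂ => (z - p) / (z - q)) x :=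
    ContinuousAt.div (by fun_prop) (by fun_prop) hxq
  obtain ⟨ρ, hρ⟩ : ∃ ρ : ℝ, ρ = (x - p) / (x - q) := ⟨_, rfl⟩
  have hρ' : ((x : ℂ) - p) / (x - q) = ρ := by rw [hρ]; push_cast; rfl
  have hρ0 : ρ < 0 := by rw [hρ]; exact div_neg_of_pos_of_neg hp (by linarith)
  have him : ∀ z : ℂ, ((z - p) / (z - q)).im = (p - q) * z.im / Complex.normSq (z - q) := by
    intro z
    rw [Complex.div_im]
    simp only [Complex.sub_re, Complex.sub_im, Complex.ofReal_re, Complex.ofReal_im]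
    ring
  have hrest : ContinuousAt (fun z : ℂ => Q z ^ (1 / 2 : ℂ)) x :=
    hQc.cpow continuousAt_const (by rw [hQ]; exact Complex.ofReal_mem_slitPlane.2 hQx)
  have hfac : ∀ᶠ z : ℂ in 𝓝 (x : ℂ), ((z - p) / (z - q)) ^ (1 / 2 : ℂ) =
      Complex.exp (Complex.log ((z - p) / (z - q)) * (1 / 2)) := by
    have : ∀ᶠ z : ℂ in 𝓝 (x : ℂ), (z - p) / (z - q) ≠ 0 := hratio.eventually_ne (by
      rw [hρ']; exact_mod_cast hρ0.ne)
    filter_upwards [this] with z hz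
    rw [Complex.cpow_def_of_ne_zero hz]
  have hmain : ∀ (s : Set ℂ) (l : ℂ),
      Tendsto (fun z : ℂ => Complex.log ((z - p) / (z - q))) (𝓝[s] x) (𝓝 l) →
      Tendsto (cutSqrt p q Q) (𝓝[s] x)
        (𝓝 ((x - q) * Complex.exp (l * (1 / 2)) * Q x ^ (1 / 2 : ℂ))) := by
    intro s l hl
    have h1 : Tendsto (fun z : ℂ => ((z - p) / (z - q)) ^ (1 / 2 : ℂ)) (𝓝[s] x)
        (𝓝 (Complex.exp (l * (1 / 2)))) := by
      refine Tendsto.congr' ?_ ((Complex.continuous_exp.tendsto _).comp (hl.mul_const (1 / 2)))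
      filter_upwards [nhdsWithin_le_nhds hfac] with z hz
      exact hz.symm
    have h2 : Tendsto (fun z : ℂ => z - q) (𝓝[s] (x : ℂ)) (𝓝 ((x : ℂ) - q)) :=
      (show ContinuousAt (fun z : ℂ => z - q) x by fun_prop).tendsto.mono_left nhdsWithin_le_nhds
    exact (h2.mul h1).mul (hrest.tendsto.mono_left nhdsWithin_le_nhds)
  have hval : ((x : ℂ) - q) * Complex.exp (Complex.log ρ * (1 / 2)) * Q x ^ (1 / 2 : ℂ) =
      cutSqrt p q Q x := by
    rw [cutSqrt, hρ', Complex.cpow_def_of_ne_zero (x := (ρ : ℂ)) (by exact_mod_cast hρ0.ne)]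
  constructor
  · rw [← hval]
    apply hmain
    have h1 := (Complex.continuousWithinAt_log_of_re_neg_of_im_zero (z := (ρ : ℂ)) (by simpa)
      (by simp)).tendsto
    refine h1.comp (tendsto_nhdsWithin_iff.2 ⟨?_, ?_⟩)
    · rw [← hρ']; exact hratio.tendsto.mono_left nhdsWithin_le_nhds
    · filter_upwards [self_mem_nhdsWithin] with z hz
      have hz : z.im < 0 := hz
      show 0 ≤ ((z - p) / (z - q)).im
      rw [him]
      exact div_nonneg (mul_nonneg_of_nonpos_of_nonpos (by linarith) hz.le)
        (Complex.normSq_nonneg _)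
  · have h1 := Complex.tendsto_log_nhdsWithin_im_neg_of_re_neg_of_im_zero (z := (ρ : ℂ)) (by simpa)
      (by simp)
    have hval' : ((x : ℂ) - q) * Complex.exp ((Real.log ‖(ρ : ℂ)‖ - Real.pi * Complex.I) * (1 / 2)) *
        Q x ^ (1 / 2 : ℂ) = -cutSqrt p q Q x := by
      have h2 : Complex.log ρ = Real.log ‖(ρ : ℂ)‖ + Real.pi * Complex.I := by
        rw [Complex.log, Complex.arg_ofReal_of_neg hρ0]
      rw [← hval, h2, show ((Real.log ‖(ρ : ℂ)‖ - Real.pi * Complex.I) * (1 / 2) : ℂ) =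
        (Real.log ‖(ρ : ℂ)‖ + Real.pi * Complex.I) * (1 / 2) - Real.pi * Complex.I by ring,
        Complex.exp_sub, Complex.exp_pi_mul_I]
      ring
    rw [← hval']
    apply hmain
    refine h1.comp (tendsto_nhdsWithin_iff.2 ⟨?_, ?_⟩)
    · rw [← hρ']; exact hratio.tendsto.mono_left nhdsWithin_le_nhds
    · filter_upwards [self_mem_nhdsWithin, nhdsWithin_le_nhds
        ((show ContinuousAt (fun z : ℂ => z - q) x by fun_prop).eventually_ne hxq)] with z hz hzq
      have hz : 0 < z.im := hz
      show ((z - p) / (z - q)).im < 0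
      rw [him]
      exact div_neg_of_neg_of_pos (mul_neg_of_neg_of_pos (by linarith) hz)
        (Complex.normSq_pos.2 hzq)

/-- A square root of a function tending to `s²` clusters at `s` and `-s` only. -/
theorem tendsto_sup_of_sq {α : Type*} {l : Filter α} {σ : α → ℂ} {s : ℂ}
    (h : Tendsto (fun a => σ a ^ 2) l (𝓝 (s ^ 2))) : Tendsto σ l (𝓝 s ⊔ 𝓝 (-s)) := by
  intro O hO
  obtain ⟨h1, h2⟩ := mem_sup.1 hO
  obtain ⟨ε₁, hε₁, b1⟩ := Metric.mem_nhds_iff.1 h1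
  obtain ⟨ε₂, hε₂, b2⟩ := Metric.mem_nhds_iff.1 h2
  have hε : 0 < min ε₁ ε₂ := lt_min hε₁ hε₂
  rw [mem_map]
  filter_upwards [h (Metric.ball_mem_nhds _ (mul_pos hε hε))] with a ha
  rw [Set.mem_preimage, Metric.mem_ball, dist_eq_norm,
    show σ a ^ 2 - s ^ 2 = (σ a - s) * (σ a - -s) by ring, norm_mul] at ha
  by_cases h3 : ‖σ a - s‖ < min ε₁ ε₂
  · exact b1 (by rw [Metric.mem_ball, dist_eq_norm]; exact h3.trans_le (min_le_left _ _))
  · refine b2 ?_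
    rw [Metric.mem_ball, dist_eq_norm]
    refine lt_of_lt_of_le ?_ (min_le_right ε₁ ε₂)
    by_contra h4
    push Not at h3 h4
    exact absurd (mul_le_mul h3 h4 hε.le (hε.le.trans h3)) (not_le.2 ha)

/-! ### Variation of the argument of √d̃. -/

/-- The closed upper half-plane without the cuts `[a, b]` and `[c, ∞)`. -/
def upperSlit (a b c : ℝ) : Set ℂ :=
  {y | 0 ≤ y.im ∧ (y.im = 0 → y.re < a ∨ (b < y.re ∧ y.re < c))}

/-- Twice the argument of the square root of `(y - a) (y - b) (c - y) (p - q y)`. -/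
def doubleArg (a b c p q : ℝ) (y : ℂ) : ℝ :=
  2 * (y - b).arg + ((y - a) / (y - b)).arg + (c - y).arg + (p - q * y).arg

section

variable {a b c p q : ℝ} {y : ℂ}

theorem ne_of_mem_upperSlit (hy : y ∈ upperSlit a b c) :
    ∀ x ∈ Set.Icc a b, y ≠ (x : ℂ) := by
  rintro x hx rfl
  have := hy.2 (by simp)
  simp only [Complex.ofReal_re] at this
  rcases this with h | h <;> linarith [hx.1, hx.2]

theorem sub_mem_slitPlane (hab : a < b) (hbc : b < c) (hy : y ∈ upperSlit a b c) :
    (c : ℂ) - y ∈ Complex.slitPlane := by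
  rw [Complex.mem_slitPlane_iff]
  by_cases h : y.im = 0
  · left
    rcases hy.2 h with h | h <;> simp <;> linarith
  · right
    simpa using h

theorem affine_mem_slitPlane (hab : a < b) (hbc : b < c) (hpq : ∀ x : ℝ, x < c → 0 < p - q * x)
    (hy : y ∈ upperSlit a b c) : (p : ℂ) - q * y ∈ Complex.slitPlane := by
  rw [Complex.mem_slitPlane_iff]
  by_cases h : y.im = 0
  · left
    have := hpq y.re (by rcases hy.2 h with h | h <;> linarith)
    simpa using this
  · by_cases hq : q = 0
    · left
      have := hpq b hbc
      simpa [hq] using this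
    · right
      simpa using ⟨hq, h⟩

/-- Only y - b can reach the negative axis, and it does so from the closed upper half-plane, where
the argument is continuous. The other three arguments are taken in the slit plane. -/
theorem continuousOn_doubleArg (hab : a < b) (hbc : b < c)
    (hpq : ∀ x : ℝ, x < c → 0 < p - q * x) :
    ContinuousOn (doubleArg a b c p q) (upperSlit a b c) := by
  intro y hy
  have hyb : y - b ≠ 0 := sub_ne_zero.2 (ne_of_mem_upperSlit hy b ⟨hab.le, le_rfl⟩)
  have h1 : ContinuousWithinAt (fun y : ℂ => (y - b).arg) (upperSlit a b c) y := by
    by_cases hs : y - b ∈ Complex.slitPlane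
    · exact ((Complex.continuousAt_arg hs).comp
        (f := fun y : ℂ => y - b) (by fun_prop)).continuousWithinAt
    · rw [Complex.mem_slitPlane_iff, not_or, not_lt, not_not] at hs
      have him : (y - b).im = 0 := hs.2
      have hre : (y - b).re < 0 := lt_of_le_of_ne hs.1 fun h => hyb (Complex.ext h him)
      refine (Complex.continuousWithinAt_arg_of_re_neg_of_im_zero hre him).comp
        (f := fun y : ℂ => y - b) (by fun_prop) fun z hz => ?_
      simpa using hz.1
  have h2 : ContinuousAt (fun y : ℂ => ((y - a) / (y - b)).arg) y :=
    (Complex.continuousAt_arg (div_mem_slitPlane hab.le (ne_of_mem_upperSlit hy))).comp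
      (f := fun y : ℂ => (y - a) / (y - b)) (ContinuousAt.div (by fun_prop) (by fun_prop) hyb)
  have h3 : ContinuousAt (fun y : ℂ => (c - y).arg) y :=
    (Complex.continuousAt_arg (sub_mem_slitPlane hab hbc hy)).comp
      (f := fun y : ℂ => c - y) (by fun_prop)
  have h4 : ContinuousAt (fun y : ℂ => (p - q * y).arg) y :=
    (Complex.continuousAt_arg (affine_mem_slitPlane hab hbc hpq hy)).comp
      (f := fun y : ℂ => p - q * y) (by fun_prop)
  exact (((h1.const_mul 2).add h2.continuousWithinAt).add h3.continuousWithinAt).add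
    h4.continuousWithinAt

theorem doubleArg_of_mem_Ioo (hab : a < b) (hpq : ∀ x : ℝ, x < c → 0 < p - q * x) {r : ℝ}
    (hr : r ∈ Set.Ioo b c) : doubleArg a b c p q r = 0 := by
  have h1 : 0 < r - b := sub_pos.2 hr.1
  have h2 : 0 < r - a := by linarith
  have h3 : 0 < c - r := sub_pos.2 hr.2
  have h4 := hpq r hr.2
  have e1 : ((r : ℂ) - b).arg = 0 := by
    rw [← Complex.ofReal_sub, Complex.arg_ofReal_of_nonneg h1.le]
  have e2 : (((r : ℂ) - a) / (r - b)).arg = 0 := by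
    rw [← Complex.ofReal_sub, ← Complex.ofReal_sub, ← Complex.ofReal_div,
      Complex.arg_ofReal_of_nonneg (by positivity)]
  have e3 : ((c : ℂ) - r).arg = 0 := by
    rw [← Complex.ofReal_sub, Complex.arg_ofReal_of_nonneg h3.le]
  have e4 : ((p : ℂ) - q * r).arg = 0 := by
    rw [← Complex.ofReal_mul, ← Complex.ofReal_sub, Complex.arg_ofReal_of_nonneg h4.le]
  rw [doubleArg, e1, e2, e3, e4]
  norm_num

/-- Left of both branch points the argument π of y - b is counted twice and all the others vanish:
this is the turn that produces the index. -/
theorem doubleArg_of_lt (hab : a < b) (hbc : b < c) (hpq : ∀ x : ℝ, x < c → 0 < p - q * x) {r : ℝ}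
    (hr : r < a) : doubleArg a b c p q r = 2 * Real.pi := by
  have h1 : r - b < 0 := by linarith
  have h2 : r - a < 0 := by linarith
  have h3 : 0 < c - r := by linarith
  have h4 := hpq r (by linarith)
  have e1 : ((r : ℂ) - b).arg = Real.pi := by
    rw [← Complex.ofReal_sub, Complex.arg_ofReal_of_neg h1]
  have e2 : (((r : ℂ) - a) / (r - b)).arg = 0 := by
    rw [← Complex.ofReal_sub, ← Complex.ofReal_sub, ← Complex.ofReal_div,
      Complex.arg_ofReal_of_nonneg (div_nonneg_of_nonpos h2.le h1.le)]
  have e3 : ((c : ℂ) - r).arg = 0 := by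
    rw [← Complex.ofReal_sub, Complex.arg_ofReal_of_nonneg h3.le]
  have e4 : ((p : ℂ) - q * r).arg = 0 := by
    rw [← Complex.ofReal_mul, ← Complex.ofReal_sub, Complex.arg_ofReal_of_nonneg h4.le]
  rw [doubleArg, e1, e2, e3, e4]
  ring

variable {S : Finset (ℤ × ℤ)} {t : ℝ}

/-- Each factor commutes with conjugation off the cuts, so the ratio is conj(σ)/σ with σ = √d̃(y).
Writing σ as the exponential of a sum of logarithms exhibits a continuous argument. -/
theorem sqrtDiscTilde_conj_div (hab : a < b) (hbc : b < c)
    (hpq : ∀ x : ℝ, x < c → 0 < p - q * x)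
    (hd : ∀ z : ℂ, discTilde S t z = (z - a) * (z - b) * (c - z) * (p - q * z))
    (hy : y ∈ upperSlit a b c) :
    sqrtDiscTilde S t a b c (conj y) / sqrtDiscTilde S t a b c y =
      Complex.exp (-(doubleArg a b c p q y * Complex.I)) := by
  have n2 : y - b ≠ 0 := sub_ne_zero.2 (ne_of_mem_upperSlit hy b ⟨hab.le, le_rfl⟩)
  have n1 : y - a ≠ 0 := sub_ne_zero.2 (ne_of_mem_upperSlit hy a ⟨le_rfl, hab.le⟩)
  have m1 := div_mem_slitPlane hab.le (ne_of_mem_upperSlit hy)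
  have m3 := sub_mem_slitPlane hab hbc hy
  have m4 := affine_mem_slitPlane hab hbc hpq hy
  have n3 := Complex.slitPlane_ne_zero m3
  have hquot : ∀ z : ℂ, z - a ≠ 0 → z - b ≠ 0 → c - z ≠ 0 →
      discTilde S t z / ((z - a) * (z - b) * (c - z)) = p - q * z := by
    intro z h1 h2 h3
    rw [hd]
    field_simp
  have htwo : conj (2 : ℂ) = 2 := map_ofNat _ 2
  have hc : ∀ z : ℂ, z ∈ Complex.slitPlane →
      conj z ^ (1 / 2 : ℂ) = conj (z ^ (1 / 2 : ℂ)) := by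
    intro z hz
    rw [Complex.conj_cpow _ _ (Complex.slitPlane_arg_ne_pi hz)]
    simp [htwo]
  have c1 : conj y - a = conj (y - a) := by simp
  have c2 : conj y - b = conj (y - b) := by simp
  have c3 : c - conj y = conj (c - y) := by simp
  have c4 : p - q * conj y = conj (p - q * y) := by simp
  have nz : ∀ z : ℂ, z ≠ 0 → conj z ≠ 0 := fun z hz => by simpa using hz
  have hconj : sqrtDiscTilde S t a b c (conj y) = conj (sqrtDiscTilde S t a b c y) := by
    unfold sqrtDiscTilde
    rw [hquot y n1 n2 n3, hquot (conj y) (by rw [c1]; exact nz _ n1) (by rw [c2]; exact nz _ n2)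
      (by rw [c3]; exact nz _ n3), c1, c2, c3, c4, ← map_div₀, hc _ m1, hc _ m3, hc _ m4]
    simp only [map_mul]
  have hexp : ∀ z : ℂ, z ≠ 0 → z ^ (1 / 2 : ℂ) = Complex.exp (Complex.log z / 2) := by
    intro z hz
    rw [Complex.cpow_def_of_ne_zero hz]
    congr 1
    ring
  have hS : sqrtDiscTilde S t a b c y = Complex.exp (Complex.log (y - b) +
      Complex.log ((y - a) / (y - b)) / 2 + Complex.log (c - y) / 2 +
      Complex.log (p - q * y) / 2) := by
    unfold sqrtDiscTilde
    rw [hquot y n1 n2 n3, hexp _ (Complex.slitPlane_ne_zero m1), hexp _ n3,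
      hexp _ (Complex.slitPlane_ne_zero m4), Complex.exp_add, Complex.exp_add, Complex.exp_add,
      Complex.exp_log n2]
  rw [hconj, hS, ← Complex.exp_conj, ← Complex.exp_sub]
  congr 1
  apply Complex.ext
  · simp [htwo]
  · simp [doubleArg, Complex.log_im, htwo]
    ring

/-- The index of the ratio of conjugate values of `√d̃` along an arc of the upper half-plane from
`(b, c)` to `(-∞, a)`. -/
theorem hasIndex_of_arc (hab : a < b) (hbc : b < c) (hpq : ∀ x : ℝ, x < c → 0 < p - q * x)
    (hd : ∀ z : ℂ, discTilde S t z = (z - a) * (z - b) * (c - z) * (p - q * z))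
    {A B : ℂ} {vp vm : ℂ → ℂ} {γ : ℝ → ℂ} (hγ : ContinuousOn γ (Set.Icc 0 1))
    (hmem : ∀ s ∈ Set.Icc (0 : ℝ) 1, γ s ∈ upperSlit a b c)
    (hvp : ∀ s ∈ Set.Icc (0 : ℝ) 1, vp (A + s * (B - A)) = γ s)
    (hvm : ∀ s ∈ Set.Icc (0 : ℝ) 1, vm (A + s * (B - A)) = conj (γ s))
    {r₀ r₁ : ℝ} (h0 : γ 0 = r₀) (hr₀ : r₀ ∈ Set.Ioo b c) (h1 : γ 1 = r₁) (hr₁ : r₁ < a) :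
    HasIndex (fun u => sqrtDiscTilde S t a b c (vm u) / sqrtDiscTilde S t a b c (vp u))
      A B (-1) := by
  refine ⟨fun s => -(doubleArg a b c p q (γ s) * Complex.I), ?_, fun s hs => ?_, ?_⟩
  · have h := (continuousOn_doubleArg hab hbc hpq).comp hγ hmem
    exact ((Complex.continuous_ofReal.comp_continuousOn h).mul continuousOn_const).neg
  · simp only [hvp s hs, hvm s hs]
    rw [sqrtDiscTilde_conj_div hab hbc hpq hd (hmem s hs)]
  · simp only [h0, h1]
    rw [doubleArg_of_mem_Ioo hab hpq hr₀, doubleArg_of_lt hab hbc hpq hr₁]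
    push_cast
    ring

end

/-! ### The curve as the boundary values of the inner branch. -/

/-- The cofactor of the inner branch points in the discriminant. -/
def cofactor (q₂ q₁ q₀ : ℝ) (z : ℂ) : ℂ := q₂ * z ^ 2 + q₁ * z + q₀

/-- The data of the two inner branch points of a model with a bounded curve. -/
structure IsBranchData (S : Finset (ℤ × ℤ)) (t f g h x₁ x₂ q₂ q₁ q₀ : ℝ) : Prop where
  model : IsKernelModel S t 1 f g h
  pos : 0 < x₁
  lt : x₁ < x₂
  lt_one : x₂ < 1
  disc_eq : ∀ z : ℂ, disc S t z = (z - x₁) * (z - x₂) * cofactor q₂ q₁ q₀ z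
  cofactor_pos : ∀ x : ℝ, -1 ≤ x → x ≤ 1 → 0 < q₂ * x ^ 2 + q₁ * x + q₀
  b_left : 0 < t * (1 + f * x₁ ^ 2) - x₁
  b_right : t * (1 + f * x₂ ^ 2) - x₂ < 0

/-- The branch of `Y(x)` of smaller modulus, analytic off `[x₁, x₂]`. -/
def innerBranch (S : Finset (ℤ × ℤ)) (t x₁ x₂ q₂ q₁ q₀ : ℝ) (z : ℂ) : ℂ :=
  (-coeffB S t z - cutSqrt x₁ x₂ (cofactor q₂ q₁ q₀) z) / (2 * coeffA S t z)

/-- The upper arc of the curve, parametrized by `[x₁, x₂]`. -/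
def upperArc (t f g x₁ x₂ q₂ q₁ q₀ x : ℝ) : ℂ :=
  ⟨-(t * (1 + f * x ^ 2) - x) / (2 * (t * (x ^ 2 + g * x))),
    Real.sqrt ((x - x₁) * (x₂ - x) * (q₂ * x ^ 2 + q₁ * x + q₀)) / (2 * (t * (x ^ 2 + g * x)))⟩

namespace IsKernelModel

variable {S : Finset (ℤ × ℤ)} {t f g h : ℝ}

theorem isWeights (hm : IsKernelModel S t 1 f g h) : IsWeights t f g h where
  f_mem := hm.f_mem
  g_mem := hm.g_mem
  h_mem := hm.h_mem
  fh := hm.fh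
  t_pos := hm.t_pos
  t_lt := by have := hm.t_lt; linarith

theorem coeffA_ofReal (hm : IsKernelModel S t 1 f g h) (x : ℝ) :
    coeffA S t x = ((t * (x ^ 2 + g * x) : ℝ) : ℂ) := by
  rw [hm.coeffA_eq]; push_cast; ring

theorem coeffB_ofReal (hm : IsKernelModel S t 1 f g h) (x : ℝ) :
    coeffB S t x = ((t * (1 + f * x ^ 2) - x : ℝ) : ℂ) := by
  rw [hm.coeffB_eq]; push_cast; ring

theorem coeffC_ofReal (hm : IsKernelModel S t 1 f g h) (x : ℝ) :
    coeffC S t x = ((t * (f + h * x) : ℝ) : ℂ) := by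
  rw [hm.coeffC_eq]; push_cast; ring

theorem disc_eq_discPoly (hm : IsKernelModel S t 1 f g h) (z : ℂ) :
    disc S t z = discPoly (t : ℂ) f g h z := by
  rw [disc, hm.coeffA_eq, hm.coeffB_eq, hm.coeffC_eq, discPoly]
  push_cast
  ring

theorem discTilde_eq_discTildePoly (hm : IsKernelModel S t 1 f g h) (z : ℂ) :
    discTilde S t z = discTildePoly (t : ℂ) f g h z := by
  rw [discTilde, hm.coeffATilde_eq, hm.coeffBTilde_eq, hm.coeffCTilde_eq, discTildePoly]
  push_cast
  ring

theorem coeffA_pos (hm : IsKernelModel S t 1 f g h) {x : ℝ} (hx : 0 < x) :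
    0 < t * (x ^ 2 + g * x) := by
  have := hm.t_pos
  have := hm.isWeights.g_nonneg
  positivity

theorem coeffC_pos (hm : IsKernelModel S t 1 f g h) {x : ℝ} (hx : 0 < x) :
    0 < t * (f + h * x) := by
  have := hm.t_pos
  have : 0 < f + h * x := by
    have := hm.fh
    rcases hm.f_mem with rfl | rfl <;> rcases hm.h_mem with rfl | rfl <;> linarith
  positivity

theorem coeffA_ne_zero (hm : IsKernelModel S t 1 f g h) {z : ℂ} (hz : 0 < z.re) :
    coeffA S t z ≠ 0 := by
  have h1 : z ≠ 0 := fun h => by simp [h] at hz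
  have h2 : z + g ≠ 0 := fun h => by
    have := congrArg Complex.re h
    simp only [Complex.add_re, Complex.ofReal_re, Complex.zero_re] at this
    linarith [hm.isWeights.g_nonneg]
  have h3 : (t : ℂ) ≠ 0 := by exact_mod_cast hm.t_pos.ne'
  rw [hm.coeffA_eq, show (t : ℂ) * (((1 : ℝ) : ℂ) * z ^ 2 + g * z) = t * (z * (z + g)) by
    push_cast; ring]
  exact mul_ne_zero h3 (mul_ne_zero h1 h2)

/-- On the cut c/a is |Y(x)|², so the curve is traversed with decreasing modulus. -/
theorem coeffC_div_coeffA_strictAntiOn (hm : IsKernelModel S t 1 f g h) {p q : ℝ} (hp : 0 < p) :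
    StrictAntiOn (fun x => t * (f + h * x) / (t * (x ^ 2 + g * x))) (Set.Icc p q) := by
  intro x hx y hy hxy
  have hx0 : 0 < x := hp.trans_le hx.1
  have hy0 : 0 < y := hx0.trans hxy
  simp only
  rw [div_lt_div_iff₀ (hm.coeffA_pos hy0) (hm.coeffA_pos hx0)]
  have ht := pow_pos hm.t_pos 2
  have hf := hm.isWeights.f_nonneg
  have hg := hm.isWeights.g_nonneg
  have hh := hm.isWeights.h_nonneg
  have h1 : t * (f + h * x) * (t * (y ^ 2 + g * y)) - t * (f + h * y) * (t * (x ^ 2 + g * x)) =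
      t ^ 2 * ((y - x) * (f * (x + y) + f * g + h * (x * y))) := by ring
  have h2 : 0 < f * (x + y) + f * g + h * (x * y) := by
    have := mul_pos hx0 hy0
    have := mul_nonneg hf hg
    have := hm.fh
    rcases hm.f_mem with rfl | rfl <;> rcases hm.h_mem with rfl | rfl <;> nlinarith
  have h3 := mul_pos ht (mul_pos (sub_pos.2 hxy) h2)
  linarith

/-- On the cut this is monotonicity of (x |Y(x)|)². It extends the bound x₂² r < 1 from the end x₂
to the whole cut. -/
theorem sq_mul_coeffC_div_coeffA_le (hm : IsKernelModel S t 1 f g h) {x y : ℝ} (hx : 0 < x)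
    (hxy : x ≤ y) :
    x ^ 2 * (t * (f + h * x) / (t * (x ^ 2 + g * x))) ≤
      y ^ 2 * (t * (f + h * y) / (t * (y ^ 2 + g * y))) := by
  have hy : 0 < y := hx.trans_le hxy
  rw [← mul_div_assoc, ← mul_div_assoc, div_le_div_iff₀ (hm.coeffA_pos hx) (hm.coeffA_pos hy)]
  have hf := hm.isWeights.f_nonneg
  have hg := hm.isWeights.g_nonneg
  have hh := hm.isWeights.h_nonneg
  have h1 : y ^ 2 * (t * (f + h * y)) * (t * (x ^ 2 + g * x)) -
      x ^ 2 * (t * (f + h * x)) * (t * (y ^ 2 + g * y)) =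
      t ^ 2 * (x * y) * ((y - x) * (f * g + h * (x * y) + h * g * (x + y))) := by ring
  have h2 : 0 ≤ t ^ 2 * (x * y) * ((y - x) * (f * g + h * (x * y) + h * g * (x + y))) := by
    have := sub_nonneg.2 hxy
    positivity
  linarith

/-- The product of the two distinct roots in `x` of `K(·, y)` is `1 / y`. -/
theorem mul_mul_eq_one (hm : IsKernelModel S t 1 f g h) {x x' y : ℂ} (hne : x ≠ x')
    (h1 : kernel S t x y = 0) (h2 : kernel S t x' y = 0) : x * x' * y = 1 := by
  have hw := hm.isWeights
  rw [hm.kernel_eq] at h1 h2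
  push_cast at h1 h2
  have e1 : (x - x') * ((y + f) * (x * x' * y - 1)) = 0 := by
    have ht : (t : ℂ) ≠ 0 := by exact_mod_cast hm.t_pos.ne'
    apply mul_left_cancel₀ ht
    linear_combination x' * h1 - x * h2
  have e2 := (mul_eq_zero.1 e1).resolve_left (sub_ne_zero.2 hne)
  rcases mul_eq_zero.1 e2 with h3 | h3
  -- At y = -f both ã and c̃ vanish, so K(·, y) is linear with nonzero slope and has only the root
  -- 0.
  · exfalso
    have hy : y = -f := eq_neg_of_add_eq_zero_left h3
    have e3 : ∀ z : ℂ, t * (1 * (z ^ 2 * y ^ 2 + y) + f * (1 + z ^ 2 * y) + g * (z * y ^ 2) + h * z)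
        - z * y = z * (((t * (g * f ^ 2 + h) + f : ℝ)) : ℂ) := by
      intro z
      have hf : (f : ℂ) ^ 2 = f := by exact_mod_cast hw.f_sq
      rw [hy]; push_cast; linear_combination (t * (z ^ 2) * f - t * z ^ 2 * f) * hf
    have hpos : 0 < t * (g * f ^ 2 + h) + f := by
      have := hm.t_pos
      have := hw.g_nonneg
      have := hm.fh
      rcases hm.f_mem with rfl | rfl <;> rcases hm.h_mem with rfl | rfl <;> nlinarith
    have hne0 : (((t * (g * f ^ 2 + h) + f : ℝ)) : ℂ) ≠ 0 := by exact_mod_cast hpos.ne'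
    rw [e3] at h1 h2
    exact hne (((mul_eq_zero.1 h1).resolve_right hne0).trans
      ((mul_eq_zero.1 h2).resolve_right hne0).symm)
  · exact sub_eq_zero.1 h3

end IsKernelModel

namespace IsBranchData

variable {S : Finset (ℤ × ℤ)} {t f g h x₁ x₂ q₂ q₁ q₀ : ℝ}

theorem cutSqrt_sq_eq (hd : IsBranchData S t f g h x₁ x₂ q₂ q₁ q₀) (z : ℂ) :
    cutSqrt x₁ x₂ (cofactor q₂ q₁ q₀) z ^ 2 = disc S t z := by
  rw [cutSqrt_sq, hd.disc_eq]

theorem kernel_innerBranch (hd : IsBranchData S t f g h x₁ x₂ q₂ q₁ q₀) {z : ℂ} (hz : 0 < z.re) :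
    kernel S t z (innerBranch S t x₁ x₂ q₂ q₁ q₀ z) = 0 := by
  have ha := hd.model.coeffA_ne_zero hz
  have hs := hd.cutSqrt_sq_eq z
  rw [hd.model.kernel_eq_quadratic, innerBranch]
  rw [disc] at hs
  field_simp
  linear_combination hs

theorem cofactor_ofReal (x : ℝ) :
    cofactor q₂ q₁ q₀ x = ((q₂ * x ^ 2 + q₁ * x + q₀ : ℝ) : ℂ) := by
  simp [cofactor]

theorem pos_of_mem (hd : IsBranchData S t f g h x₁ x₂ q₂ q₁ q₀) {x : ℝ}
    (hx : x ∈ Set.Icc x₁ x₂) : 0 < x := hd.pos.trans_le hx.1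

theorem cofactor_pos_of_mem (hd : IsBranchData S t f g h x₁ x₂ q₂ q₁ q₀) {x : ℝ}
    (hx : x ∈ Set.Icc x₁ x₂) : 0 < q₂ * x ^ 2 + q₁ * x + q₀ :=
  hd.cofactor_pos x (by linarith [hd.pos_of_mem hx]) (by linarith [hx.2, hd.lt_one])

theorem innerBranch_ofReal (hd : IsBranchData S t f g h x₁ x₂ q₂ q₁ q₀) {x : ℝ}
    (hx : x ∈ Set.Icc x₁ x₂) :
    innerBranch S t x₁ x₂ q₂ q₁ q₀ x = upperArc t f g x₁ x₂ q₂ q₁ q₀ x := by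
  rw [innerBranch, cutSqrt_ofReal hx (hd.cofactor_pos_of_mem hx).le (cofactor_ofReal x),
    hd.model.coeffA_ofReal, hd.model.coeffB_ofReal]
  have : ∀ a b s : ℝ, (-(b : ℂ) - -Complex.I * s) / (2 * a) = ⟨-b / (2 * a), s / (2 * a)⟩ := by
    intro a b s
    have e : (⟨-b / (2 * a), s / (2 * a)⟩ : ℂ) =
      ((-b / (2 * a) : ℝ) : ℂ) + ((s / (2 * a) : ℝ) : ℂ) * Complex.I := by
      rw [Complex.mk_eq_add_mul_I]
    rw [e]
    push_cast
    ring
  rw [this]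
  rfl

theorem conj_upperArc_eq (hd : IsBranchData S t f g h x₁ x₂ q₂ q₁ q₀) {x : ℝ}
    (hx : x ∈ Set.Icc x₁ x₂) :
    conj (upperArc t f g x₁ x₂ q₂ q₁ q₀ x) =
      (-coeffB S t x - -cutSqrt x₁ x₂ (cofactor q₂ q₁ q₀) x) / (2 * coeffA S t x) := by
  rw [← hd.innerBranch_ofReal hx, innerBranch, cutSqrt_ofReal hx (hd.cofactor_pos_of_mem hx).le
    (cofactor_ofReal x), hd.model.coeffA_ofReal, hd.model.coeffB_ofReal]
  simp only [map_div₀, map_sub, map_neg, map_mul, Complex.conj_ofReal, Complex.conj_I]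
  rw [show conj (2 : ℂ) = 2 from map_ofNat _ 2]
  ring

theorem mem_curveL_iff (hd : IsBranchData S t f g h x₁ x₂ q₂ q₁ q₀) {y : ℂ} :
    y ∈ curveL S t x₁ x₂ ↔ ∃ x ∈ Set.Icc x₁ x₂, y = upperArc t f g x₁ x₂ q₂ q₁ q₀ x ∨
      y = conj (upperArc t f g x₁ x₂ q₂ q₁ q₀ x) := by
  have key : ∀ x ∈ Set.Icc x₁ x₂, kernel S t x y = 0 ↔ y = upperArc t f g x₁ x₂ q₂ q₁ q₀ x ∨
      y = conj (upperArc t f g x₁ x₂ q₂ q₁ q₀ x) := by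
    intro x hx
    have ha := hd.model.coeffA_ne_zero (z := (x : ℂ)) (by simpa using hd.pos_of_mem hx)
    have hs := hd.cutSqrt_sq_eq x
    rw [hd.conj_upperArc_eq hx, ← hd.innerBranch_ofReal hx, innerBranch,
      hd.model.kernel_eq_quadratic, eq_div_iff (mul_ne_zero two_ne_zero ha),
      eq_div_iff (mul_ne_zero two_ne_zero ha)]
    rw [disc] at hs
    set σ := cutSqrt x₁ x₂ (cofactor q₂ q₁ q₀) x
    constructor
    · intro h0
      have : (y * (2 * coeffA S t x) - (-coeffB S t x - σ)) *
          (y * (2 * coeffA S t x) - (-coeffB S t x - -σ)) = 0 := by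
        linear_combination 4 * coeffA S t x * h0 - hs
      rcases mul_eq_zero.1 this with h1 | h1
      · exact Or.inl (sub_eq_zero.1 h1)
      · exact Or.inr (sub_eq_zero.1 h1)
    · intro h1
      have : (y * (2 * coeffA S t x) - (-coeffB S t x - σ)) *
          (y * (2 * coeffA S t x) - (-coeffB S t x - -σ)) = 0 := by
        rcases h1 with h1 | h1 <;> rw [h1] <;> ring
      have h4 : (4 * coeffA S t x) ≠ 0 := mul_ne_zero (by norm_num) ha
      apply mul_left_cancel₀ h4
      linear_combination this + hs
  unfold curveL
  constructor
  · rintro ⟨x, hx, h0⟩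
    exact ⟨x, hx, (key x hx).1 h0⟩
  · rintro ⟨x, hx, h0⟩
    exact ⟨x, hx, (key x hx).2 h0⟩

theorem upperArc_im_nonneg (hd : IsBranchData S t f g h x₁ x₂ q₂ q₁ q₀) {x : ℝ}
    (hx : x ∈ Set.Icc x₁ x₂) : 0 ≤ (upperArc t f g x₁ x₂ q₂ q₁ q₀ x).im := by
  have := hd.model.coeffA_pos (hd.pos_of_mem hx)
  simp only [upperArc]
  positivity

theorem eq_or_eq_of_upperArc_im (hd : IsBranchData S t f g h x₁ x₂ q₂ q₁ q₀) {x : ℝ}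
    (hx : x ∈ Set.Icc x₁ x₂) (h0 : (upperArc t f g x₁ x₂ q₂ q₁ q₀ x).im = 0) :
    x = x₁ ∨ x = x₂ := by
  have ha := hd.model.coeffA_pos (hd.pos_of_mem hx)
  have hc := hd.cofactor_pos_of_mem hx
  by_contra! hn
  have h1 : 0 < x - x₁ := sub_pos.2 (lt_of_le_of_ne hx.1 (Ne.symm hn.1))
  have h2 : 0 < x₂ - x := sub_pos.2 (lt_of_le_of_ne hx.2 hn.2)
  have h3 : 0 < Real.sqrt ((x - x₁) * (x₂ - x) * (q₂ * x ^ 2 + q₁ * x + q₀)) :=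
    Real.sqrt_pos.2 (by positivity)
  simp only [upperArc] at h0
  exact (div_pos h3 (by positivity : 0 < 2 * (t * (x ^ 2 + g * x)))).ne' h0

theorem upperArc_left :
    upperArc t f g x₁ x₂ q₂ q₁ q₀ x₁ =
      ((-(t * (1 + f * x₁ ^ 2) - x₁) / (2 * (t * (x₁ ^ 2 + g * x₁))) : ℝ) : ℂ) := by
  apply Complex.ext
  · rw [Complex.ofReal_re]; rfl
  · rw [Complex.ofReal_im]; simp [upperArc]

theorem upperArc_right :
    upperArc t f g x₁ x₂ q₂ q₁ q₀ x₂ =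
      ((-(t * (1 + f * x₂ ^ 2) - x₂) / (2 * (t * (x₂ ^ 2 + g * x₂))) : ℝ) : ℂ) := by
  apply Complex.ext
  · rw [Complex.ofReal_re]; rfl
  · rw [Complex.ofReal_im]; simp [upperArc]

theorem branchValue_ofReal (hm : IsKernelModel S t 1 f g h) (x : ℝ) :
    branchValue S t x =
      ((-(t * (1 + f * x ^ 2) - x) / (2 * (t * (x ^ 2 + g * x))) : ℝ) : ℂ) := by
  rw [branchValue, hm.coeffA_ofReal, hm.coeffB_ofReal]
  push_cast
  ring

theorem continuousOn_upperArc (hd : IsBranchData S t f g h x₁ x₂ q₂ q₁ q₀) :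
    ContinuousOn (upperArc t f g x₁ x₂ q₂ q₁ q₀) (Set.Icc x₁ x₂) := by
  have e : upperArc t f g x₁ x₂ q₂ q₁ q₀ = fun x : ℝ =>
      ((-(t * (1 + f * x ^ 2) - x) / (2 * (t * (x ^ 2 + g * x))) : ℝ) : ℂ) +
      ((Real.sqrt ((x - x₁) * (x₂ - x) * (q₂ * x ^ 2 + q₁ * x + q₀)) /
        (2 * (t * (x ^ 2 + g * x))) : ℝ) : ℂ) * Complex.I := by
    ext x
    rw [← Complex.mk_eq_add_mul_I]
    rfl
  rw [e]
  have hne : ∀ x ∈ Set.Icc x₁ x₂, 2 * (t * (x ^ 2 + g * x)) ≠ 0 := fun x hx => by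
    have := hd.model.coeffA_pos (hd.pos_of_mem hx)
    positivity
  refine (Complex.continuous_ofReal.comp_continuousOn
    (ContinuousOn.div (by fun_prop) (by fun_prop) hne)).add
    ((Complex.continuous_ofReal.comp_continuousOn
    (ContinuousOn.div ?_ (by fun_prop) hne)).mul continuousOn_const)
  exact (Real.continuous_sqrt.comp (by fun_prop)).continuousOn

theorem disc_real (hd : IsBranchData S t f g h x₁ x₂ q₂ q₁ q₀) (x : ℝ) :
    (t * (1 + f * x ^ 2) - x) ^ 2 - 4 * (t * (x ^ 2 + g * x)) * (t * (f + h * x)) =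
      (x - x₁) * (x - x₂) * (q₂ * x ^ 2 + q₁ * x + q₀) := by
  have := hd.disc_eq x
  rw [disc, hd.model.coeffA_ofReal, hd.model.coeffB_ofReal, hd.model.coeffC_ofReal,
    cofactor_ofReal] at this
  exact_mod_cast this

theorem norm_upperArc_sq (hd : IsBranchData S t f g h x₁ x₂ q₂ q₁ q₀) {x : ℝ}
    (hx : x ∈ Set.Icc x₁ x₂) : ‖upperArc t f g x₁ x₂ q₂ q₁ q₀ x‖ ^ 2 =
      t * (f + h * x) / (t * (x ^ 2 + g * x)) := by
  have ha := hd.model.coeffA_pos (hd.pos_of_mem hx)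
  have h0 : 0 ≤ (x - x₁) * (x₂ - x) * (q₂ * x ^ 2 + q₁ * x + q₀) :=
    mul_nonneg (mul_nonneg (sub_nonneg.2 hx.1) (sub_nonneg.2 hx.2)) (hd.cofactor_pos_of_mem hx).le
  have hs := Real.sq_sqrt h0
  have hdr := hd.disc_real x
  rw [Complex.sq_norm, Complex.normSq_apply]
  simp only [upperArc]
  set s := Real.sqrt ((x - x₁) * (x₂ - x) * (q₂ * x ^ 2 + q₁ * x + q₀))
  rw [← mul_div_mul_comm, ← mul_div_mul_comm, ← add_div, div_eq_div_iff (by positivity) ha.ne']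
  linear_combination (t * (x ^ 2 + g * x)) * (hs + hdr)

/-- The curve as the locus `a |y|² = c`, `2 a Re y + b = 0`. -/
theorem mem_curveL_iff_norm (hd : IsBranchData S t f g h x₁ x₂ q₂ q₁ q₀) (y : ℂ) :
    (∃ x ∈ Set.Icc x₁ x₂, t * (x ^ 2 + g * x) * ‖y‖ ^ 2 = t * (f + h * x) ∧
      2 * (t * (x ^ 2 + g * x)) * y.re + (t * (1 + f * x ^ 2) - x) = 0) ↔
      y ∈ curveL S t x₁ x₂ := by
  rw [hd.mem_curveL_iff]
  have key : ∀ x ∈ Set.Icc x₁ x₂, ∀ y' : ℂ, y'.re = (upperArc t f g x₁ x₂ q₂ q₁ q₀ x).re →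
      ‖y'‖ = ‖upperArc t f g x₁ x₂ q₂ q₁ q₀ x‖ →
      t * (x ^ 2 + g * x) * ‖y'‖ ^ 2 = t * (f + h * x) ∧
      2 * (t * (x ^ 2 + g * x)) * y'.re + (t * (1 + f * x ^ 2) - x) = 0 := by
    intro x hx y' h1 h2
    have ha := hd.model.coeffA_pos (hd.pos_of_mem hx)
    rw [h1, h2, hd.norm_upperArc_sq hx]
    refine ⟨mul_div_cancel₀ _ ha.ne', ?_⟩
    simp only [upperArc]
    rw [mul_div_cancel₀ _ (mul_pos two_pos ha).ne']
    ring
  constructor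
  · rintro ⟨x, hx, h1, h2⟩
    refine ⟨x, hx, ?_⟩
    have ha := hd.model.coeffA_pos (hd.pos_of_mem hx)
    obtain ⟨k1, k2⟩ := key x hx _ rfl rfl
    set Y := upperArc t f g x₁ x₂ q₂ q₁ q₀ x
    have e1 : y.re = Y.re := by
      apply mul_left_cancel₀ (mul_pos two_pos ha).ne'
      linarith
    have e2 : ‖y‖ ^ 2 = ‖Y‖ ^ 2 := mul_left_cancel₀ ha.ne' (h1.trans k1.symm)
    rw [Complex.sq_norm, Complex.sq_norm, Complex.normSq_apply, Complex.normSq_apply, e1] at e2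
    have e3 : (y.im - Y.im) * (y.im + Y.im) = 0 := by linarith
    rcases mul_eq_zero.1 e3 with e | e
    · exact Or.inl (Complex.ext e1 (sub_eq_zero.1 e))
    · exact Or.inr (Complex.ext (by simpa using e1) (by simpa using eq_neg_of_add_eq_zero_left e))
  · rintro ⟨x, hx, rfl | rfl⟩
    · exact ⟨x, hx, key x hx _ rfl rfl⟩
    · exact ⟨x, hx, key x hx _ (by simp) (by simp)⟩

theorem isClosed_curveL (hd : IsBranchData S t f g h x₁ x₂ q₂ q₁ q₀) :
    IsClosed (curveL S t x₁ x₂) := by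
  have e : curveL S t x₁ x₂ = upperArc t f g x₁ x₂ q₂ q₁ q₀ '' Set.Icc x₁ x₂ ∪
      (fun x => conj (upperArc t f g x₁ x₂ q₂ q₁ q₀ x)) '' Set.Icc x₁ x₂ := by
    ext y
    rw [hd.mem_curveL_iff]
    constructor
    · rintro ⟨x, hx, rfl | rfl⟩
      · exact Or.inl ⟨x, hx, rfl⟩
      · exact Or.inr ⟨x, hx, rfl⟩
    · rintro (⟨x, hx, rfl⟩ | ⟨x, hx, rfl⟩)
      · exact ⟨x, hx, Or.inl rfl⟩
      · exact ⟨x, hx, Or.inr rfl⟩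
  rw [e]
  have hc := hd.continuousOn_upperArc
  exact (isCompact_Icc.image_of_continuousOn hc).isClosed.union
    (isCompact_Icc.image_of_continuousOn (Complex.continuous_conj.comp_continuousOn hc)).isClosed

end IsBranchData

/-! ### Limits of the inner branch on the cut. -/

theorem tendsto_quotient {a b σ : ℂ → ℂ} {a₀ b₀ s : ℂ} {l : Filter ℂ} (ha : Tendsto a l (𝓝 a₀))
    (hb : Tendsto b l (𝓝 b₀)) (h0 : a₀ ≠ 0) (hσ : Tendsto σ l (𝓝 s)) :
    Tendsto (fun z => (-b z - σ z) / (2 * a z)) l (𝓝 ((-b₀ - s) / (2 * a₀))) :=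
  (hb.neg.sub hσ).div (ha.const_mul 2) (mul_ne_zero two_ne_zero h0)

theorem tendsto_quotient_sup {a b σ : ℂ → ℂ} {a₀ b₀ s : ℂ} {l : Filter ℂ}
    (ha : Tendsto a l (𝓝 a₀)) (hb : Tendsto b l (𝓝 b₀)) (h0 : a₀ ≠ 0)
    (hσ : Tendsto σ l (𝓝 s ⊔ 𝓝 (-s))) :
    Tendsto (fun z => (-b z - σ z) / (2 * a z)) l
      (𝓝 ((-b₀ - s) / (2 * a₀)) ⊔ 𝓝 ((-b₀ - -s) / (2 * a₀))) := by
  obtain ⟨F, hF⟩ : ∃ F : (ℂ × ℂ) × ℂ → ℂ, F = fun w => (-w.1.2 - w.2) / (2 * w.1.1) := ⟨_, rfl⟩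
  have key : ∀ s : ℂ, Tendsto F (𝓝 (a₀, b₀) ×ˢ 𝓝 s) (𝓝 ((-b₀ - s) / (2 * a₀))) := by
    intro s
    have : ContinuousAt F ((a₀, b₀), s) := by
      rw [hF]
      exact ContinuousAt.div (by fun_prop) (by fun_prop) (mul_ne_zero two_ne_zero h0)
    have h1 := this.tendsto
    rw [nhds_prod_eq, hF] at h1
    rw [hF]
    exact h1
  have h1 : Tendsto (fun z => ((a z, b z), σ z)) l (𝓝 (a₀, b₀) ×ˢ (𝓝 s ⊔ 𝓝 (-s))) :=
    (ha.prodMk_nhds hb).prodMk hσ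
  rw [prod_sup] at h1
  have h2 := ((key s).sup_sup (key (-s))).comp h1
  rw [hF] at h2
  exact h2

namespace IsBranchData

variable {S : Finset (ℤ × ℤ)} {t f g h x₁ x₂ q₂ q₁ q₀ : ℝ}

theorem left_mem (hd : IsBranchData S t f g h x₁ x₂ q₂ q₁ q₀) : x₁ ∈ Set.Icc x₁ x₂ :=
  ⟨le_rfl, hd.lt.le⟩

theorem right_mem (hd : IsBranchData S t f g h x₁ x₂ q₂ q₁ q₀) : x₂ ∈ Set.Icc x₁ x₂ :=
  ⟨hd.lt.le, le_rfl⟩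

/-- The two real points `-R` and `r` of the curve. -/
theorem exists_radii (hd : IsBranchData S t f g h x₁ x₂ q₂ q₁ q₀) :
    ∃ r R : ℝ, 0 < r ∧ r < R ∧
      upperArc t f g x₁ x₂ q₂ q₁ q₀ x₁ = ((-R : ℝ) : ℂ) ∧
      upperArc t f g x₁ x₂ q₂ q₁ q₀ x₂ = (r : ℂ) ∧
      branchValue S t x₁ = ((-R : ℝ) : ℂ) ∧ branchValue S t x₂ = (r : ℂ) ∧
      x₂ ^ 2 * r < 1 ∧ Metric.ball 0 r ⊆ domainOf (curveL S t x₁ x₂) ∧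
      t * (x₂ ^ 2 + g * x₂) * r ^ 2 = t * (f + h * x₂) ∧
      t * (x₂ ^ 2 + g * x₂) * r ^ 2 + (t * (1 + f * x₂ ^ 2) - x₂) * r + t * (f + h * x₂) = 0 := by
  have hm := hd.model
  have hx2 : 0 < x₂ := hd.pos.trans hd.lt
  have ha1 := hm.coeffA_pos hd.pos
  have ha2 := hm.coeffA_pos hx2
  obtain ⟨r, hr⟩ : ∃ r, r = -(t * (1 + f * x₂ ^ 2) - x₂) / (2 * (t * (x₂ ^ 2 + g * x₂))) := ⟨_, rfl⟩
  obtain ⟨R, hR⟩ : ∃ R, R = (t * (1 + f * x₁ ^ 2) - x₁) / (2 * (t * (x₁ ^ 2 + g * x₁))) := ⟨_, rfl⟩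
  have hr0 : 0 < r := by
    rw [hr]
    exact div_pos (by linarith [hd.b_right]) (by linarith)
  have hR0 : 0 < R := by
    rw [hR]
    exact div_pos hd.b_left (by linarith)
  -- At a branch point the quadratic in y has a double root, so b and c are read off from a and that
  -- root.
  have hbr : t * (1 + f * x₂ ^ 2) - x₂ = -2 * (t * (x₂ ^ 2 + g * x₂)) * r := by
    rw [eq_div_iff (by linarith)] at hr
    linarith
  have hbR : t * (1 + f * x₁ ^ 2) - x₁ = 2 * (t * (x₁ ^ 2 + g * x₁)) * R := by
    rw [eq_div_iff (by linarith)] at hR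
    linarith
  have hcr : t * (f + h * x₂) = t * (x₂ ^ 2 + g * x₂) * r ^ 2 := by
    have := hd.disc_real x₂
    rw [hbr] at this
    apply mul_left_cancel₀ (mul_pos four_pos ha2).ne'
    linear_combination -this
  have hcR : t * (f + h * x₁) = t * (x₁ ^ 2 + g * x₁) * R ^ 2 := by
    have := hd.disc_real x₁
    rw [hbR] at this
    apply mul_left_cancel₀ (mul_pos four_pos ha1).ne'
    linear_combination -this
  have hanti := hm.coeffC_div_coeffA_strictAntiOn (q := x₂) hd.pos
  have hrR : r < R := by
    have := hanti hd.left_mem hd.right_mem hd.lt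
    simp only [hcr, hcR] at this
    rw [mul_div_cancel_left₀ _ ha1.ne', mul_div_cancel_left₀ _ ha2.ne'] at this
    exact lt_of_pow_lt_pow_left₀ 2 hR0.le this
  have hbv2 : branchValue S t x₂ = (r : ℂ) := by rw [branchValue_ofReal hm, hr]
  have hbv1 : branchValue S t x₁ = ((-R : ℝ) : ℂ) := by rw [branchValue_ofReal hm, hR, neg_div]
  refine ⟨r, R, hr0, hrR, ?_, ?_, hbv1, hbv2, ?_, ?_, hcr.symm, ?_⟩
  · rw [upperArc_left, hR, neg_div]
  · rw [upperArc_right, hr]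
  · exact hm.isWeights.sq_mul_lt_one hx2 hd.lt_one hr0 (by rw [hbr, hcr]; ring) (by rw [hbr]; ring)
  · exact ball_subset_domainOf (a := fun x => t * (x ^ 2 + g * x))
      (b := fun x => t * (1 + f * x ^ 2) - x) (c := fun x => t * (f + h * x)) hd.lt.le
      (by fun_prop) (by fun_prop) (by fun_prop) (fun x hx => hm.coeffA_pos (hd.pos_of_mem hx))
      hanti hr0 hrR hcr hcR hbr hbR
      hd.mem_curveL_iff_norm
  · rw [hbr, hcr]; ring

theorem _root_.ThreeQuadrant.IsKernelModel.continuous_coeffA (hm : IsKernelModel S t 1 f g h) :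
    Continuous (coeffA S t) := by
  rw [funext hm.coeffA_eq]
  fun_prop

theorem _root_.ThreeQuadrant.IsKernelModel.continuous_coeffB (hm : IsKernelModel S t 1 f g h) :
    Continuous (coeffB S t) := by
  rw [funext hm.coeffB_eq]
  fun_prop

theorem coeffA_ne_zero_of_mem (hd : IsBranchData S t f g h x₁ x₂ q₂ q₁ q₀) {x : ℝ}
    (hx : x ∈ Set.Icc x₁ x₂) : coeffA S t x ≠ 0 :=
  hd.model.coeffA_ne_zero (z := (x : ℂ)) (by simpa using hd.pos_of_mem hx)

theorem tendsto_innerBranch_of_cutSqrt (hd : IsBranchData S t f g h x₁ x₂ q₂ q₁ q₀) {x : ℝ}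
    (hx : x ∈ Set.Icc x₁ x₂) {s : ℂ} {l : Filter ℂ} (hl : l ≤ 𝓝 (x : ℂ))
    (hs : Tendsto (cutSqrt x₁ x₂ (cofactor q₂ q₁ q₀)) l (𝓝 s)) :
    Tendsto (innerBranch S t x₁ x₂ q₂ q₁ q₀) l
      (𝓝 ((-coeffB S t x - s) / (2 * coeffA S t x))) :=
  tendsto_quotient ((hd.model.continuous_coeffA.tendsto _).mono_left hl)
    ((hd.model.continuous_coeffB.tendsto _).mono_left hl) (hd.coeffA_ne_zero_of_mem hx) hs

theorem continuous_cofactor : Continuous (cofactor q₂ q₁ q₀) := by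
  unfold cofactor
  fun_prop

/-- The lower side of the cut goes to the upper arc, because the boundary value of the square root
is -i times a nonnegative number there. -/
theorem tendsto_innerBranch_lower (hd : IsBranchData S t f g h x₁ x₂ q₂ q₁ q₀) {x : ℝ}
    (hx : x ∈ Set.Icc x₁ x₂) :
    Tendsto (innerBranch S t x₁ x₂ q₂ q₁ q₀) (𝓝[{z | z.im < 0}] x)
      (𝓝 (upperArc t f g x₁ x₂ q₂ q₁ q₀ x)) := by
  rw [← hd.innerBranch_ofReal hx]
  exact hd.tendsto_innerBranch_of_cutSqrt hx nhdsWithin_le_nhds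
    (tendsto_cutSqrt hd.lt hx (hd.cofactor_pos_of_mem hx) (cofactor_ofReal x)
      continuous_cofactor.continuousAt).1

theorem tendsto_innerBranch_upper (hd : IsBranchData S t f g h x₁ x₂ q₂ q₁ q₀) {x : ℝ}
    (hx : x ∈ Set.Icc x₁ x₂) :
    Tendsto (innerBranch S t x₁ x₂ q₂ q₁ q₀) (𝓝[{z | 0 < z.im}] x)
      (𝓝 (conj (upperArc t f g x₁ x₂ q₂ q₁ q₀ x))) := by
  rw [hd.conj_upperArc_eq hx]
  exact hd.tendsto_innerBranch_of_cutSqrt hx nhdsWithin_le_nhds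
    (tendsto_cutSqrt hd.lt hx (hd.cofactor_pos_of_mem hx) (cofactor_ofReal x)
      continuous_cofactor.continuousAt).2

/-- No side is chosen here: the cluster points are a conjugate pair. This is enough for continuity
after composing with `w`, which takes one value on the pair. -/
theorem tendsto_innerBranch (hd : IsBranchData S t f g h x₁ x₂ q₂ q₁ q₀) {x : ℝ}
    (hx : x ∈ Set.Icc x₁ x₂) :
    Tendsto (innerBranch S t x₁ x₂ q₂ q₁ q₀) (𝓝 x)
      (𝓝 (upperArc t f g x₁ x₂ q₂ q₁ q₀ x) ⊔ 𝓝 (conj (upperArc t f g x₁ x₂ q₂ q₁ q₀ x))) := by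
  have h1 : Tendsto (fun z => cutSqrt x₁ x₂ (cofactor q₂ q₁ q₀) z ^ 2) (𝓝 (x : ℂ))
      (𝓝 (cutSqrt x₁ x₂ (cofactor q₂ q₁ q₀) x ^ 2)) := by
    simp only [cutSqrt_sq]
    have : Continuous fun z : ℂ => (z - x₁) * (z - x₂) * cofactor q₂ q₁ q₀ z :=
      Continuous.mul (by fun_prop) continuous_cofactor
    exact this.tendsto _
  rw [hd.conj_upperArc_eq hx, ← hd.innerBranch_ofReal hx, innerBranch]
  exact tendsto_quotient_sup (hd.model.continuous_coeffA.tendsto _)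
    (hd.model.continuous_coeffB.tendsto _) (hd.coeffA_ne_zero_of_mem hx) (tendsto_sup_of_sq h1)

theorem differentiableAt_innerBranch (hd : IsBranchData S t f g h x₁ x₂ q₂ q₁ q₀) {z : ℂ}
    (hz : ∀ x ∈ Set.Icc x₁ x₂, z ≠ (x : ℂ)) (hre : 0 < z.re)
    (hQ : 0 < (cofactor q₂ q₁ q₀ z).re) :
    DifferentiableAt ℂ (innerBranch S t x₁ x₂ q₂ q₁ q₀) z := by
  have h1 : DifferentiableAt ℂ (coeffA S t) z := by rw [funext hd.model.coeffA_eq]; fun_prop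
  have h2 : DifferentiableAt ℂ (coeffB S t) z := by rw [funext hd.model.coeffB_eq]; fun_prop
  have h3 : DifferentiableAt ℂ (cofactor q₂ q₁ q₀) z := by unfold cofactor; fun_prop
  have h4 := differentiableAt_cutSqrt hd.lt.le hz h3 (Or.inl hQ)
  exact (h2.neg.sub h4).div (h1.const_mul 2)
    (mul_ne_zero two_ne_zero (hd.model.coeffA_ne_zero hre))

end IsBranchData

/-! ### Uniformization of the gluing function near the cut. -/

/-- A property that holds near each point of a real segment holds on a convex neighbourhood of the
segment that is symmetric about the real axis. -/
theorem exists_symmetric_nhds {p q : ℝ} {P : ℂ → Prop}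
    (hP : ∀ x ∈ Set.Icc p q, ∀ᶠ z in 𝓝 (x : ℂ), P z) :
    ∃ N : Set ℂ, IsOpen N ∧ Convex ℝ N ∧ (∀ z ∈ N, conj z ∈ N) ∧
      (∀ x ∈ Set.Icc p q, (x : ℂ) ∈ N) ∧ ∀ z ∈ N, P z := by
  obtain ⟨s, hs⟩ : ∃ s : Set ℂ, s = (fun x : ℝ => (x : ℂ)) '' Set.Icc p q := ⟨_, rfl⟩
  have hc : IsCompact s := by rw [hs]; exact isCompact_Icc.image Complex.continuous_ofReal
  have hconv : Convex ℝ s := by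
    rw [hs]
    exact (convex_Icc p q).is_linear_image (f := fun x : ℝ => (x : ℂ))
      ⟨fun _ _ => Complex.ofReal_add _ _, fun c x => by simp⟩
  have hsub : s ⊆ interior {z | P z} := by
    rw [hs]
    rintro _ ⟨x, hx, rfl⟩
    exact mem_interior_iff_mem_nhds.2 (hP x hx)
  obtain ⟨δ, hδ, hδs⟩ := hc.exists_thickening_subset_open isOpen_interior hsub
  refine ⟨Metric.thickening δ s, Metric.isOpen_thickening, hconv.thickening δ, fun z hz => ?_,
    fun x hx => Metric.self_subset_thickening hδ s (by rw [hs]; exact ⟨x, hx, rfl⟩),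
    fun z hz => interior_subset (hδs hz)⟩
  rw [Metric.mem_thickening_iff] at hz ⊢
  obtain ⟨w, hw, hzw⟩ := hz
  refine ⟨w, hw, ?_⟩
  have hw' : conj w = w := by
    rw [hs] at hw
    obtain ⟨x, -, rfl⟩ := hw
    exact Complex.conj_ofReal x
  rwa [← hw', Complex.dist_conj_conj]

/-- The slit neighbourhood is covered by four convex pieces (above, right, below, left), each
meeting the union of the preceding ones. It lets a single point decide in which component of the
complement of the curve the inner branch takes its values. -/
theorem isPreconnected_diff_segment {p q : ℝ} (hpq : p ≤ q) {N : Set ℂ} (hN : IsOpen N)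
    (hNc : Convex ℝ N) (hseg : ∀ x ∈ Set.Icc p q, (x : ℂ) ∈ N) :
    IsPreconnected (N \ ((fun x : ℝ => (x : ℂ)) '' Set.Icc p q)) := by
  have hmem : ∀ x ∈ Set.Icc p q, ∀ c : ℂ, ∃ ε : ℝ, 0 < ε ∧ (x : ℂ) + ε * c ∈ N := by
    intro x hx c
    have h1 : Tendsto (fun ε : ℝ => (x : ℂ) + ε * c) (𝓝[>] 0) (𝓝 (x : ℂ)) := by
      have h : Continuous fun ε : ℝ => (x : ℂ) + ε * c := by fun_prop
      have h0 := h.tendsto 0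
      simp only [Complex.ofReal_zero, zero_mul, add_zero] at h0
      exact h0.mono_left nhdsWithin_le_nhds
    have h2 : ∀ᶠ ε : ℝ in 𝓝[>] 0, 0 < ε := self_mem_nhdsWithin
    obtain ⟨ε, h3, h4⟩ := (h2.and (h1 (hN.mem_nhds (hseg x hx)))).exists
    exact ⟨ε, h3, h4⟩
  have cU := (hNc.inter (convex_halfSpace_im_gt 0)).isPreconnected
  have cL := (hNc.inter (convex_halfSpace_im_lt 0)).isPreconnected
  have cR := (hNc.inter (convex_halfSpace_re_gt q)).isPreconnected
  have cM := (hNc.inter (convex_halfSpace_re_lt p)).isPreconnected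
  have hp := Set.left_mem_Icc.2 hpq
  have hq := Set.right_mem_Icc.2 hpq
  have h1 : IsPreconnected ((N ∩ {z : ℂ | 0 < z.im}) ∪ (N ∩ {z : ℂ | q < z.re})) := by
    refine IsPreconnected.union' ?_ cU cR
    obtain ⟨ε, hε, hm⟩ := hmem q hq (1 + Complex.I)
    exact ⟨_, ⟨hm, by simpa using hε⟩, ⟨hm, by simpa using hε⟩⟩
  have h2 : IsPreconnected (((N ∩ {z : ℂ | 0 < z.im}) ∪ (N ∩ {z : ℂ | q < z.re})) ∪
      (N ∩ {z : ℂ | z.im < 0})) := by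
    refine IsPreconnected.union' ?_ h1 cL
    obtain ⟨ε, hε, hm⟩ := hmem q hq (1 - Complex.I)
    exact ⟨_, Or.inr ⟨hm, by simpa using hε⟩, ⟨hm, by simpa using hε⟩⟩
  have h3 : IsPreconnected ((((N ∩ {z : ℂ | 0 < z.im}) ∪ (N ∩ {z : ℂ | q < z.re})) ∪
      (N ∩ {z : ℂ | z.im < 0})) ∪ (N ∩ {z : ℂ | z.re < p})) := by
    refine IsPreconnected.union' ?_ h2 cM
    obtain ⟨ε, hε, hm⟩ := hmem p hp (-1 - Complex.I)
    exact ⟨_, Or.inr ⟨hm, by simpa using hε⟩, ⟨hm, by simpa using hε⟩⟩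
  convert h3 using 1
  ext z
  constructor
  · rintro ⟨hz, hzs⟩
    rcases lt_trichotomy z.im 0 with hi | hi | hi
    · exact Or.inl (Or.inr ⟨hz, hi⟩)
    · by_cases hr : z.re < p
      · exact Or.inr ⟨hz, hr⟩
      · refine Or.inl (Or.inl (Or.inr ⟨hz, ?_⟩))
        by_contra hr'
        exact hzs ⟨z.re, ⟨not_lt.1 hr, not_lt.1 hr'⟩, Complex.ext (by simp) (by simp [hi])⟩
    · exact Or.inl (Or.inl (Or.inl ⟨hz, hi⟩))
  · rintro (((⟨hz, h⟩ | ⟨hz, h⟩) | ⟨hz, h⟩) | ⟨hz, h⟩) <;> refine ⟨hz, ?_⟩ <;>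
      rintro ⟨x, hx, rfl⟩
    · simp at h
    · simp only [Set.mem_ofPred_eq, Complex.ofReal_re] at h; linarith [hx.2]
    · simp at h
    · simp only [Set.mem_ofPred_eq, Complex.ofReal_re] at h; linarith [hx.1]

/-- A finite boundary limit bounds `w` on the part of `G` near y, which excludes poles there. In
normal form, absence of a pole is analyticity. -/
theorem eventually_analyticAt_of_tendsto {G : Set ℂ} (hG : IsOpen G) {w : ℂ → ℂ}
    (hmer : MeromorphicNFOn w G) {y c : ℂ} (h : Tendsto w (𝓝[G] y) (𝓝 c)) :
    ∀ᶠ y' in 𝓝 y, y' ∈ G → AnalyticAt ℂ w y' := by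
  have h1 : ∀ᶠ y' in 𝓝[G] y, ‖w y'‖ < ‖c‖ + 1 :=
    h.norm.eventually (gt_mem_nhds (lt_add_one _))
  have h2 := (eventually_nhdsWithin_iff.1 h1).eventually_nhds
  filter_upwards [h2] with y' hy' hyG
  have hnf := hmer hyG
  rw [← hnf.meromorphicOrderAt_nonneg_iff_analyticAt]
  by_contra! hn
  have h3 := tendsto_cobounded_of_meromorphicOrderAt_neg hn
  have h4 : ∀ᶠ z in 𝓝[≠] y', ‖c‖ + 1 < ‖w z‖ :=
    (tendsto_norm_atTop_iff_cobounded.2 h3).eventually (eventually_gt_atTop _)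
  have h5 : ∀ᶠ z in 𝓝[≠] y', ‖w z‖ < ‖c‖ + 1 := by
    refine nhdsWithin_le_nhds ?_
    filter_upwards [hy', hG.mem_nhds hyG] with z hz hzG
    exact hz hzG
  obtain ⟨z, hz1, hz2⟩ := (h4.and h5).exists
  exact lt_asymm hz1 hz2

/-- Boundary values are themselves limits from inside, so a closed neighbourhood containing the
nearby inner values also contains the nearby boundary values. -/
theorem tendsto_of_boundary_limit {G L : Set ℂ} {w : ℂ → ℂ}
    (h : ∀ y ∈ L, Tendsto w (𝓝[G] y) (𝓝 (w y))) (hL : L ⊆ closure G) {y : ℂ} (hy : y ∈ L) :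
    Tendsto w (𝓝[G ∪ L] y) (𝓝 (w y)) := by
  rw [(closed_nhds_basis (w y)).tendsto_right_iff]
  rintro C ⟨hC, hCc⟩
  have h1 := (eventually_nhdsWithin_iff.1 (h y hy hC)).eventually_nhds
  rw [eventually_nhdsWithin_iff]
  filter_upwards [h1] with z hz hzGL
  rcases hzGL with hzG | hzL
  · exact hz.self_of_nhds hzG
  · have : (𝓝[G] z).NeBot := mem_closure_iff_nhdsWithin_neBot.1 (hL hzL)
    exact hCc.mem_of_tendsto (h z hzL) (eventually_nhdsWithin_iff.2 hz)

theorem sphereValue_of_analyticAt {w : ℂ → ℂ} {y : ℂ} (h : AnalyticAt ℂ w y) :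
    sphereValue w y = (w y : OnePoint ℂ) := by
  rw [sphereValue, if_neg (not_lt.2 h.meromorphicOrderAt_nonneg)]

namespace IsBranchData

variable {S : Finset (ℤ × ℤ)} {t f g h x₁ x₂ q₂ q₁ q₀ : ℝ}

theorem upperArc_mem_curveL (hd : IsBranchData S t f g h x₁ x₂ q₂ q₁ q₀) {x : ℝ}
    (hx : x ∈ Set.Icc x₁ x₂) : upperArc t f g x₁ x₂ q₂ q₁ q₀ x ∈ curveL S t x₁ x₂ :=
  hd.mem_curveL_iff.2 ⟨x, hx, Or.inl rfl⟩

theorem conj_upperArc_mem_curveL (hd : IsBranchData S t f g h x₁ x₂ q₂ q₁ q₀) {x : ℝ}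
    (hx : x ∈ Set.Icc x₁ x₂) : conj (upperArc t f g x₁ x₂ q₂ q₁ q₀ x) ∈ curveL S t x₁ x₂ :=
  hd.mem_curveL_iff.2 ⟨x, hx, Or.inr rfl⟩

/-- Just to the right of `x₂` the inner branch takes values in the disc of radius `Y(x₂)`. -/
theorem eventually_norm_innerBranch_lt (hd : IsBranchData S t f g h x₁ x₂ q₂ q₁ q₀) {r : ℝ}
    (hr : 0 < r) (hcr : t * (x₂ ^ 2 + g * x₂) * r ^ 2 = t * (f + h * x₂)) :
    ∀ᶠ x : ℝ in 𝓝[>] x₂, ‖innerBranch S t x₁ x₂ q₂ q₁ q₀ x‖ < r := by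
  have hm := hd.model
  have hx2 : 0 < x₂ := hd.pos.trans hd.lt
  have hb : ∀ᶠ x : ℝ in 𝓝[>] x₂, t * (1 + f * x ^ 2) - x < 0 := by
    have : Continuous fun x : ℝ => t * (1 + f * x ^ 2) - x := by fun_prop
    exact nhdsWithin_le_nhds ((this.tendsto x₂).eventually (gt_mem_nhds hd.b_right))
  have h1 : ∀ᶠ x : ℝ in 𝓝[>] x₂, x < 1 := nhdsWithin_le_nhds (gt_mem_nhds hd.lt_one)
  filter_upwards [hb, h1, self_mem_nhdsWithin] with x hbx hx1 hx
  have hx : x₂ < x := hx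
  have hx0 : 0 < x := hx2.trans hx
  have hQ := hd.cofactor_pos x (by linarith) hx1.le
  obtain ⟨s, hs0, hs⟩ := cutSqrt_ofReal_of_lt hd.lt.le hx hQ.le (cofactor_ofReal x)
  have ha := hm.coeffA_pos hx0
  have hc := hm.coeffC_pos hx0
  have hs2 : s ^ 2 = (t * (1 + f * x ^ 2) - x) ^ 2 -
      4 * (t * (x ^ 2 + g * x)) * (t * (f + h * x)) := by
    rw [hd.disc_real]
    have := hd.cutSqrt_sq_eq x
    rw [hs, hd.disc_eq, cofactor_ofReal] at this
    exact_mod_cast this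
  have hY : innerBranch S t x₁ x₂ q₂ q₁ q₀ x =
      (((-(t * (1 + f * x ^ 2) - x) - s) / (2 * (t * (x ^ 2 + g * x))) : ℝ) : ℂ) := by
    rw [innerBranch, hs, hm.coeffA_ofReal, hm.coeffB_ofReal]
    push_cast
    ring
  have hanti := hm.coeffC_div_coeffA_strictAntiOn (q := x) hx2
    ⟨le_rfl, hx.le⟩ ⟨hx.le, le_rfl⟩ hx
  simp only at hanti
  rw [← hcr, mul_div_cancel_left₀ _ (hm.coeffA_pos hx2).ne', div_lt_iff₀ ha] at hanti
  rw [hY, Complex.norm_real, Real.norm_eq_abs]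
  refine abs_lt_of_sq_lt_sq ?_ hr.le
  rw [div_pow, div_lt_iff₀ (by positivity)]
  set β := -(t * (1 + f * x ^ 2) - x) with hβ
  have hβ0 : 0 < β := by linarith
  have hbβ : t * (1 + f * x ^ 2) - x = -β := by rw [hβ]; ring
  rw [hbβ] at hs2
  have hsβ : s ≤ β := by nlinarith [mul_pos ha hc]
  -- Since 0 ≤ s ≤ β, (β - s)² ≤ (β - s)(β + s) = 4ac: the smaller root has square at most c/a,
  -- which is below r² beyond x₂.
  have h2 : (β - s) ^ 2 ≤ 4 * (t * (x ^ 2 + g * x)) * (t * (f + h * x)) := by nlinarith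
  nlinarith

theorem ne_ofReal_of_notMem {z : ℂ} (hz : z ∉ (fun x : ℝ => (x : ℂ)) '' Set.Icc x₁ x₂) :
    ∀ x ∈ Set.Icc x₁ x₂, z ≠ (x : ℂ) := fun x hx h => hz ⟨x, hx, h.symm⟩

/-- The gluing function, transported to the `x`-plane by the inner branch, is holomorphic and
injective near `[x₁, x₂]`. -/
theorem exists_uniformization (hd : IsBranchData S t f g h x₁ x₂ q₂ q₁ q₀) {w : ℂ → ℂ}
    (hw : IsConformalGluing (curveL S t x₁ x₂) (domainOf (curveL S t x₁ x₂)) w)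
    (hwreal : ∀ y ∈ curveL S t x₁ x₂, (w y).im = 0) :
    ∃ N : Set ℂ, IsOpen N ∧ Convex ℝ N ∧ (∀ z ∈ N, conj z ∈ N) ∧
      (∀ x ∈ Set.Icc x₁ x₂, (x : ℂ) ∈ N) ∧
      (∀ z ∈ N \ ((fun x : ℝ => (x : ℂ)) '' Set.Icc x₁ x₂),
        innerBranch S t x₁ x₂ q₂ q₁ q₀ z ∈ domainOf (curveL S t x₁ x₂) ∧
        AnalyticAt ℂ w (innerBranch S t x₁ x₂ q₂ q₁ q₀ z)) ∧
      DifferentiableOn ℂ (fun z => w (innerBranch S t x₁ x₂ q₂ q₁ q₀ z)) N ∧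
      Set.InjOn (fun z => w (innerBranch S t x₁ x₂ q₂ q₁ q₀ z)) N := by
  obtain ⟨r, R, hr0, -, -, -, -, -, hxr, hball, hcr, -⟩ := hd.exists_radii
  have hx2 : 0 < x₂ := hd.pos.trans hd.lt
  set L := curveL S t x₁ x₂ with hLdef
  set G := domainOf L with hGdef
  set Y := innerBranch S t x₁ x₂ q₂ q₁ q₀ with hYdef
  have hLc : IsClosed L := hd.isClosed_curveL
  have hGo : IsOpen G := isOpen_domainOf hLc
  -- The room for `M` is exactly x₂² r < 1. On the cut |x| ≤ x₂ < M and |x Y(x)| ≤ x₂ r < 1/M, and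
  -- both bounds persist nearby.
  obtain ⟨M, hM1, hM2⟩ : ∃ M, x₂ < M ∧ M < 1 / (x₂ * r) :=
    exists_between (by rw [lt_div_iff₀ (by positivity)]; nlinarith)
  have hM0 : 0 < M := hx2.trans hM1
  have hMr : x₂ * r < 1 / M := by
    rw [lt_div_iff₀ (by positivity)] at hM2 ⊢
    linarith
  obtain ⟨N, hN, hNc, hNconj, hNseg, hNP⟩ := exists_symmetric_nhds (p := x₁) (q := x₂)
    (P := fun z => 0 < z.re ∧ 0 < (cofactor q₂ q₁ q₀ z).re ∧ ‖z‖ < M ∧ ‖z * Y z‖ < 1 / M ∧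
      (Y z ∈ G → AnalyticAt ℂ w (Y z))) (by
    intro x hx
    have e1 : ∀ᶠ z : ℂ in 𝓝 (x : ℂ), 0 < z.re :=
      (Complex.continuous_re.tendsto _).eventually
        (lt_mem_nhds (by simpa using hd.pos_of_mem hx))
    have e2 : ∀ᶠ z : ℂ in 𝓝 (x : ℂ), 0 < (cofactor q₂ q₁ q₀ z).re :=
      ((Complex.continuous_re.comp continuous_cofactor).tendsto _).eventually
        (lt_mem_nhds (by
          simp only [Function.comp]
          rw [cofactor_ofReal, Complex.ofReal_re]
          exact hd.cofactor_pos_of_mem hx))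
    have e3 : ∀ᶠ z : ℂ in 𝓝 (x : ℂ), ‖z‖ < M :=
      (continuous_norm.tendsto _).eventually (gt_mem_nhds (by
        rw [Complex.norm_real, Real.norm_eq_abs, abs_of_pos (hd.pos_of_mem hx)]
        exact hx.2.trans_lt hM1))
    have e4 : ∀ᶠ z : ℂ in 𝓝 (x : ℂ), ‖z * Y z‖ < 1 / M := by
      obtain ⟨ρ, hρ⟩ : ∃ ρ, ρ = ‖upperArc t f g x₁ x₂ q₂ q₁ q₀ x‖ := ⟨_, rfl⟩
      have h1 : x * ρ < 1 / M := by
        refine lt_of_le_of_lt ?_ hMr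
        have h2 := hd.model.sq_mul_coeffC_div_coeffA_le (hd.pos_of_mem hx) hx.2
        rw [← hd.norm_upperArc_sq hx, ← hcr, mul_div_cancel_left₀ _ (hd.model.coeffA_pos hx2).ne',
          ← hρ, ← mul_pow, ← mul_pow] at h2
        exact le_of_sq_le_sq h2 (by positivity)
      have h2 : Tendsto (fun z => ‖Y z‖) (𝓝 (x : ℂ)) (𝓝 ρ) := by
        have h3 : Tendsto (fun z : ℂ => ‖z‖) (𝓝 (upperArc t f g x₁ x₂ q₂ q₁ q₀ x) ⊔
            𝓝 (conj (upperArc t f g x₁ x₂ q₂ q₁ q₀ x))) (𝓝 ρ) := by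
          refine tendsto_sup.2 ⟨?_, ?_⟩
          · rw [hρ]; exact continuous_norm.tendsto _
          · rw [hρ, ← Complex.norm_conj]; exact continuous_norm.tendsto _
        exact h3.comp (hd.tendsto_innerBranch hx)
      have h3 : Tendsto (fun z : ℂ => ‖z‖ * ‖Y z‖) (𝓝 (x : ℂ)) (𝓝 (x * ρ)) := by
        have h4 : Tendsto (fun z : ℂ => ‖z‖) (𝓝 (x : ℂ)) (𝓝 x) := by
          have := continuous_norm.tendsto (x : ℂ)
          rwa [Complex.norm_real, Real.norm_eq_abs, abs_of_pos (hd.pos_of_mem hx)] at this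
        exact h4.mul h2
      filter_upwards [h3.eventually (gt_mem_nhds h1)] with z hz
      rwa [norm_mul]
    have e5 : ∀ᶠ z : ℂ in 𝓝 (x : ℂ), Y z ∈ G → AnalyticAt ℂ w (Y z) := by
      have h1 := eventually_analyticAt_of_tendsto hGo hw.meromorphic
        (hw.boundary_limit _ (hd.upperArc_mem_curveL hx))
      have h2 := eventually_analyticAt_of_tendsto hGo hw.meromorphic
        (hw.boundary_limit _ (hd.conj_upperArc_mem_curveL hx))
      exact (hd.tendsto_innerBranch hx).eventually (mem_sup.2 ⟨h1, h2⟩)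
    filter_upwards [e1, e2, e3, e4, e5] with z h1 h2 h3 h4 h5
    exact ⟨h1, h2, h3, h4, h5⟩)
  set s : Set ℂ := (fun x : ℝ => (x : ℂ)) '' Set.Icc x₁ x₂ with hs
  have hsN : s ⊆ N := by rintro _ ⟨x, hx, rfl⟩; exact hNseg x hx
  have hsreal : ∀ z ∈ s, z.im = 0 := by rintro _ ⟨x, -, rfl⟩; simp
  -- A second root would satisfy z z' Y(z) = 1, but the modulus of this product is less than M ·
  -- (1/M). This gives both injectivity of Y and, taking z' on the cut, avoidance of the curve.
  have hroot : ∀ z ∈ N, ∀ z' ∈ N, z ≠ z' → kernel S t z' (Y z) ≠ 0 := by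
    intro z hz z' hz' hne h0
    obtain ⟨h1, -, -, h4, -⟩ := hNP z hz
    obtain ⟨-, -, h3, -, -⟩ := hNP z' hz'
    have h5 := hd.model.mul_mul_eq_one hne (hd.kernel_innerBranch h1) h0
    have h6 : ‖z * Y z‖ * ‖z'‖ = 1 := by
      rw [← norm_mul, show z * Y z * z' = z * z' * Y z by ring, h5, norm_one]
    have h7 : ‖z * Y z‖ * ‖z'‖ < 1 / M * M :=
      mul_lt_mul'' h4 h3 (norm_nonneg _) (norm_nonneg _)
    rw [one_div_mul_cancel hM0.ne'] at h7
    linarith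
  have hYdiff : ∀ z ∈ N \ s, DifferentiableAt ℂ Y z := fun z hz =>
    hd.differentiableAt_innerBranch (ne_ofReal_of_notMem hz.2) (hNP z hz.1).1 (hNP z hz.1).2.1
  have hYL : ∀ z ∈ N \ s, Y z ∉ L := by
    rintro z hz ⟨x, hx, h0⟩
    exact hroot z hz.1 x (hNseg x hx) (ne_ofReal_of_notMem hz.2 x hx) h0
  have hYinj : Set.InjOn Y (N \ s) := by
    intro z hz z' hz' he
    by_contra hne
    refine hroot z hz.1 z' hz'.1 hne ?_
    have he' : Y z = Y z' := he
    rw [he']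
    exact hd.kernel_innerBranch (hNP z' hz'.1).1
  have hpre : IsPreconnected (Y '' (N \ s)) :=
    (isPreconnected_diff_segment hd.lt.le hN hNc hNseg).image _
      fun z hz => (hYdiff z hz).continuousAt.continuousWithinAt
  -- The image of the slit neighbourhood is connected, avoids `L`, and meets the disc |y| < r just
  -- to the right of x₂.
  have hYG : ∀ z ∈ N \ s, Y z ∈ G := by
    intro z hz
    obtain ⟨x, hxN, hxr, hx⟩ : ∃ x : ℝ, (x : ℂ) ∈ N ∧ ‖Y x‖ < r ∧ x₂ < x := by
      have h1 : ∀ᶠ x : ℝ in 𝓝[>] x₂, (x : ℂ) ∈ N := nhdsWithin_le_nhds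
        ((Complex.continuous_ofReal.tendsto x₂) (hN.mem_nhds (hNseg x₂ hd.right_mem)))
      have h2 : ∀ᶠ x : ℝ in 𝓝[>] x₂, x₂ < x := self_mem_nhdsWithin
      exact (h1.and ((hd.eventually_norm_innerBranch_lt hr0 hcr).and h2)).exists
    have hxs : (x : ℂ) ∉ s := by
      rintro ⟨x', hx', he⟩
      have : x' = x := Complex.ofReal_injective he
      linarith [hx'.2]
    refine mem_domainOf_of_isPreconnected hpre ?_ ⟨x, ⟨hxN, hxs⟩, rfl⟩ ⟨z, hz, rfl⟩
      (hball (by simpa using hxr))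
    rintro _ ⟨z, hz, rfl⟩
    exact hYL z hz
  have hnear : ∀ x ∈ Set.Icc x₁ x₂, ∀ σ : ℝ, σ ≠ 0 →
      ∃ᶠ z in 𝓝[{z : ℂ | 0 < σ * z.im}] (x : ℂ), z ∈ N \ s := by
    intro x hx σ hσ
    have h1 : ∀ᶠ z in 𝓝[{z : ℂ | 0 < σ * z.im}] (x : ℂ), z ∈ N \ s := by
      filter_upwards [self_mem_nhdsWithin, nhdsWithin_le_nhds (hN.mem_nhds (hNseg x hx))] with z h1 h2
      refine ⟨h2, fun h3 => ?_⟩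
      have h1 : 0 < σ * z.im := h1
      rw [hsreal z h3, mul_zero] at h1
      exact lt_irrefl _ h1
    have : (𝓝[{z : ℂ | 0 < σ * z.im}] (x : ℂ)).NeBot := by
      rw [← mem_closure_iff_nhdsWithin_neBot]
      have h2 : Tendsto (fun ε : ℝ => (x : ℂ) + (ε * σ : ℝ) * Complex.I) (𝓝[>] 0) (𝓝 (x : ℂ)) := by
        have h : Continuous fun ε : ℝ => (x : ℂ) + (ε * σ : ℝ) * Complex.I := by fun_prop
        have h0 := h.tendsto 0
        simp only [Complex.ofReal_zero, zero_mul, add_zero] at h0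
        exact h0.mono_left nhdsWithin_le_nhds
      refine mem_closure_of_tendsto h2 ?_
      filter_upwards [self_mem_nhdsWithin] with ε hε
      have hε : 0 < ε := hε
      have : 0 < σ * (ε * σ) := by
        have := mul_self_pos.2 hσ
        nlinarith
      simpa using this
    exact h1.frequently
  have hLG : L ⊆ closure G := by
    intro y hy
    obtain ⟨x, hx, rfl | rfl⟩ := hd.mem_curveL_iff.1 hy
    · refine mem_closure_of_frequently_of_tendsto (f := Y) ((hnear x hx (-1) (by norm_num)).mono
        hYG) ?_
      convert hd.tendsto_innerBranch_lower hx using 3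
      ext z; simp
    · refine mem_closure_of_frequently_of_tendsto (f := Y) ((hnear x hx 1 (by norm_num)).mono
        hYG) ?_
      convert hd.tendsto_innerBranch_upper hx using 3
      ext z; simp
  have hYseg : ∀ x ∈ Set.Icc x₁ x₂, Y x ∈ L := fun x hx => by
    rw [hYdef, hd.innerBranch_ofReal hx]; exact hd.upperArc_mem_curveL hx
  -- On the cut Y jumps between conjugate points of the curve, and the gluing condition removes the
  -- jump of `w` along Y.
  have hcont : ContinuousOn (fun z => w (Y z)) N := by
    intro z hz
    refine ContinuousAt.continuousWithinAt ?_
    by_cases hzs : z ∈ s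
    · obtain ⟨x, hx, rfl⟩ := hzs
      have h1 : Tendsto Y (𝓝 (x : ℂ)) (𝓝[G ∪ L] (upperArc t f g x₁ x₂ q₂ q₁ q₀ x) ⊔
          𝓝[G ∪ L] (conj (upperArc t f g x₁ x₂ q₂ q₁ q₀ x))) := by
        simp only [nhdsWithin]
        rw [← inf_sup_right, tendsto_inf]
        refine ⟨hd.tendsto_innerBranch hx, tendsto_principal.2 ?_⟩
        filter_upwards [hN.mem_nhds hz] with z hz
        by_cases hzs : z ∈ s
        · obtain ⟨x, hx, rfl⟩ := hzs
          exact Or.inr (hYseg x hx)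
        · exact Or.inl (hYG z ⟨hz, hzs⟩)
      have h2 : w (Y x) = w (upperArc t f g x₁ x₂ q₂ q₁ q₀ x) := by
        rw [hYdef, hd.innerBranch_ofReal hx]
      have h3 := tendsto_of_boundary_limit hw.boundary_limit hLG (hd.upperArc_mem_curveL hx)
      have h4 := tendsto_of_boundary_limit hw.boundary_limit hLG (hd.conj_upperArc_mem_curveL hx)
      rw [← hw.glue _ (hd.upperArc_mem_curveL hx)] at h4
      show Tendsto (fun z => w (Y z)) (𝓝 (x : ℂ)) (𝓝 (w (Y x)))
      rw [h2]
      exact (tendsto_sup.2 ⟨h3, h4⟩).comp h1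
    · have h1 := hYdiff z ⟨hz, hzs⟩
      have h2 := (hNP z hz).2.2.2.2 (hYG z ⟨hz, hzs⟩)
      exact ContinuousAt.comp (f := Y) h2.continuousAt h1.continuousAt
  have hdiff : DifferentiableOn ℂ (fun z => w (Y z)) N := by
    refine differentiableOn_of_differentiableAt_of_im_ne_zero hN hcont fun z hz hzi => ?_
    have hzs : z ∈ N \ s := ⟨hz, fun h => hzi (hsreal z h)⟩
    have h2 := (hNP z hz).2.2.2.2 (hYG z hzs)
    exact DifferentiableAt.comp (f := Y) z h2.differentiableAt (hYdiff z hzs)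
  have hinj : Set.InjOn (fun z => w (Y z)) (N \ s) := by
    intro z hz z' hz' he
    refine hYinj hz hz' (hw.injOn (hYG z hz) (hYG z' hz') ?_)
    rw [sphereValue_of_analyticAt ((hNP z hz.1).2.2.2.2 (hYG z hz)),
      sphereValue_of_analyticAt ((hNP z' hz'.1).2.2.2.2 (hYG z' hz'))]
    exact congrArg _ he
  refine ⟨N, hN, hNc, hNconj, hNseg, fun z hz => ⟨hYG z hz, (hNP z hz.1).2.2.2.2 (hYG z hz)⟩,
    hdiff, injOn_of_injOn_diff hN hdiff hinj hsreal ?_⟩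
  rintro _ ⟨x, hx, rfl⟩
  exact hwreal _ (hYseg x hx)

end IsBranchData

/-! ### Image of the cut and orientation of its sides. -/

section Segment

variable {N : Set ℂ} {W : ℂ → ℂ} {p q : ℝ}

theorem map_endpoints_ne (hinj : Set.InjOn W N) (hpq : p < q)
    (hseg : ∀ x ∈ Set.Icc p q, (x : ℂ) ∈ N) : W q ≠ W p := fun h =>
  hpq.ne' (Complex.ofReal_injective
    (hinj (hseg q ⟨hpq.le, le_rfl⟩) (hseg p ⟨le_rfl, hpq.le⟩) h))

theorem im_normalized_eq_zero {A B z : ℂ} (hA : A.im = 0) (hB : B.im = 0) (hz : z.im = 0) :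
    ((z - A) / (B - A)).im = 0 := by
  rw [← Complex.conj_eq_iff_im] at *
  rw [map_div₀, map_sub, map_sub, hA, hB, hz]

/-- An injective holomorphic map that is real on `[p, q]` maps it onto the segment between the
images of the ends. -/
theorem image_Icc_eq_segment (hd : DifferentiableOn ℂ W N)
    (hinj : Set.InjOn W N) (hpq : p < q) (hseg : ∀ x ∈ Set.Icc p q, (x : ℂ) ∈ N)
    (hreal : ∀ x ∈ Set.Icc p q, (W (x : ℂ)).im = 0) :
    (fun x : ℝ => W x) '' Set.Icc p q = segment ℝ (W q) (W p) := by
  have hp : p ∈ Set.Icc p q := ⟨le_rfl, hpq.le⟩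
  have hq : q ∈ Set.Icc p q := ⟨hpq.le, le_rfl⟩
  have hne : W p - W q ≠ 0 := sub_ne_zero.2 (map_endpoints_ne hinj hpq hseg).symm
  set τ : ℝ → ℝ := fun x => ((W x - W q) / (W p - W q)).re with hτ
  have hW : ∀ x ∈ Set.Icc p q, W x = W q + (τ x : ℂ) * (W p - W q) := by
    intro x hx
    have h1 : ((τ x : ℝ) : ℂ) = (W x - W q) / (W p - W q) := by
      refine Complex.ext (by simp [hτ]) ?_
      rw [im_normalized_eq_zero (hreal q hq) (hreal p hp) (hreal x hx), Complex.ofReal_im]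
    rw [h1, div_mul_cancel₀ _ hne]
    ring
  have hcont : ContinuousOn τ (Set.Icc p q) := by
    have h1 : ContinuousOn (fun x : ℝ => W x) (Set.Icc p q) :=
      hd.continuousOn.comp Complex.continuous_ofReal.continuousOn hseg
    exact Complex.continuous_re.comp_continuousOn ((h1.sub continuousOn_const).div_const _)
  have hτinj : Set.InjOn τ (Set.Icc p q) := by
    intro x hx y hy he
    refine Complex.ofReal_injective (hinj (hseg x hx) (hseg y hy) ?_)
    rw [hW x hx, hW y hy, he]
  have hτp : τ p = 1 := by simp [hτ, div_self hne]
  have hτq : τ q = 0 := by simp [hτ]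
  have hanti : StrictAntiOn τ (Set.Icc p q) := by
    rcases hcont.strictMonoOn_of_injOn_Icc' hpq.le hτinj with h | h
    · have := h hp hq hpq
      rw [hτp, hτq] at this
      linarith
    · exact h
  rw [segment_eq_image']
  ext u
  constructor
  · rintro ⟨x, hx, rfl⟩
    refine ⟨τ x, ⟨?_, ?_⟩, ?_⟩
    · rw [← hτq]; exact hanti.antitoneOn hx hq hx.2
    · rw [← hτp]; exact hanti.antitoneOn hp hx hx.1
    · simp only [Complex.real_smul]
      exact (hW x hx).symm
  · rintro ⟨θ, hθ, rfl⟩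
    have h1 := intermediate_value_Icc' hpq.le hcont
    rw [hτp, hτq] at h1
    obtain ⟨x, hx, rfl⟩ := h1 hθ
    refine ⟨x, hx, ?_⟩
    simp only [Complex.real_smul]
    exact hW x hx

/-- An injective holomorphic map that is real on `[p, q]` exchanges the sides of `[p, q]` with
those of the image segment, oriented from the image of `q` to the image of `p`. -/
theorem im_neg_of_mem_leftSide_and_im_pos_of_mem_rightSide (hN : IsOpen N) (hNc : Convex ℝ N)
    (hconj : ∀ z ∈ N, conj z ∈ N) (hd : DifferentiableOn ℂ W N) (hinj : Set.InjOn W N)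
    (hpq : p < q) (hseg : ∀ x ∈ Set.Icc p q, (x : ℂ) ∈ N)
    (hreal : ∀ x ∈ Set.Icc p q, (W (x : ℂ)).im = 0) {z : ℂ} (hz : z ∈ N) :
    (W z ∈ leftSide (W q) (W p) → z.im < 0) ∧ (W z ∈ rightSide (W q) (W p) → 0 < z.im) := by
  have hp : p ∈ Set.Icc p q := ⟨le_rfl, hpq.le⟩
  have hq : q ∈ Set.Icc p q := ⟨hpq.le, le_rfl⟩
  have hne : W p - W q ≠ 0 := sub_ne_zero.2 (map_endpoints_ne hinj hpq hseg).symm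
  have hTd : DifferentiableOn ℂ (fun z => (W z - W q) / (W p - W q)) N :=
    (hd.sub_const _).div_const _
  have hTreal : ∀ x ∈ Set.Icc p q, ((W x - W q) / (W p - W q)).im = 0 := fun x hx =>
    im_normalized_eq_zero (hreal q hq) (hreal p hp) (hreal x hx)
  have hTinj : Set.InjOn (fun z => (W z - W q) / (W p - W q)) N := fun x hx y hy he =>
    hinj hx hy (sub_left_injective ((div_left_inj' hne).1 he))
  have hpos : ∀ z ∈ N, z.im < 0 → 0 < ((W z - W q) / (W p - W q)).im := fun z hz hz0 =>
    im_pos_of_im_neg hN hNc hconj hTd hTinj hpq hseg hTreal (div_self hne) (by simp) hz hz0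
  have hsymm : (W (conj z) - W q) / (W p - W q) = conj ((W z - W q) / (W p - W q)) :=
    map_conj_eq_conj_map hN hNc.isPreconnected hconj hTd hpq hseg hTreal hz
  have hzero : z.im = 0 → ((W z - W q) / (W p - W q)).im = 0 := fun h => by
    rw [Complex.conj_eq_iff_im.2 h] at hsymm
    exact Complex.conj_eq_iff_im.1 hsymm.symm
  have hneg : 0 < z.im → ((W z - W q) / (W p - W q)).im < 0 := fun h => by
    have h1 := hpos _ (hconj z hz) (by simpa using h)
    rw [hsymm, Complex.conj_im] at h1
    linarith
  simp only [leftSide, rightSide, Set.mem_ofPred_eq]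
  constructor
  · intro h
    by_contra! h1
    rcases h1.eq_or_lt with h2 | h2
    · exact h.ne' (hzero h2.symm)
    · exact lt_asymm h (hneg h2)
  · intro h
    by_contra! h1
    rcases h1.eq_or_lt with h2 | h2
    · exact h.ne (hzero h2)
    · exact lt_asymm h (hpos z hz h2)

end Segment

/-! ### Zeros inside the curve and one-sided limits of the inverse. -/

namespace IsBranchData

variable {S : Finset (ℤ × ℤ)} {t f g h x₁ x₂ q₂ q₁ q₀ : ℝ}

theorem upperArc_mem_upperSlit (hd : IsBranchData S t f g h x₁ x₂ q₂ q₁ q₀) {r R a b c : ℝ}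
    (h₁ : upperArc t f g x₁ x₂ q₂ q₁ q₀ x₁ = ((-R : ℝ) : ℂ))
    (h₂ : upperArc t f g x₁ x₂ q₂ q₁ q₀ x₂ = (r : ℂ)) (hR : -R < a) (hbr : b < r) (hrc : r < c)
    {x : ℝ} (hx : x ∈ Set.Icc x₁ x₂) :
    upperArc t f g x₁ x₂ q₂ q₁ q₀ x ∈ upperSlit a b c := by
  refine ⟨hd.upperArc_im_nonneg hx, fun h0 => ?_⟩
  rcases hd.eq_or_eq_of_upperArc_im hx h0 with rfl | rfl
  · rw [h₁]; exact Or.inl hR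
  · rw [h₂]; exact Or.inr ⟨hbr, hrc⟩

/-- The zeros of `d̃` in the domain bounded by the curve. -/
theorem discTilde_zeros_eq (hd : IsBranchData S t f g h x₁ x₂ q₂ q₁ q₀) {r R y₁ y₂ y₃ : ℝ}
    (hR0 : 0 < R) (h₁ : upperArc t f g x₁ x₂ q₂ q₁ q₀ x₁ = ((-R : ℝ) : ℂ))
    (h₂ : upperArc t f g x₁ x₂ q₂ q₁ q₀ x₂ = (r : ℂ))
    (hball : Metric.ball 0 r ⊆ domainOf (curveL S t x₁ x₂)) (hy₁ : 0 ≤ y₁) (hlt : y₁ < y₂)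
    (hr : y₂ < r) (hry : r < y₃) (hz₁ : discTilde S t y₁ = 0) (hz₂ : discTilde S t y₂ = 0)
    (hzeros : ∀ z : ℂ, discTilde S t z = 0 → z = y₁ ∨ z = y₂ ∨ ∃ s : ℝ, y₃ ≤ s ∧ z = s) :
    {y ∈ domainOf (curveL S t x₁ x₂) | discTilde S t y = 0} = {(y₁ : ℂ), (y₂ : ℂ)} := by
  have hmem : ∀ y : ℝ, 0 ≤ y → y < r → (y : ℂ) ∈ domainOf (curveL S t x₁ x₂) := fun y h0 hyr =>
    hball (by simpa [abs_of_nonneg h0] using hyr)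
  ext z
  constructor
  · rintro ⟨hzG, hz⟩
    rcases hzeros z hz with h | h | ⟨s, hs, rfl⟩
    · exact Or.inl h
    · exact Or.inr h
    -- The curve meets the real axis only at -R and r, both below y₃, so the real ray from s to +∞
    -- avoids it.
    · refine absurd hzG (ofReal_notMem_domainOf fun s' hs' hL => ?_)
      obtain ⟨x, hx, he⟩ := hd.mem_curveL_iff.1 hL
      have he' : upperArc t f g x₁ x₂ q₂ q₁ q₀ x = (s' : ℂ) := by
        rcases he with he | he
        · exact he.symm
        · rw [← Complex.conj_conj (upperArc t f g x₁ x₂ q₂ q₁ q₀ x), ← he, Complex.conj_ofReal]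
      rcases hd.eq_or_eq_of_upperArc_im hx (by rw [he']; simp) with rfl | rfl
      · have : -R = s' := Complex.ofReal_injective (h₁.symm.trans he')
        linarith
      · have : r = s' := Complex.ofReal_injective (h₂.symm.trans he')
        linarith
  · rintro (rfl | rfl)
    · exact ⟨hmem y₁ hy₁ (hlt.trans hr), hz₁⟩
    · exact ⟨hmem y₂ (hy₁.trans hlt.le) hr, hz₂⟩

/-- The one-sided limits of the inverse of the gluing function along the image of the curve. -/
theorem exists_inverse_limits (hd : IsBranchData S t f g h x₁ x₂ q₂ q₁ q₀) {w : ℂ → ℂ}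
    (hw : IsConformalGluing (curveL S t x₁ x₂) (domainOf (curveL S t x₁ x₂)) w)
    (hwreal : ∀ y ∈ curveL S t x₁ x₂, (w y).im = 0) {A B : ℂ}
    (hA : A = w (upperArc t f g x₁ x₂ q₂ q₁ q₀ x₂))
    (hB : B = w (upperArc t f g x₁ x₂ q₂ q₁ q₀ x₁)) :
    A ≠ B ∧ w '' curveL S t x₁ x₂ = segment ℝ A B ∧
    ∃ ξ : ℂ → ℝ, ContinuousOn ξ (segment ℝ A B) ∧ ξ A = x₂ ∧ ξ B = x₁ ∧
      ∀ u ∈ segment ℝ A B, ξ u ∈ Set.Icc x₁ x₂ ∧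
        Tendsto (inverseOn (domainOf (curveL S t x₁ x₂)) w) (𝓝[leftSide A B] u)
          (𝓝 (upperArc t f g x₁ x₂ q₂ q₁ q₀ (ξ u))) ∧
        Tendsto (inverseOn (domainOf (curveL S t x₁ x₂)) w) (𝓝[rightSide A B] u)
          (𝓝 (conj (upperArc t f g x₁ x₂ q₂ q₁ q₀ (ξ u)))) := by
  obtain ⟨N, hN, hNc, hNconj, hNseg, hNG, hWd, hWinj⟩ := hd.exists_uniformization hw hwreal
  set L := curveL S t x₁ x₂ with hL
  set Y := innerBranch S t x₁ x₂ q₂ q₁ q₀ with hY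
  set W : ℂ → ℂ := fun z => w (Y z) with hW
  have hWseg : ∀ x ∈ Set.Icc x₁ x₂, W x = w (upperArc t f g x₁ x₂ q₂ q₁ q₀ x) := fun x hx => by
    rw [hW]; simp only; rw [hY, hd.innerBranch_ofReal hx]
  have hWreal : ∀ x ∈ Set.Icc x₁ x₂, (W x).im = 0 := fun x hx => by
    rw [hWseg x hx]; exact hwreal _ (hd.upperArc_mem_curveL hx)
  rw [← hWseg x₂ hd.right_mem] at hA
  rw [← hWseg x₁ hd.left_mem] at hB
  have himage := image_Icc_eq_segment hWd hWinj hd.lt hNseg hWreal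
  rw [← hA, ← hB] at himage
  have hside := fun z hz => im_neg_of_mem_leftSide_and_im_pos_of_mem_rightSide hN hNc hNconj hWd
    hWinj hd.lt hNseg hWreal (z := z) hz
  rw [← hA, ← hB] at hside
  have hwL : w '' L = segment ℝ A B := by
    rw [← himage]
    ext u
    constructor
    · rintro ⟨y, hy, rfl⟩
      obtain ⟨x, hx, rfl | rfl⟩ := hd.mem_curveL_iff.1 hy
      · exact ⟨x, hx, hWseg x hx⟩
      · exact ⟨x, hx, (hWseg x hx).trans (hw.glue _ (hd.upperArc_mem_curveL hx))⟩
    · rintro ⟨x, hx, rfl⟩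
      exact ⟨_, hd.upperArc_mem_curveL hx, (hWseg x hx).symm⟩
  set V := Function.invFunOn W N with hV
  have hVW : ∀ z ∈ N, V (W z) = z := fun z hz => hWinj.leftInvOn_invFunOn hz
  have hVt : ∀ z ∈ N, Tendsto V (𝓝 (W z)) (𝓝 z) := fun z hz =>
    tendsto_invFunOn (s := ∅) hN hWd hWinj (by simp) hz
  have hnear : ∀ z ∈ N, ∀ᶠ u in 𝓝 (W z), V u ∈ N ∧ W (V u) = u := by
    intro z hz
    filter_upwards [image_mem_nhds_of_injOn (s := ∅) hN hWd (hWinj.mono Set.sdiff_subset)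
      (by simp) hz (hN.mem_nhds hz)]
    rintro _ ⟨z', hz', rfl⟩
    rw [hVW z' hz']
    exact ⟨hz', rfl⟩
  -- Off the real axis Y(z) lies in the domain and is not a pole of `w`, so inverting `w` at W z
  -- recovers Y(z).
  have hinv : ∀ z ∈ N, z.im ≠ 0 → inverseOn (domainOf L) w (W z) = Y z := by
    intro z hz hzi
    obtain ⟨h1, h2⟩ := hNG z ⟨hz, by rintro ⟨x, -, rfl⟩; simp at hzi⟩
    rw [inverseOn, ← sphereValue_of_analyticAt h2]
    exact hw.injOn.leftInvOn_invFunOn h1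
  have hVx : ∀ x ∈ Set.Icc x₁ x₂, (V (W x)).re = x := fun x hx => by
    rw [hVW _ (hNseg x hx), Complex.ofReal_re]
  -- The inverse of w ∘ Y is real on the segment, so its real part is the cut parameter there.
  refine ⟨?_, hwL, fun u => (V u).re, ?_, ?_, ?_, ?_⟩
  · rw [hA, hB]
    exact map_endpoints_ne hWinj hd.lt hNseg
  · rw [← himage]
    rintro _ ⟨x, hx, rfl⟩
    have h1 := hVt _ (hNseg x hx)
    refine ContinuousAt.continuousWithinAt ?_
    simp only [ContinuousAt]
    rw [hVx x hx, ← Complex.ofReal_re x]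
    exact (Complex.continuous_re.tendsto _).comp h1
  · simp only
    rw [hA, hVx _ hd.right_mem]
  · simp only
    rw [hB, hVx _ hd.left_mem]
  · rw [← himage]
    rintro _ ⟨x, hx, rfl⟩
    have hxN := hNseg x hx
    simp only
    rw [hVx x hx]
    refine ⟨hx, ?_, ?_⟩
    · have h1 : ∀ᶠ u in 𝓝[leftSide A B] (W x),
          (V u).im < 0 ∧ Y (V u) = inverseOn (domainOf L) w u := by
        filter_upwards [nhdsWithin_le_nhds (hnear _ hxN), self_mem_nhdsWithin] with u hu hus
        have h2 : (V u).im < 0 := (hside _ hu.1).1 (by rwa [hu.2])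
        refine ⟨h2, ?_⟩
        rw [← hinv _ hu.1 h2.ne, hu.2]
      refine Tendsto.congr' (h1.mono fun u hu => hu.2)
        ((hd.tendsto_innerBranch_lower hx).comp (tendsto_nhdsWithin_iff.2 ⟨?_, h1.mono
          fun u hu => hu.1⟩))
      exact (hVt _ hxN).mono_left nhdsWithin_le_nhds
    · have h1 : ∀ᶠ u in 𝓝[rightSide A B] (W x),
          0 < (V u).im ∧ Y (V u) = inverseOn (domainOf L) w u := by
        filter_upwards [nhdsWithin_le_nhds (hnear _ hxN), self_mem_nhdsWithin] with u hu hus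
        have h2 : 0 < (V u).im := (hside _ hu.1).2 (by rwa [hu.2])
        refine ⟨h2, ?_⟩
        rw [← hinv _ hu.1 h2.ne', hu.2]
      refine Tendsto.congr' (h1.mono fun u hu => hu.2)
        ((hd.tendsto_innerBranch_upper hx).comp (tendsto_nhdsWithin_iff.2 ⟨?_, h1.mono
          fun u hu => hu.1⟩))
      exact (hVt _ hxN).mono_left nhdsWithin_le_nhds

end IsBranchData

namespace IsKernelModel

variable {S : Finset (ℤ × ℤ)} {t f g h : ℝ}

theorem disc_ofReal_eq_zero_iff (hm : IsKernelModel S t 1 f g h) (x : ℝ) :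
    disc S t x = 0 ↔ discPoly t f g h x = 0 := by
  rw [hm.disc_eq_discPoly, ← ofReal_discPoly, Complex.ofReal_eq_zero]

theorem discTilde_ofReal_eq_zero_iff (hm : IsKernelModel S t 1 f g h) (y : ℝ) :
    discTilde S t y = 0 ↔ discTildePoly t f g h y = 0 := by
  rw [hm.discTilde_eq_discTildePoly, ← ofReal_discTildePoly, Complex.ofReal_eq_zero]

theorem exists_isBranchData (hm : IsKernelModel S t 1 f g h) {x₁ x₂ : ℝ}
    (hx : IsInnerBranchPair (disc S t) x₁ x₂) :
    ∃ q₂ q₁ q₀ : ℝ, IsBranchData S t f g h x₁ x₂ q₂ q₁ q₀ := by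
  have e1 := (hm.disc_ofReal_eq_zero_iff x₁).1 hx.left_zero
  have e2 := (hm.disc_ofReal_eq_zero_iff x₂).1 hx.right_zero
  obtain ⟨h0, q₂, q₁, q₀, -, hq, hpos⟩ :=
    hm.isWeights.exists_disc_factor hx.lt hx.left_mem hx.right_mem e1 e2
  obtain ⟨b1, b2⟩ := hm.isWeights.coeffB_sign hx.lt hx.left_mem hx.right_mem e1 e2
  exact ⟨q₂, q₁, q₀, hm, h0, hx.lt, hx.right_mem.2,
    fun z => (hm.disc_eq_discPoly z).trans (hq z), hpos, b1, b2⟩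

end IsKernelModel

end ThreeQuadrant

end

/-! ### The main theorem. -/

open ThreeQuadrant in
theorem proposition3p4
    (Shat : Finset (ℤ × ℤ)) (hShat : IsSymmetricModel Shat)
    (S : Finset (ℤ × ℤ)) (hS : S = changeSteps Shat)
    (t : ℝ) (ht0 : 0 < t) (ht1 : t < 1 / (S.card : ℝ))
    -- the branch points
    (x₁ x₂ : ℝ) (hx : IsInnerBranchPair (disc S t) x₁ x₂)
    (y₁ y₂ : ℝ) (hy : IsInnerBranchPair (discTilde S t) y₁ y₂)
    (y₃ : ℝ) (hy₃ : IsThirdBranchPoint (discTilde S t) y₃)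
    -- the curve `L`, which is a closed curve, and its interior `G`
    (L G : Set ℂ) (hL : L = curveL S t x₁ x₂) (hLb : Bornology.IsBounded L) (hG : G = domainOf L)
    -- a conformal gluing function sending `L` into the real line, and the ends of `U = w(L)`
    (w : ℂ → ℂ) (hw : IsConformalGluing L G w) (hwreal : ∀ y ∈ L, (w y).im = 0)
    (A B : ℂ) (hA : A = w (branchValue S t x₂)) (hB : B = w (branchValue S t x₁)) :
    {y ∈ G | discTilde S t y = 0} = {(y₁ : ℂ), (y₂ : ℂ)} ∧
    A ≠ B ∧ w '' L = segment ℝ A B ∧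
    ∃ vp vm : ℂ → ℂ,
      (∀ u ∈ w '' L,
        Tendsto (inverseOn G w) (𝓝[leftSide A B] u) (𝓝 (vp u)) ∧
        Tendsto (inverseOn G w) (𝓝[rightSide A B] u) (𝓝 (vm u))) ∧
      HasIndex
        (fun u => sqrtDiscTilde S t y₁ y₂ y₃ (vm u) / sqrtDiscTilde S t y₁ y₂ y₃ (vp u))
        A B (-1) := by
  subst hG hL
  obtain ⟨e, f, g, h, hm⟩ := exists_isKernelModel hShat hS ht0 ht1
  obtain rfl := hm.e_eq_one hx hLb
  obtain ⟨q₂, q₁, q₀, hd⟩ := hm.exists_isBranchData hx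
  have e1 := (hm.discTilde_ofReal_eq_zero_iff y₁).1 hy.left_zero
  have e2 := (hm.discTilde_ofReal_eq_zero_iff y₂).1 hy.right_zero
  have h3 : IsLeast {y : ℝ | 1 < y ∧ discTildePoly t f g h y = 0} y₃ := by
    simpa only [IsThirdBranchPoint, hm.discTilde_ofReal_eq_zero_iff] using hy₃
  obtain ⟨hy0, p, q, hpq, hppos, hzeros⟩ :=
    hm.isWeights.exists_discTilde_factor hy.lt hy.right_mem.2 e1 e2 h3
  simp only [← hm.discTilde_eq_discTildePoly] at hpq hzeros
  obtain ⟨r, R, hr0, hrR, hu1, hu2, hb1, hb2, hxr, hball, -, hK⟩ := hd.exists_radii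
  have hR0 : 0 < R := hr0.trans hrR
  -- No zero of d̃ lies between r and 1. As y₂ < 1 < y₃, this places r strictly between y₂ and y₃,
  -- on whichever side of 1 it lies.
  have hpos : ∀ y ∈ Set.uIcc r 1, 0 < discTildePoly t f g h y := fun y hy' =>
    hm.isWeights.discTildePoly_pos (hd.pos.trans hd.lt) hr0 hK hxr.ne hy'
  have hy2r : y₂ < r := by
    by_contra! hle
    exact (hpos y₂ (Set.mem_uIcc.2 (Or.inl ⟨hle, hy.right_mem.2.le⟩))).ne' e2
  have hry3 : r < y₃ := by
    by_contra! hle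
    exact (hpos y₃ (Set.mem_uIcc.2 (Or.inr ⟨h3.1.1.le, hle⟩))).ne' h3.1.2
  rw [hb2, ← hu2] at hA
  rw [hb1, ← hu1] at hB
  obtain ⟨hAB, hseg, ξ, hξc, hξA, hξB, hξ⟩ := hd.exists_inverse_limits hw hwreal hA hB
  refine ⟨hd.discTilde_zeros_eq hR0 hu1 hu2 hball hy0 hy.lt hy2r hry3 hy.left_zero hy.right_zero
    hzeros, hAB, hseg, fun u => upperArc t f g x₁ x₂ q₂ q₁ q₀ (ξ u),
    fun u => starRingEnd ℂ (upperArc t f g x₁ x₂ q₂ q₁ q₀ (ξ u)), ?_, ?_⟩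
  · rw [hseg]
    exact fun u hu => (hξ u hu).2
  · have hmaps : ∀ s ∈ Set.Icc (0 : ℝ) 1, A + s * (B - A) ∈ segment ℝ A B := fun s hs => by
      rw [segment_eq_image']
      exact ⟨s, hs, by simp⟩
    -- Oriented from A to B, the left limits follow the upper arc from r in (y₂, y₃) to -R, which is
    -- below y₁ because y₁ ≥ 0.
    refine hasIndex_of_arc
      (γ := fun s => upperArc t f g x₁ x₂ q₂ q₁ q₀ (ξ (A + s * (B - A))))
      (r₀ := r) (r₁ := -R) hy.lt (hy2r.trans hry3) hppos hpq ?_ ?_ (fun s _ => rfl)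
      (fun s _ => rfl) ?_ ⟨hy2r, hry3⟩ ?_ (by linarith)
    · refine hd.continuousOn_upperArc.comp (hξc.comp ?_ hmaps) fun s hs => (hξ _ (hmaps s hs)).1
      fun_prop
    · exact fun s hs => hd.upperArc_mem_upperSlit hu1 hu2 (by linarith) hy2r hry3
        (hξ _ (hmaps s hs)).1
    · simp [hξA, hu2]
    · simp [hξB, hu1]
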